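/- **Conventions.** $\mathbf{C}^*$ is the category of (not necessarily unital) complex $C^*$-algebras and $*$-homomorphisms, $\otimes$ is the maximal tensor product, $0$ is the zero algebra, $\oplus$ is the direct product. A *labeled endofunctor* is a functor $F:\mathbf{C}^*\to\mathbf{C}^*$ with $*$-homomorphisms $\kappa^F_{A,B}: A\otimes FB\to F(A\otimes B)$, natural in $A$ and $B$, such that, up to the canonical isomorphisms $A\otimes(A'\otimes B)\cong(A\otimes A')\otimes B$ and $B\cong\mathbb{C}\otimes B$, one has $\kappa^F_{A\otimes A',B}=\kappa^F_{A,A'\otimes B}\circ(\mathrm{id}_A\otimes\kappa^F_{A',B})$, and $\kappa^F_{\mathbb{C},B}$ is the identity of $FB$. A natural transformation $\alpha:F\Rightarrow G$ is *labeled* if $\alpha_{A\otimes B}\circ\kappa^F_{A,B}=\kappa^G_{A,B}\circ(\mathrm{id}_A\otimes\alpha_B)$ for all $A,B$. The labeled endofunctor $F$ is *good* if $F0\cong 0$ and $F$ preserves the pullback of every cospan $A\xrightarrow{f}C\xleftarrow{g}B$ in which $g$ is a split epimorphism. $\mathbf{GEFC}$ is the category of good labeled endofunctors and labeled natural transformations.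 A *bimonoidal category* is a category with a symmetric monoidal structure $(\oplus,0)$, a monoidal structure $(\otimes,1)$, natural isomorphisms $0\otimes A\to 0$ and $A\otimes 0\to 0$, and natural monomorphisms $A\otimes(B\oplus B')\to(A\otimes B)\oplus(A\otimes B')$ and $(B\oplus B')\otimes A\to(B\otimes A)\oplus(B'\otimes A)$ satisfying Laplaza's coherence axioms (those that do not involve a symmetry of $\otimes$). It is *tight* if the distributivity morphisms are isomorphisms; its multiplicative structure is *strict* if the associators and unitors of $\otimes$ are identities. A *bimonoidal congruence* is a family of equivalence relations on the hom-sets that is compatible with composition, with $\otimes$ and with $\oplus$; the quotient category then inherits all the operations and structure morphisms. On $\mathbf{GEFC}$ the multiplicative structure is composition: $F\cdot G=F\circ G$ with labeling $F(\kappa^G_{A,B})\circ\kappa^F_{A,GB}$, horizontal composition of transformations, and unit $\mathrm{Id}$. The additive structure is the cartesian one: $(F\oplus G)B=FB\oplus GB$ with the labeling given by the two coordinates, and neutral object the zero functor. The distributivity morphisms and multiplicative zeros are the canonical morphisms into products and into the zero functor. The *cylinder functor* is $IB=C([0,1],B)$ with labeling $a\otimes f\mapsto(t\mapsto a\otimes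 f(t))$; evaluation at $t\in[0,1]$ is a labeled natural transformation $\mathrm{ev}_t:I\Rightarrow\mathrm{Id}$. Labeled natural transformations $\gamma_0,\gamma_1:F\Rightarrow G$ between good endofunctors are *homotopic*, $\gamma_0\simeq\gamma_1$, if there is a labeled natural transformation $\Gamma:F\Rightarrow GI$ with $G(\mathrm{ev}_j)\circ\Gamma=\gamma_j$ for $j=0,1$. **Proposition 4.51.** With these structures $\mathbf{GEFC}$ is a tight bimonoidal category with strict multiplicative structure, $\simeq$ is a bimonoidal congruence on $\mathbf{GEFC}$, and the quotient $\mathbf{hGEFC}=\mathbf{GEFC}/{\simeq}$, with the induced structure, is a tight bimonoidal category with strict multiplicative structure. -/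

import Mathlib

open scoped TensorProduct
open CategoryTheory

set_option linter.unusedSectionVars false

universe u v

noncomputable section

section Completion

variable {R : Type u} [NonUnitalRing R] [Module ℂ R] [StarRing R]

/-- A C⋆-seminorm on a complex ⋆-algebra: a submultiplicative seminorm satisfying the
C⋆-identity. -/
structure CStarSeminorm (R : Type u) [NonUnitalRing R] [Module ℂ R] [StarRing R] extends
    Seminorm ℂ R where
  mul_le' : ∀ x y, toFun (x * y) ≤ toFun x * toFun y
  cstar' : ∀ x, toFun (star x * x) = toFun x * toFun x

namespace CStarSeminorm

instance : CoeFun (CStarSeminorm R) fun _ => R → ℝ := ⟨fun p => p.toSeminorm⟩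

variable (p : CStarSeminorm R)

lemma mul_le (x y : R) : p (x * y) ≤ p x * p y := p.mul_le' x y

lemma cstar (x : R) : p (star x * x) = p x * p x := p.cstar' x

lemma nonneg (x : R) : 0 ≤ p x := apply_nonneg p.toSeminorm x

lemma star_eq (x : R) : p (star x) = p x := by
  have key : ∀ y : R, p y ≤ p (star y) := fun y => by
    by_contra! h
    have h1 := p.cstar y
    have h2 := p.mul_le (star y) y
    have h3 := p.nonneg (star y)
    nlinarith
  exact le_antisymm (by simpa using key (star x)) (key x)

/-- The underlying ⋆-algebra, regarded as seminormed by `p`. -/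
def Pre (_p : CStarSeminorm R) : Type u := R

/-- The ring structure of the copy. -/
abbrev preRing : NonUnitalRing (Pre p) := inferInstanceAs (NonUnitalRing R)

/-- The vector space structure of the copy. -/
abbrev preModule : @Module ℂ (Pre p) _ (preRing p).toAddCommGroup.toAddCommMonoid :=
  inferInstanceAs (Module ℂ R)

/-- `p` as a seminorm on the copy. -/
def preSeminorm : @AddGroupSeminorm (Pre p) (preRing p).toAddCommGroup.toAddGroup :=
  p.toSeminorm.toAddGroupSeminorm

instance : NonUnitalSeminormedRing (Pre p) :=
  letI := preRing p
  { preRing p, (preSeminorm p).toSeminormedAddCommGroup with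
    norm_mul_le := p.mul_le }

instance : NormedSpace ℂ (Pre p) :=
  { preModule p with
    norm_smul_le := fun c x => (map_smul_eq_mul p.toSeminorm c x).le }

instance : StarRing (Pre p) := inferInstanceAs (StarRing R)

instance : NormedStarGroup (Pre p) where
  norm_star_le x := (p.star_eq x).le

instance [h : IsScalarTower ℂ R R] : IsScalarTower ℂ (Pre p) (Pre p) := ⟨h.smul_assoc⟩
instance [h : SMulCommClass ℂ R R] : SMulCommClass ℂ (Pre p) (Pre p) := ⟨h.smul_comm⟩
instance [h : StarModule ℂ R] : StarModule ℂ (Pre p) := ⟨h.star_smul⟩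

lemma norm_pre (x : Pre p) : ‖x‖ = p x := rfl

/-- The Hausdorff completion of a ⋆-algebra with respect to a C⋆-seminorm. -/
def Compl : Type u := UniformSpace.Completion (Pre p)

instance : NormedAddCommGroup (Compl p) :=
  inferInstanceAs (NormedAddCommGroup (UniformSpace.Completion (Pre p)))
instance : NormedSpace ℂ (Compl p) :=
  inferInstanceAs (NormedSpace ℂ (UniformSpace.Completion (Pre p)))
instance : CompleteSpace (Compl p) :=
  inferInstanceAs (CompleteSpace (UniformSpace.Completion (Pre p)))

/-- The canonical map to the completion. -/
def toCompl : Pre p →L[ℂ] Compl p := UniformSpace.Completion.toComplL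

lemma norm_toCompl (x : Pre p) : ‖toCompl p x‖ = p x :=
  UniformSpace.Completion.norm_coe x

lemma denseRange_toCompl : DenseRange (toCompl p) :=
  UniformSpace.Completion.denseRange_coe

variable {p} in
lemma compl_induction {P : Compl p → Prop} (x : Compl p) (hc : IsClosed {x | P x})
    (h : ∀ a : Pre p, P (toCompl p a)) : P x :=
  UniformSpace.Completion.induction_on x hc h

variable {p} in
lemma compl_induction₂ {P : Compl p → Compl p → Prop} (x y : Compl p)
    (hc : IsClosed {z : Compl p × Compl p | P z.1 z.2})
    (h : ∀ a b : Pre p, P (toCompl p a) (toCompl p b)) : P x y :=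
  UniformSpace.Completion.induction_on₂ x y hc h

variable {p} in
lemma compl_induction₃ {P : Compl p → Compl p → Compl p → Prop} (x y z : Compl p)
    (hc : IsClosed {z : Compl p × Compl p × Compl p | P z.1 z.2.1 z.2.2})
    (h : ∀ a b c : Pre p, P (toCompl p a) (toCompl p b) (toCompl p c)) : P x y z :=
  UniformSpace.Completion.induction_on₃ x y z hc h

/-- Extension of a contractive linear map to the completion. -/
def extendL {F : Type*} [AddCommGroup F] [UniformSpace F] [IsUniformAddGroup F]
    [T0Space F] [Module ℂ F] [ContinuousConstSMul ℂ F] [CompleteSpace F] (f : Pre p →L[ℂ] F) : Compl p →L[ℂ] F :=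
  f.extend (toCompl p)

lemma isUniformInducing_toCompl : IsUniformInducing (toCompl p) :=
  UniformSpace.Completion.isUniformInducing_coe (Pre p)

@[simp] lemma extendL_toCompl {F : Type*} [AddCommGroup F] [UniformSpace F]
    [IsUniformAddGroup F] [T0Space F] [Module ℂ F] [ContinuousConstSMul ℂ F] [CompleteSpace F]
    (f : Pre p →L[ℂ] F) (x : Pre p) : extendL p f (toCompl p x) = f x :=
  f.extend_eq (denseRange_toCompl p) (isUniformInducing_toCompl p) x

variable [IsScalarTower ℂ R R] [SMulCommClass ℂ R R] [StarModule ℂ R]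

/-- Left multiplication by elements of the completion on the original algebra. -/
def mulAux : Compl p →L[ℂ] Pre p →L[ℂ] Compl p :=
  extendL p ((ContinuousLinearMap.compL ℂ (Pre p) (Pre p) (Compl p) (toCompl p)).comp
    (ContinuousLinearMap.mul ℂ (Pre p)))

/-- Multiplication on the completion, with the factors interchanged, as a bounded bilinear map. -/
def mulFlip : Compl p →L[ℂ] Compl p →L[ℂ] Compl p :=
  extendL p (mulAux p).flip

instance : Mul (Compl p) := ⟨fun x y => mulFlip p y x⟩

lemma toCompl_mul (x y : Pre p) : toCompl p (x * y) = toCompl p x * toCompl p y := by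
  change _ = mulFlip p _ _
  simp [mulFlip, mulAux]

lemma continuous_mul : Continuous fun z : Compl p × Compl p => z.1 * z.2 := by
  change Continuous fun z : Compl p × Compl p => mulFlip p z.2 z.1
  fun_prop

instance : ContinuousMul (Compl p) := ⟨continuous_mul p⟩

instance : Star (Compl p) := ⟨UniformSpace.Completion.map (star : Pre p → Pre p)⟩

lemma toCompl_star (x : Pre p) : toCompl p (star x) = star (toCompl p x) :=
  (UniformSpace.Completion.map_coe (f := (star : Pre p → Pre p))
    star_isometry.uniformContinuous x).symm

instance : ContinuousStar (Compl p) := ⟨UniformSpace.Completion.continuous_map⟩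

instance : NonUnitalNormedRing (Compl p) :=
  { (inferInstance : NormedAddCommGroup (Compl p)),
    (inferInstance : Mul (Compl p)) with
    left_distrib := fun x y z => by
      change mulFlip p (y + z) x = mulFlip p y x + mulFlip p z x
      simp
    right_distrib := fun x y z => by
      change mulFlip p z (x + y) = mulFlip p z x + mulFlip p z y
      simp
    zero_mul := fun x => by
      change mulFlip p x 0 = 0
      simp
    mul_zero := fun x => by
      change mulFlip p 0 x = 0
      simp
    mul_assoc := fun x y z => by
      induction x, y, z using compl_induction₃ with
      | hc => exact isClosed_eq (by fun_prop) (by fun_prop)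
      | h a b c =>
        simp only [← toCompl_mul, mul_assoc]
    norm_mul_le := fun x y => by
      induction x, y using compl_induction₂ with
      | hc => exact isClosed_le (by fun_prop) (by fun_prop)
      | h a b =>
        simp only [← toCompl_mul, norm_toCompl]
        exact p.mul_le a b }

lemma compl_star_smul (c : ℂ) (x : Compl p) : star (c • x) = star c • star x := by
  have h1 : Continuous fun x : Compl p => c • x := continuous_const_smul c
  have h2 : Continuous fun x : Compl p => star c • x := continuous_const_smul (star c)
  have h3 : Continuous fun x : Compl p => star x := continuous_star
  induction x using compl_induction with
  | hc => exact isClosed_eq (h3.comp h1) (h2.comp h3)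
  | h a => rw [← toCompl_star, ← (toCompl p).map_smul, ← toCompl_star, ← (toCompl p).map_smul,
      star_smul]

lemma compl_smul_mul (c : ℂ) (x y : Compl p) : (c • x) * y = c • (x * y) := by
  change mulFlip p y (c • x) = c • mulFlip p y x
  simp

lemma compl_mul_smul (c : ℂ) (x y : Compl p) : x * (c • y) = c • (x * y) := by
  change mulFlip p (c • y) x = c • mulFlip p y x
  simp

instance : NonUnitalCStarAlgebra (Compl p) :=
  { (inferInstance : NonUnitalNormedRing (Compl p)),
    (inferInstance : CompleteSpace (Compl p)),
    (inferInstance : NormedSpace ℂ (Compl p)) with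
    star := star
    star_involutive := fun x => by
      induction x using compl_induction with
      | hc => exact isClosed_eq (by fun_prop) (by fun_prop)
      | h a =>
        simp only [← toCompl_star, star_star]
    star_mul := fun x y => by
      induction x, y using compl_induction₂ with
      | hc => exact isClosed_eq (by fun_prop) (by fun_prop)
      | h a b =>
        simp only [← toCompl_star, ← toCompl_mul, star_mul]
    star_add := fun x y => by
      induction x, y using compl_induction₂ with
      | hc => exact isClosed_eq (by fun_prop) (by fun_prop)
      | h a b =>
        simp only [← toCompl_star, ← map_add, star_add]
    star_smul := compl_star_smul p
    smul_assoc := compl_smul_mul p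
    smul_comm := fun c x y => (compl_mul_smul p c x y).symm
    norm_mul_self_le := fun x => by
      induction x using compl_induction with
      | hc => exact isClosed_le (by fun_prop) (by fun_prop)
      | h a =>
        simp only [← toCompl_star, ← toCompl_mul, norm_toCompl]
        exact (p.cstar a).ge }

/-- The canonical ⋆-homomorphism to the completion. -/
def ι : R →⋆ₙₐ[ℂ] Compl p where
  toFun := toCompl p
  map_smul' := (toCompl p).map_smul
  map_zero' := (toCompl p).map_zero
  map_add' := (toCompl p).map_add
  map_mul' := toCompl_mul p
  map_star' := toCompl_star p

lemma norm_ι (x : R) : ‖ι p x‖ = p x := norm_toCompl p x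

lemma denseRange_ι : DenseRange (ι p) := denseRange_toCompl p

variable {D : Type*} [NonUnitalCStarAlgebra D]

/-- A ⋆-homomorphism dominated by `p` extends to the completion. -/
def lift (f : R →⋆ₙₐ[ℂ] D) (hf : ∀ x, ‖f x‖ ≤ p x) : Compl p →⋆ₙₐ[ℂ] D :=
  let f' : Pre p →ₗ[ℂ] D :=
    { toFun := f, map_add' := map_add f, map_smul' := map_smul f }
  let fL : Pre p →L[ℂ] D := f'.mkContinuous 1 fun x => by simpa using! hf x
  { toFun := extendL p fL
    map_smul' := (extendL p fL).map_smul
    map_zero' := (extendL p fL).map_zero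
    map_add' := (extendL p fL).map_add
    map_mul' := fun x y => by
      induction x, y using compl_induction₂ with
      | hc => exact isClosed_eq (by fun_prop) (by fun_prop)
      | h a b =>
        simp only [← toCompl_mul, extendL_toCompl]
        exact map_mul f a b
    map_star' := fun x => by
      induction x using compl_induction with
      | hc => exact isClosed_eq (by fun_prop) (by fun_prop)
      | h a =>
        simp only [← toCompl_star, extendL_toCompl]
        exact map_star f a }

@[simp] lemma lift_ι (f : R →⋆ₙₐ[ℂ] D) (hf : ∀ x, ‖f x‖ ≤ p x) (x : R) :
    lift p f hf (ι p x) = f x :=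
  extendL_toCompl p _ x

end CStarSeminorm
end Completion

section AlgTensor

variable {A B : Type u} [NonUnitalCStarAlgebra A] [NonUnitalCStarAlgebra B]

instance algTensorStarRing : StarRing (A ⊗[ℂ] B) :=
  { (inferInstance : StarAddMonoid (A ⊗[ℂ] B)) with
    star_mul := fun x y => by
      induction x using TensorProduct.induction_on with
      | zero => simp
      | add x₁ x₂ h₁ h₂ => simp [add_mul, mul_add, h₁, h₂]
      | tmul a b =>
        induction y using TensorProduct.induction_on with
        | zero => simp
        | add y₁ y₂ h₁ h₂ => simp [add_mul, mul_add, h₁, h₂]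
        | tmul c d => simp [TensorProduct.star_tmul] }

namespace CStarSeminorm

variable (p : CStarSeminorm (A ⊗[ℂ] B))

lemma tmul_sq (a : A) (b : B) :
    p (a ⊗ₜ[ℂ] b) * p (a ⊗ₜ[ℂ] b) = p ((star a * a) ⊗ₜ[ℂ] (star b * b)) := by
  rw [← p.cstar]; simp

lemma exists_bound_left (b : B) : ∃ C : ℝ, ∀ a : A, p (a ⊗ₜ[ℂ] b) ≤ C * ‖a‖ := by
  let _ := CStarAlgebra.spectralOrder A
  let _ := CStarAlgebra.spectralOrderedRing A
  let _ := CStarAlgebra.spectralOrder (Compl p)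
  let _ := CStarAlgebra.spectralOrderedRing (Compl p)
  let φ : A →ₗ[ℂ] Compl p :=
    { toFun := fun a => ι p (a ⊗ₜ[ℂ] (star b * b))
      map_add' := fun x y => by rw [TensorProduct.add_tmul, map_add]
      map_smul' := fun c x => by rw [← TensorProduct.smul_tmul', map_smul]; rfl }
  have hφ : ∀ x, 0 ≤ x → 0 ≤ φ x := fun x hx => by
    obtain ⟨y, rfl⟩ := CStarAlgebra.nonneg_iff_eq_star_mul_self.mp hx
    have : φ (star y * y) = star (ι p (y ⊗ₜ[ℂ] b)) * ι p (y ⊗ₜ[ℂ] b) := by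
      rw [← map_star, ← map_mul]
      simp [φ]
    rw [this]
    exact star_mul_self_nonneg (R := Compl p) _
  obtain ⟨C, hC⟩ := (PositiveLinearMap.mk₀ φ hφ).exists_norm_apply_le
  refine ⟨Real.sqrt C, fun a => ?_⟩
  have h1 : p (a ⊗ₜ[ℂ] b) * p (a ⊗ₜ[ℂ] b) ≤ C * (‖a‖ * ‖a‖) := by
    rw [tmul_sq, ← norm_ι p, ← CStarRing.norm_star_mul_self]
    exact hC _
  have h2 : Real.sqrt C * Real.sqrt C = C := Real.mul_self_sqrt C.2
  refine abs_le_of_sq_le_sq' ?_ (by positivity) |>.2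
  nlinarith

lemma exists_bound_right (a : A) : ∃ C : ℝ, ∀ b : B, p (a ⊗ₜ[ℂ] b) ≤ C * ‖b‖ := by
  let _ := CStarAlgebra.spectralOrder B
  let _ := CStarAlgebra.spectralOrderedRing B
  let _ := CStarAlgebra.spectralOrder (Compl p)
  let _ := CStarAlgebra.spectralOrderedRing (Compl p)
  let φ : B →ₗ[ℂ] Compl p :=
    { toFun := fun b => ι p ((star a * a) ⊗ₜ[ℂ] b)
      map_add' := fun x y => by rw [TensorProduct.tmul_add, map_add]
      map_smul' := fun c x => by rw [TensorProduct.tmul_smul, map_smul]; rfl }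
  have hφ : ∀ x, 0 ≤ x → 0 ≤ φ x := fun x hx => by
    obtain ⟨y, rfl⟩ := CStarAlgebra.nonneg_iff_eq_star_mul_self.mp hx
    have : φ (star y * y) = star (ι p (a ⊗ₜ[ℂ] y)) * ι p (a ⊗ₜ[ℂ] y) := by
      rw [← map_star, ← map_mul]
      simp [φ]
    rw [this]
    exact star_mul_self_nonneg (R := Compl p) _
  obtain ⟨C, hC⟩ := (PositiveLinearMap.mk₀ φ hφ).exists_norm_apply_le
  refine ⟨Real.sqrt C, fun b => ?_⟩
  have h1 : p (a ⊗ₜ[ℂ] b) * p (a ⊗ₜ[ℂ] b) ≤ C * (‖b‖ * ‖b‖) := by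
    rw [tmul_sq, ← norm_ι p, ← CStarRing.norm_star_mul_self]
    exact hC _
  have h2 : Real.sqrt C * Real.sqrt C = C := Real.mul_self_sqrt C.2
  refine abs_le_of_sq_le_sq' ?_ (by positivity) |>.2
  nlinarith

lemma exists_bound : ∃ C : ℝ, ∀ (a : A) (b : B), p (a ⊗ₜ[ℂ] b) ≤ C * (‖a‖ * ‖b‖) := by
  choose K hK using exists_bound_right p
  let T : A → B →L[ℂ] Compl p := fun a =>
    LinearMap.mkContinuous
      { toFun := fun b => ι p (a ⊗ₜ[ℂ] b)
        map_add' := fun x y => by rw [TensorProduct.tmul_add, map_add]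
        map_smul' := fun c x => by rw [TensorProduct.tmul_smul, map_smul]; rfl }
      (K a) fun b => by
        change ‖ι p _‖ ≤ _
        rw [norm_ι]
        exact hK a b
  obtain ⟨C, hC⟩ := banach_steinhaus (g := fun a : Metric.closedBall (0 : A) 1 => T a)
    fun b => by
      obtain ⟨L, hL⟩ := exists_bound_left p b
      refine ⟨|L|, fun a => ?_⟩
      change ‖ι p _‖ ≤ _
      rw [norm_ι]
      have ha : ‖(a : A)‖ ≤ 1 := mem_closedBall_zero_iff.mp a.2
      calc p ((a : A) ⊗ₜ[ℂ] b) ≤ L * ‖(a : A)‖ := hL _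
        _ ≤ |L| * ‖(a : A)‖ := by gcongr; exact le_abs_self L
        _ ≤ |L| := by nlinarith [abs_nonneg L]
  refine ⟨C, fun a b => ?_⟩
  rcases eq_or_ne a 0 with rfl | ha
  · rw [TensorProduct.zero_tmul, map_zero]; simp
  have ha' : 0 < ‖a‖ := norm_pos_iff.mpr ha
  have h1 := (T ((‖a‖⁻¹ : ℂ) • a)).le_of_opNorm_le
    (hC ⟨(‖a‖⁻¹ : ℂ) • a, by simp [norm_smul, ha'.ne']⟩) b
  have h2 : ‖T ((‖a‖⁻¹ : ℂ) • a) b‖ = ‖a‖⁻¹ * p (a ⊗ₜ[ℂ] b) := by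
    change ‖ι p _‖ = _
    rw [norm_ι, ← TensorProduct.smul_tmul', map_smul_eq_mul]
    simp
  rw [h2, inv_mul_le_iff₀ ha'] at h1
  linarith

lemma sq_iterate_bound (n : ℕ) (h : A) (hh : IsSelfAdjoint h) (k : B) (hk : IsSelfAdjoint k) :
    ∃ h' : A, ∃ k' : B, p (h ⊗ₜ[ℂ] k) ^ (2 ^ n) = p (h' ⊗ₜ[ℂ] k') ∧
      ‖h'‖ = ‖h‖ ^ (2 ^ n) ∧ ‖k'‖ = ‖k‖ ^ (2 ^ n) ∧ IsSelfAdjoint h' ∧ IsSelfAdjoint k' := by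
  induction n with
  | zero => exact ⟨h, k, by simp, by simp, by simp, hh, hk⟩
  | succ n ih =>
    obtain ⟨h', k', e, e1, e2, s1, s2⟩ := ih
    refine ⟨star h' * h', star k' * k', ?_, ?_, ?_, .star_mul_self _, .star_mul_self _⟩
    · rw [pow_succ, pow_mul, e, sq, tmul_sq]
    · rw [CStarRing.norm_star_mul_self, e1, pow_succ, pow_mul, sq]
    · rw [CStarRing.norm_star_mul_self, e2, pow_succ, pow_mul, sq]

lemma le_of_pow_two_pow_le {x y C : ℝ} (hy : 0 ≤ y)
    (h : ∀ n : ℕ, x ^ (2 ^ n) ≤ C * y ^ (2 ^ n)) : x ≤ y := by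
  rcases hy.eq_or_lt with rfl | hy
  · have := h 0
    simp at this
    linarith
  by_contra! hxy
  have h1 : 1 < x / y := (one_lt_div hy).mpr hxy
  obtain ⟨n, hn⟩ := pow_unbounded_of_one_lt C h1
  have h2 := h n
  have h3 : (x / y) ^ n ≤ (x / y) ^ (2 ^ n) := pow_le_pow_right₀ h1.le Nat.lt_two_pow_self.le
  rw [div_pow x y (2 ^ n)] at h3
  rw [← div_le_iff₀ (by positivity)] at h2
  linarith

/-- Every C⋆-seminorm on the algebraic tensor product of two C⋆-algebras is a subcross seminorm. -/
lemma tmul_le (a : A) (b : B) : p (a ⊗ₜ[ℂ] b) ≤ ‖a‖ * ‖b‖ := by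
  have key : ∀ (h : A) (k : B), IsSelfAdjoint h → IsSelfAdjoint k →
      p (h ⊗ₜ[ℂ] k) ≤ ‖h‖ * ‖k‖ := fun h k hh hk => by
    obtain ⟨C, hC⟩ := exists_bound p
    refine le_of_pow_two_pow_le (by positivity) (C := C) fun n => ?_
    obtain ⟨h', k', e, e1, e2, -, -⟩ := sq_iterate_bound p n h hh k hk
    rw [e, mul_pow, ← e1, ← e2]
    exact hC _ _
  refine abs_le_of_sq_le_sq' ?_ (by positivity) |>.2
  have h1 := key _ _ (IsSelfAdjoint.star_mul_self a) (IsSelfAdjoint.star_mul_self b)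
  rw [← tmul_sq, CStarRing.norm_star_mul_self, CStarRing.norm_star_mul_self] at h1
  nlinarith

end CStarSeminorm

end AlgTensor

section MaxTensor

lemma continuous_starHom {A : Type u} {D : Type v} [NonUnitalCStarAlgebra A]
    [NonUnitalCStarAlgebra D] (f : A →⋆ₙₐ[ℂ] D) : Continuous f :=
  (NonUnitalStarAlgHom.instContinuousLinearMapClassComplex
    (F := A →⋆ₙₐ[ℂ] D) (A := A) (B := D)).map_continuous f

variable (A B : Type u) [NonUnitalCStarAlgebra A] [NonUnitalCStarAlgebra B]

instance : Nonempty (CStarSeminorm (A ⊗[ℂ] B)) :=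
  ⟨{ toSeminorm := 0
     mul_le' := fun _ _ => (mul_zero (0 : ℝ)).ge
     cstar' := fun _ => (mul_zero (0 : ℝ)).symm }⟩

variable {A B} in
lemma bddAbove_cstarSeminorm (x : A ⊗[ℂ] B) :
    BddAbove (Set.range fun p : CStarSeminorm (A ⊗[ℂ] B) => p x) := by
  induction x using TensorProduct.induction_on with
  | zero => exact ⟨0, by rintro _ ⟨p, rfl⟩; simp⟩
  | tmul a b => exact ⟨‖a‖ * ‖b‖, by rintro _ ⟨p, rfl⟩; exact p.tmul_le a b⟩
  | add x y hx hy =>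
    obtain ⟨M, hM⟩ := hx
    obtain ⟨N, hN⟩ := hy
    refine ⟨M + N, ?_⟩
    rintro _ ⟨p, rfl⟩
    exact (map_add_le_add p.toSeminorm x y).trans (add_le_add (hM ⟨p, rfl⟩) (hN ⟨p, rfl⟩))

/-- The maximal C⋆-norm on the algebraic tensor product of two C⋆-algebras: the supremum of all
C⋆-seminorms. -/
def maxSeminorm : CStarSeminorm (A ⊗[ℂ] B) where
  toFun x := ⨆ p : CStarSeminorm (A ⊗[ℂ] B), p x
  map_zero' := by simp
  add_le' x y := ciSup_le fun p => (map_add_le_add p.toSeminorm x y).trans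
    (add_le_add (le_ciSup (bddAbove_cstarSeminorm x) p) (le_ciSup (bddAbove_cstarSeminorm y) p))
  neg' x := by simp
  smul' c x := by
    simp only [map_smul_eq_mul]
    exact (Real.mul_iSup_of_nonneg (norm_nonneg c) _).symm
  mul_le' x y := ciSup_le fun p => (p.mul_le x y).trans
    (mul_le_mul (le_ciSup (bddAbove_cstarSeminorm x) p) (le_ciSup (bddAbove_cstarSeminorm y) p)
      (p.nonneg y) (Real.iSup_nonneg fun q => q.nonneg x))
  cstar' x := by
    have h0 : 0 ≤ ⨆ p : CStarSeminorm (A ⊗[ℂ] B), p x := Real.iSup_nonneg fun q => q.nonneg x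
    apply le_antisymm
    · refine ciSup_le fun p => ?_
      rw [p.cstar]
      have h := le_ciSup (bddAbove_cstarSeminorm x) p
      exact mul_le_mul h h (p.nonneg x) h0
    · have h1 : (⨆ p : CStarSeminorm (A ⊗[ℂ] B), p x) ≤
          Real.sqrt (⨆ p : CStarSeminorm (A ⊗[ℂ] B), p (star x * x)) := by
        refine ciSup_le fun p => Real.le_sqrt_of_sq_le ?_
        rw [sq, ← p.cstar]
        exact le_ciSup (bddAbove_cstarSeminorm _) p
      calc _ ≤ Real.sqrt (⨆ p : CStarSeminorm (A ⊗[ℂ] B), p (star x * x)) *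
            Real.sqrt (⨆ p : CStarSeminorm (A ⊗[ℂ] B), p (star x * x)) :=
            mul_le_mul h1 h1 h0 (Real.sqrt_nonneg _)
        _ = _ := Real.mul_self_sqrt (Real.iSup_nonneg fun q => q.nonneg _)

variable {A B} in
lemma le_maxSeminorm (p : CStarSeminorm (A ⊗[ℂ] B)) (x : A ⊗[ℂ] B) : p x ≤ maxSeminorm A B x :=
  le_ciSup (bddAbove_cstarSeminorm x) p

/-- The maximal tensor product of two C⋆-algebras: the completion of the algebraic tensor product
with respect to the maximal C⋆-norm. -/
def MaxTensor : Type u := (maxSeminorm A B).Compl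

instance : NonUnitalCStarAlgebra (MaxTensor A B) :=
  inferInstanceAs (NonUnitalCStarAlgebra (maxSeminorm A B).Compl)

namespace MaxTensor

/-- The canonical map from the algebraic to the maximal tensor product. -/
def incl : A ⊗[ℂ] B →⋆ₙₐ[ℂ] MaxTensor A B := (maxSeminorm A B).ι

lemma norm_incl (x : A ⊗[ℂ] B) : ‖incl A B x‖ = maxSeminorm A B x := (maxSeminorm A B).norm_ι x

lemma denseRange_incl : DenseRange (incl A B) := (maxSeminorm A B).denseRange_ι

variable {A B}

/-- Elementary tensors. -/
def tmul (a : A) (b : B) : MaxTensor A B := incl A B (a ⊗ₜ[ℂ] b)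

lemma norm_tmul_le (a : A) (b : B) : ‖tmul a b‖ ≤ ‖a‖ * ‖b‖ := by
  rw [tmul, norm_incl]; exact CStarSeminorm.tmul_le _ a b

lemma add_tmul (a a' : A) (b : B) : tmul (a + a') b = tmul a b + tmul a' b := by
  simp [tmul, TensorProduct.add_tmul, map_add]

lemma tmul_add (a : A) (b b' : B) : tmul a (b + b') = tmul a b + tmul a b' := by
  simp [tmul, TensorProduct.tmul_add, map_add]

lemma smul_tmul (c : ℂ) (a : A) (b : B) : tmul (c • a) b = c • tmul a b := by
  rw [tmul, ← TensorProduct.smul_tmul', map_smul]; rfl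

lemma tmul_smul (c : ℂ) (a : A) (b : B) : tmul a (c • b) = c • tmul a b := by
  rw [tmul, TensorProduct.tmul_smul, map_smul]; rfl

lemma continuous_tmul (a : A) : Continuous fun b : B => tmul a b :=
  AddMonoidHomClass.continuous_of_bound
    ({ toFun := fun b => tmul a b
       map_add' := tmul_add a
       map_smul' := fun c => tmul_smul c a } : B →ₗ[ℂ] MaxTensor A B) ‖a‖ (norm_tmul_le a)

lemma tmul_mul_tmul (a a' : A) (b b' : B) :
    tmul a b * tmul a' b' = tmul (a * a') (b * b') := by
  rw [tmul, tmul, ← map_mul]; simp [tmul]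

lemma star_tmul (a : A) (b : B) : star (tmul a b) = tmul (star a) (star b) := by
  rw [tmul, ← map_star]; simp [tmul]

variable {D : Type v} [NonUnitalCStarAlgebra D]

/-- Two ⋆-homomorphisms out of a maximal tensor product agree if they agree on elementary
tensors. -/
lemma hom_ext {f g : MaxTensor A B →⋆ₙₐ[ℂ] D} (h : ∀ a b, f (tmul a b) = g (tmul a b)) :
    f = g := by
  have h1 : ∀ x : A ⊗[ℂ] B, f (incl A B x) = g (incl A B x) := fun x => by
    induction x using TensorProduct.induction_on with
    | zero => simp
    | tmul a b => exact h a b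
    | add x y hx hy => simp [hx, hy]
  exact DFunLike.coe_injective ((denseRange_incl A B).equalizer
    (continuous_starHom f) (continuous_starHom g) (funext h1))

/-- A ⋆-homomorphism from the algebraic tensor product to a C⋆-algebra extends to the maximal
tensor product. -/
def liftHom (f : A ⊗[ℂ] B →⋆ₙₐ[ℂ] D) : MaxTensor A B →⋆ₙₐ[ℂ] D :=
  (maxSeminorm A B).lift f fun x =>
    le_maxSeminorm
      { toFun := fun x => ‖f x‖
        map_zero' := by simp
        add_le' := fun x y => by rw [map_add]; exact norm_add_le _ _
        neg' := fun x => by simp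
        smul' := fun c x => by simp [map_smul, norm_smul]
        mul_le' := fun x y => by rw [map_mul]; exact norm_mul_le _ _
        cstar' := fun x => by rw [map_mul, map_star]; exact CStarRing.norm_star_mul_self } x

lemma liftHom_incl (f : A ⊗[ℂ] B →⋆ₙₐ[ℂ] D) (x : A ⊗[ℂ] B) : liftHom f (incl A B x) = f x :=
  (maxSeminorm A B).lift_ι f _ x

/-- The ⋆-homomorphism from the maximal tensor product that is determined by a bilinear map
compatible with multiplication and involution. -/
def lift (β : A →ₗ[ℂ] B →ₗ[ℂ] D)
    (hm : ∀ a b a' b', β (a * a') (b * b') = β a b * β a' b')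
    (hs : ∀ a b, β (star a) (star b) = star (β a b)) : MaxTensor A B →⋆ₙₐ[ℂ] D :=
  liftHom
    { TensorProduct.lift β with
      map_zero' := map_zero _
      map_mul' := fun x y => by
        change TensorProduct.lift β _ = TensorProduct.lift β _ * TensorProduct.lift β _
        induction x using TensorProduct.induction_on with
        | zero => simp
        | add x₁ x₂ h₁ h₂ => simp [add_mul, h₁, h₂]
        | tmul a b =>
          induction y using TensorProduct.induction_on with
          | zero => simp
          | add y₁ y₂ h₁ h₂ => simp [mul_add, h₁, h₂]
          | tmul c d => simp [hm]
      map_star' := fun x => by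
        change TensorProduct.lift β _ = star (TensorProduct.lift β _)
        induction x using TensorProduct.induction_on with
        | zero => simp
        | add x₁ x₂ h₁ h₂ => simp [h₁, h₂]
        | tmul a b => simp [hs] }

@[simp] lemma lift_tmul (β : A →ₗ[ℂ] B →ₗ[ℂ] D) (hm) (hs) (a : A) (b : B) :
    lift β hm hs (tmul a b) = β a b := by
  rw [lift, tmul, liftHom_incl]
  exact TensorProduct.lift.tmul a b

variable {A' B' : Type u} [NonUnitalCStarAlgebra A'] [NonUnitalCStarAlgebra B']

/-- The maximal tensor product of two ⋆-homomorphisms. -/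
def map (f : A →⋆ₙₐ[ℂ] A') (g : B →⋆ₙₐ[ℂ] B') : MaxTensor A B →⋆ₙₐ[ℂ] MaxTensor A' B' :=
  lift (LinearMap.mk₂ ℂ (fun a b => tmul (f a) (g b))
      (fun _ _ _ => by rw [map_add, add_tmul]) (fun _ _ _ => by rw [map_smul, smul_tmul])
      (fun _ _ _ => by rw [map_add, tmul_add]) (fun _ _ _ => by rw [map_smul, tmul_smul]))
    (fun _ _ _ _ => by simp [tmul_mul_tmul]) (fun _ _ => by simp [star_tmul, map_star])

@[simp] lemma map_tmul (f : A →⋆ₙₐ[ℂ] A') (g : B →⋆ₙₐ[ℂ] B') (a : A) (b : B) :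
    map f g (tmul a b) = tmul (f a) (g b) := by
  simp [map]

lemma map_id : map (NonUnitalStarAlgHom.id ℂ A) (NonUnitalStarAlgHom.id ℂ B) =
    NonUnitalStarAlgHom.id ℂ _ :=
  hom_ext fun a b => by simp

lemma map_comp {A'' B'' : Type u} [NonUnitalCStarAlgebra A''] [NonUnitalCStarAlgebra B'']
    (f : A →⋆ₙₐ[ℂ] A') (g : B →⋆ₙₐ[ℂ] B') (f' : A' →⋆ₙₐ[ℂ] A'') (g' : B' →⋆ₙₐ[ℂ] B'') :
    map (f'.comp f) (g'.comp g) = (map f' g').comp (map f g) :=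
  hom_ext fun a b => by simp

end MaxTensor

end MaxTensor

section Assoc

variable (A B C : Type u) [NonUnitalCStarAlgebra A] [NonUnitalCStarAlgebra B]
  [NonUnitalCStarAlgebra C]

namespace MaxTensor

/-- The map `(a, ∑ b ⊗ c) ↦ ∑ (a ⊗ b) ⊗ c`. -/
def assocAux : A →ₗ[ℂ] (B ⊗[ℂ] C) →ₗ[ℂ] MaxTensor (MaxTensor A B) C :=
  LinearMap.mk₂ ℂ
    (fun a s => incl (MaxTensor A B) C
      (TensorProduct.map
        { toFun := fun b => tmul a b
          map_add' := tmul_add a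
          map_smul' := fun c => tmul_smul c a } LinearMap.id s))
    (fun a a' s => by
      induction s using TensorProduct.induction_on with
      | zero => simp
      | tmul b c => simp [add_tmul, TensorProduct.add_tmul]
      | add x y hx hy => simp only [map_add, hx, hy]; abel)
    (fun r a s => by
      induction s using TensorProduct.induction_on with
      | zero => simp
      | tmul b c =>
        simp only [TensorProduct.map_tmul, LinearMap.coe_mk, AddHom.coe_mk, LinearMap.id_coe, id_eq]
        exact (congrArg (tmul · c) (smul_tmul r a b)).trans (smul_tmul r _ _)
      | add x y hx hy => simp only [map_add, hx, hy, smul_add])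
    (fun a s s' => by simp only [map_add])
    (fun r a s => by simp only [map_smul])

variable {A B C}

@[simp] lemma assocAux_tmul (a : A) (b : B) (c : C) :
    assocAux A B C a (b ⊗ₜ c) = tmul (tmul a b) c := by
  simp [assocAux, tmul]

lemma assocAux_mul (a a' : A) (s t : B ⊗[ℂ] C) :
    assocAux A B C (a * a') (s * t) = assocAux A B C a s * assocAux A B C a' t := by
  induction s using TensorProduct.induction_on with
  | zero => simp
  | add x₁ x₂ h₁ h₂ => simp only [add_mul, map_add, h₁, h₂]
  | tmul b c =>
    induction t using TensorProduct.induction_on with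
    | zero => simp
    | add y₁ y₂ h₁ h₂ => simp only [mul_add, map_add, h₁, h₂]
    | tmul b' c' => simp [tmul_mul_tmul]

lemma assocAux_star (a : A) (s : B ⊗[ℂ] C) :
    assocAux A B C (star a) (star s) = star (assocAux A B C a s) := by
  induction s using TensorProduct.induction_on with
  | zero => simp
  | add x₁ x₂ h₁ h₂ => simp only [star_add, map_add, h₁, h₂]
  | tmul b c => simp [star_tmul]

lemma exists_norm_assocAux_le (s : B ⊗[ℂ] C) :
    ∃ K : ℝ, 0 ≤ K ∧ ∀ a : A, ‖assocAux A B C a s‖ ≤ K * ‖a‖ := by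
  induction s using TensorProduct.induction_on with
  | zero => exact ⟨0, le_rfl, fun a => by simp⟩
  | tmul b c =>
    refine ⟨‖b‖ * ‖c‖, by positivity, fun a => ?_⟩
    rw [assocAux_tmul]
    calc _ ≤ ‖tmul a b‖ * ‖c‖ := norm_tmul_le _ _
      _ ≤ ‖a‖ * ‖b‖ * ‖c‖ := by gcongr; exact norm_tmul_le _ _
      _ = _ := by ring
  | add x y hx hy =>
    obtain ⟨M, hM0, hM⟩ := hx
    obtain ⟨N, hN0, hN⟩ := hy
    refine ⟨M + N, by positivity, fun a => ?_⟩
    rw [map_add, add_mul]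
    exact norm_add_le_of_le (hM a) (hN a)

lemma continuous_assocAux (s : B ⊗[ℂ] C) : Continuous fun a : A => assocAux A B C a s := by
  obtain ⟨K, -, hK⟩ := exists_norm_assocAux_le (A := A) s
  exact AddMonoidHomClass.continuous_of_bound ((assocAux A B C).flip s) K hK

variable (A) in
/-- The value of `assocSeminorm`. -/
def assocNorm (s : B ⊗[ℂ] C) : ℝ := ⨆ a : Metric.closedBall (0 : A) 1, ‖assocAux A B C a s‖

lemma assocAux_le (s : B ⊗[ℂ] C) (a : A) (ha : ‖a‖ ≤ 1) :
    ‖assocAux A B C a s‖ ≤ assocNorm A s := by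
  obtain ⟨K, hK0, hK⟩ := exists_norm_assocAux_le (A := A) s
  refine le_ciSup (f := fun a : Metric.closedBall (0 : A) 1 => ‖assocAux A B C a s‖) ⟨K, ?_⟩
    ⟨a, mem_closedBall_zero_iff.mpr ha⟩
  rintro _ ⟨x, rfl⟩
  have := mem_closedBall_zero_iff.mp x.2
  exact (hK x).trans (mul_le_of_le_one_right hK0 this)

lemma assocNorm_le {s : B ⊗[ℂ] C} {r : ℝ}
    (h : ∀ a : A, ‖a‖ ≤ 1 → ‖assocAux A B C a s‖ ≤ r) : assocNorm A s ≤ r :=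
  haveI : Nonempty (Metric.closedBall (0 : A) 1) := ⟨⟨0, by simp⟩⟩
  ciSup_le fun a => h a (mem_closedBall_zero_iff.mp a.2)

lemma assocNorm_nonneg (s : B ⊗[ℂ] C) : 0 ≤ assocNorm A s :=
  Real.iSup_nonneg fun _ => norm_nonneg _

lemma assocNorm_smul_le (c : ℂ) (s : B ⊗[ℂ] C) : assocNorm A (c • s) ≤ ‖c‖ * assocNorm A s :=
  assocNorm_le fun a ha => by
    rw [map_smul, norm_smul]
    exact mul_le_mul_of_nonneg_left (assocAux_le s a ha) (norm_nonneg c)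

lemma assocNorm_mul_le (s t : B ⊗[ℂ] C) : assocNorm A (s * t) ≤ assocNorm A s * assocNorm A t := by
  refine assocNorm_le fun a ha => ?_
  let _ := CStarAlgebra.spectralOrder A
  let _ := CStarAlgebra.spectralOrderedRing A
  have hu := CStarAlgebra.increasingApproximateUnit A
  have h1 : Filter.Tendsto (fun e : A => ‖assocAux A B C (e * a) (s * t)‖)
      (CStarAlgebra.approximateUnit A) (nhds ‖assocAux A B C a (s * t)‖) :=
    ((continuous_assocAux (s * t)).norm.tendsto a).comp (hu.tendsto_mul_right a)
  refine le_of_tendsto h1 ?_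
  filter_upwards [hu.eventually_norm] with e he
  rw [assocAux_mul]
  exact (norm_mul_le _ _).trans (mul_le_mul (assocAux_le s e he) (assocAux_le t a ha)
    (norm_nonneg _) (assocNorm_nonneg s))

lemma assocNorm_star_le (s : B ⊗[ℂ] C) : assocNorm A (star s) ≤ assocNorm A s :=
  assocNorm_le fun a ha => by
    have := assocAux_star (star a) s
    rw [star_star] at this
    rw [this, norm_star]
    exact assocAux_le s _ (by rwa [norm_star])

lemma assocNorm_sq_le (s : B ⊗[ℂ] C) :
    assocNorm A s * assocNorm A s ≤ assocNorm A (star s * s) := by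
  have h0 := assocNorm_nonneg (A := A) s
  have h : assocNorm A s ≤ Real.sqrt (assocNorm A (star s * s)) :=
    assocNorm_le fun a ha => Real.le_sqrt_of_sq_le <| by
      rw [sq, ← CStarRing.norm_star_mul_self, ← assocAux_star, ← assocAux_mul]
      refine assocAux_le _ _ ?_
      rw [CStarRing.norm_star_mul_self]
      nlinarith [norm_nonneg a]
  calc _ ≤ _ := mul_le_mul h h h0 (Real.sqrt_nonneg _)
    _ = _ := Real.mul_self_sqrt (assocNorm_nonneg _)

variable (A B C) in
/-- The C⋆-seminorm `s ↦ sup {‖assocAux a s‖ : ‖a‖ ≤ 1}`. -/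
def assocSeminorm : CStarSeminorm (B ⊗[ℂ] C) where
  toFun := assocNorm A
  map_zero' := le_antisymm (assocNorm_le fun a _ => by simp) (assocNorm_nonneg 0)
  add_le' s t := assocNorm_le fun a ha => by
    rw [map_add]
    exact norm_add_le_of_le (assocAux_le s a ha) (assocAux_le t a ha)
  neg' s := le_antisymm
    (by simpa using assocNorm_smul_le (A := A) (-1) s)
    (by simpa using assocNorm_smul_le (A := A) (-1) (-s))
  smul' c s := by
    refine le_antisymm (assocNorm_smul_le c s) ?_
    rcases eq_or_ne c 0 with rfl | hc
    · simpa using assocNorm_nonneg 0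
    · have h := assocNorm_smul_le (A := A) c⁻¹ (c • s)
      rw [smul_smul, inv_mul_cancel₀ hc, one_smul, norm_inv] at h
      rwa [le_inv_mul_iff₀ (norm_pos_iff.mpr hc)] at h
  mul_le' := assocNorm_mul_le
  cstar' s := le_antisymm
    ((assocNorm_mul_le _ _).trans
      (mul_le_mul_of_nonneg_right (assocNorm_star_le s) (assocNorm_nonneg s)))
    (assocNorm_sq_le s)

lemma norm_assocAux_le (a : A) (s : B ⊗[ℂ] C) :
    ‖assocAux A B C a s‖ ≤ ‖a‖ * maxSeminorm B C s := by
  have h := le_maxSeminorm (assocSeminorm A B C) s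
  rcases eq_or_ne a 0 with rfl | ha
  · simp
  have ha' : 0 < ‖a‖ := norm_pos_iff.mpr ha
  have h1 := assocAux_le s ((‖a‖⁻¹ : ℂ) • a) (by simp [norm_smul, ha'.ne'])
  rw [map_smul, LinearMap.smul_apply, norm_smul, norm_inv, Complex.norm_real, norm_norm,
    inv_mul_le_iff₀ ha'] at h1
  exact h1.trans (mul_le_mul_of_nonneg_left h (norm_nonneg a))

/-- Extension of `assocAux a` to the maximal tensor product. -/
def assocExt (a : A) : MaxTensor B C →L[ℂ] MaxTensor (MaxTensor A B) C :=
  (maxSeminorm B C).extendL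
    (LinearMap.mkContinuous (E := (maxSeminorm B C).Pre)
      { toFun := fun s => assocAux A B C a s
        map_add' := fun s t => map_add (assocAux A B C a) s t
        map_smul' := fun c s => map_smul (assocAux A B C a) c s } ‖a‖ (norm_assocAux_le a))

lemma assocExt_incl (a : A) (s : B ⊗[ℂ] C) :
    assocExt a (incl B C s) = assocAux A B C a s :=
  (maxSeminorm B C).extendL_toCompl _ s

lemma ext_dense {F : Type*} [TopologicalSpace F] [T2Space F] {f g : MaxTensor B C → F}
    (hf : Continuous f) (hg : Continuous g) (h : ∀ s, f (incl B C s) = g (incl B C s)) :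
    ∀ x, f x = g x :=
  congrFun ((denseRange_incl B C).equalizer hf hg (funext h))

lemma continuous_assocExt (a : A) : Continuous fun x : MaxTensor B C => assocExt a x :=
  (assocExt a).continuous

lemma assocExt_add (a a' : A) (x : MaxTensor B C) :
    assocExt (a + a') x = assocExt a x + assocExt a' x := by
  revert x
  refine ext_dense (continuous_assocExt _)
    ((continuous_assocExt _).add (continuous_assocExt _)) fun s => ?_
  simp only [assocExt_incl, map_add, LinearMap.add_apply]

lemma assocExt_smul (c : ℂ) (a : A) (x : MaxTensor B C) :
    assocExt (c • a) x = c • assocExt a x := by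
  revert x
  refine ext_dense (continuous_assocExt _) ((continuous_assocExt _).const_smul c) fun s => ?_
  simp only [assocExt_incl, map_smul, LinearMap.smul_apply]

lemma assocExt_mul (a a' : A) (x y : MaxTensor B C) :
    assocExt (a * a') (x * y) = assocExt a x * assocExt a' y := by
  revert x
  refine ext_dense ((continuous_assocExt _).comp (continuous_id.mul continuous_const))
    ((continuous_assocExt _).mul continuous_const) fun s => ?_
  revert y
  refine ext_dense ((continuous_assocExt _).comp (continuous_const.mul continuous_id))
    (continuous_const.mul (continuous_assocExt _)) fun t => ?_
  simp only [← map_mul, assocExt_incl, assocAux_mul]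

lemma assocExt_star (a : A) (x : MaxTensor B C) :
    assocExt (star a) (star x) = star (assocExt a x) := by
  revert x
  refine ext_dense ((continuous_assocExt _).comp continuous_star)
    (continuous_star.comp (continuous_assocExt _)) fun s => ?_
  simp only [← map_star, assocExt_incl, assocAux_star]

variable (A B C) in
/-- The canonical ⋆-homomorphism `A ⊗ (B ⊗ C) → (A ⊗ B) ⊗ C`. -/
def assocInv : MaxTensor A (MaxTensor B C) →⋆ₙₐ[ℂ] MaxTensor (MaxTensor A B) C :=
  lift (LinearMap.mk₂ ℂ (fun a x => assocExt a x) assocExt_add assocExt_smul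
      (fun a => map_add (assocExt a)) (fun c a => map_smul (assocExt a) c))
    (fun a x a' y => assocExt_mul a a' x y) (fun a x => assocExt_star a x)

@[simp] lemma assocInv_tmul (a : A) (b : B) (c : C) :
    assocInv A B C (tmul a (tmul b c)) = tmul (tmul a b) c := by
  refine (lift_tmul _ _ _ a (tmul b c)).trans ?_
  exact (assocExt_incl a _).trans (assocAux_tmul a b c)

lemma hom_ext₃ {D : Type v} [NonUnitalCStarAlgebra D]
    {f g : MaxTensor A (MaxTensor B C) →⋆ₙₐ[ℂ] D}
    (h : ∀ a b c, f (tmul a (tmul b c)) = g (tmul a (tmul b c))) : f = g := by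
  refine hom_ext fun a => ?_
  refine ext_dense ((continuous_starHom f).comp (continuous_tmul a))
    ((continuous_starHom g).comp (continuous_tmul a)) fun s => ?_
  induction s using TensorProduct.induction_on with
  | zero => simp [tmul]
  | tmul b c => exact h a b c
  | add x y hx hy =>
    simp only [map_add, tmul_add, hx, hy]

end MaxTensor

end Assoc

section UnitAlg

instance : StarRing (ULift.{u} ℂ) where
  star x := ⟨star x.down⟩
  star_involutive x := ULift.ext _ _ (star_star x.down)
  star_mul x y := ULift.ext _ _ (star_mul x.down y.down)
  star_add x y := ULift.ext _ _ (star_add x.down y.down)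

/-- The C⋆-algebra of complex numbers in an arbitrary universe. -/
instance : NonUnitalCStarAlgebra (ULift.{u} ℂ) :=
  { (inferInstance : NonUnitalNormedRing (ULift.{u} ℂ)),
    (inferInstance : NormedSpace ℂ (ULift.{u} ℂ)),
    (inferInstance : StarRing (ULift.{u} ℂ)),
    (inferInstance : CompleteSpace (ULift.{u} ℂ)),
    (inferInstance : IsScalarTower ℂ (ULift.{u} ℂ) (ULift.{u} ℂ)),
    (inferInstance : SMulCommClass ℂ (ULift.{u} ℂ) (ULift.{u} ℂ)) with
    norm_mul_self_le := fun x => (CStarRing.norm_star_mul_self (x := x.down)).ge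
    star_smul := fun c x => ULift.ext _ _ (star_smul c x.down) }

/-- The zero C⋆-algebra. -/
instance : NonUnitalCStarAlgebra PUnit.{u + 1} :=
  { (inferInstance : NormedCommRing PUnit.{u + 1}),
    (inferInstance : NormedSpace ℂ PUnit.{u + 1}),
    (inferInstance : CompleteSpace PUnit.{u + 1}) with
    norm_mul_self_le := fun _ => by simp
    star := id
    star_involutive := fun _ => rfl
    star_mul := fun _ _ => rfl
    star_add := fun _ _ => rfl
    star_smul := fun _ _ => rfl
    smul_assoc := fun _ _ _ => rfl
    smul_comm := fun _ _ _ => rfl }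

end UnitAlg

/-- The category of (not necessarily unital) C⋆-algebras and ⋆-homomorphisms. -/
structure CStarAlg where
  /-- The underlying type. -/
  carrier : Type u
  [alg : NonUnitalCStarAlgebra carrier]

namespace CStarAlg

instance : CoeSort CStarAlg.{u} (Type u) := ⟨carrier⟩

attribute [instance] alg

/-- Morphisms of C⋆-algebras: the ⋆-homomorphisms. -/
@[ext]
structure Hom (A B : CStarAlg.{u}) where
  /-- The underlying ⋆-homomorphism. -/
  hom : A →⋆ₙₐ[ℂ] B

instance : Category CStarAlg.{u} where
  Hom A B := Hom A B
  id A := ⟨NonUnitalStarAlgHom.id ℂ A⟩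
  comp f g := ⟨g.hom.comp f.hom⟩

/-- Constructor for objects. -/
abbrev of (A : Type u) [NonUnitalCStarAlgebra A] : CStarAlg.{u} := ⟨A⟩

/-- Constructor for morphisms. -/
def ofHom {A B : Type u} [NonUnitalCStarAlgebra A] [NonUnitalCStarAlgebra B] (f : A →⋆ₙₐ[ℂ] B) :
    of A ⟶ of B := ⟨f⟩

/-- The underlying ⋆-homomorphism of a morphism. -/
def homOf {A B : CStarAlg.{u}} (f : A ⟶ B) : A →⋆ₙₐ[ℂ] B := Hom.hom f

@[simp] lemma homOf_ofHom {A B : Type u} [NonUnitalCStarAlgebra A] [NonUnitalCStarAlgebra B]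
    (f : A →⋆ₙₐ[ℂ] B) : homOf (ofHom f) = f := rfl

@[simp] lemma homOf_id (A : CStarAlg.{u}) : homOf (𝟙 A) = NonUnitalStarAlgHom.id ℂ A := rfl

@[simp] lemma homOf_comp {A B C : CStarAlg.{u}} (f : A ⟶ B) (g : B ⟶ C) :
    homOf (f ≫ g) = (homOf g).comp (homOf f) := rfl

lemma hom_ext {A B : CStarAlg.{u}} {f g : A ⟶ B} (h : homOf f = homOf g) : f = g :=
  Hom.ext h

/-- The complex numbers. -/
abbrev unit : CStarAlg.{u} := of (ULift.{u} ℂ)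

/-- The zero algebra. -/
abbrev zero : CStarAlg.{u} := of PUnit.{u + 1}

/-- The maximal tensor product. -/
abbrev tensor (A B : CStarAlg.{u}) : CStarAlg.{u} := of (MaxTensor A B)

/-- Functoriality of the maximal tensor product. -/
def tensorMap {A A' B B' : CStarAlg.{u}} (f : A ⟶ A') (g : B ⟶ B') : tensor A B ⟶ tensor A' B' :=
  ofHom (MaxTensor.map (homOf f) (homOf g))

lemma tensorMap_tmul {A A' B B' : CStarAlg.{u}} (f : A ⟶ A') (g : B ⟶ B') (a : A) (b : B) :
    homOf (tensorMap f g) (MaxTensor.tmul a b) = MaxTensor.tmul (homOf f a) (homOf g b) :=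
  MaxTensor.map_tmul _ _ a b

lemma tensor_ext {A B D : CStarAlg.{u}} {f g : tensor A B ⟶ D}
    (h : ∀ a b, homOf f (MaxTensor.tmul a b) = homOf g (MaxTensor.tmul a b)) : f = g :=
  hom_ext (MaxTensor.hom_ext h)

@[simp] lemma tensorMap_id (A B : CStarAlg.{u}) : tensorMap (𝟙 A) (𝟙 B) = 𝟙 (tensor A B) :=
  hom_ext MaxTensor.map_id

lemma tensorMap_comp {A A' A'' B B' B'' : CStarAlg.{u}} (f : A ⟶ A') (f' : A' ⟶ A'')
    (g : B ⟶ B') (g' : B' ⟶ B'') :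
    tensorMap (f ≫ f') (g ≫ g') = tensorMap f g ≫ tensorMap f' g' :=
  hom_ext (MaxTensor.map_comp _ _ _ _)

/-- The canonical map `A ⊗ (B ⊗ C) ⟶ (A ⊗ B) ⊗ C`. -/
def assocInv (A B C : CStarAlg.{u}) : tensor A (tensor B C) ⟶ tensor (tensor A B) C :=
  ofHom (MaxTensor.assocInv A B C)

/-- The canonical map `B ⟶ ℂ ⊗ B`, `b ↦ 1 ⊗ b`. -/
def unitInv (B : CStarAlg.{u}) : B ⟶ tensor unit B :=
  ofHom
    { toFun := fun b => MaxTensor.tmul (1 : ULift.{u} ℂ) b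
      map_smul' := fun c b => MaxTensor.tmul_smul c _ b
      map_zero' := by simp [MaxTensor.tmul]
      map_add' := fun a b => MaxTensor.tmul_add _ a b
      map_mul' := fun a b => by
        rw [MaxTensor.tmul_mul_tmul]
        exact congrArg (fun z => MaxTensor.tmul z (a * b)) (one_mul (1 : ULift.{u} ℂ)).symm
      map_star' := fun b => by
        rw [MaxTensor.star_tmul]
        exact congrArg (fun z => MaxTensor.tmul z (star b)) (ULift.ext _ _ (star_one ℂ).symm) }

lemma homOf_unitInv (B : CStarAlg.{u}) (b : B) :
    homOf (unitInv B) b = MaxTensor.tmul (1 : ULift.{u} ℂ) b := rfl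

lemma homOf_assocInv_tmul (A B C : CStarAlg.{u}) (a : A) (b : B) (c : C) :
    homOf (assocInv A B C) (MaxTensor.tmul a (MaxTensor.tmul b c)) =
      MaxTensor.tmul (MaxTensor.tmul a b) c :=
  MaxTensor.assocInv_tmul a b c

lemma tensor_ext₃ {A B C D : CStarAlg.{u}} {f g : tensor A (tensor B C) ⟶ D}
    (h : ∀ a b c, homOf f (MaxTensor.tmul a (MaxTensor.tmul b c)) =
      homOf g (MaxTensor.tmul a (MaxTensor.tmul b c))) : f = g :=
  hom_ext (MaxTensor.hom_ext₃ h)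

lemma assocInv_naturality₃ (A B : CStarAlg.{u}) {C C' : CStarAlg.{u}} (f : C ⟶ C') :
    assocInv A B C ≫ tensorMap (𝟙 (tensor A B)) f =
      tensorMap (𝟙 A) (tensorMap (𝟙 B) f) ≫ assocInv A B C' := by
  refine tensor_ext₃ fun a b c => ?_
  have h₁ : homOf (tensorMap (𝟙 (tensor A B)) f) (homOf (assocInv A B C)
      (MaxTensor.tmul a (MaxTensor.tmul b c))) =
        MaxTensor.tmul (MaxTensor.tmul a b) (homOf f c) :=
    (congrArg _ (homOf_assocInv_tmul A B C a b c)).trans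
      (tensorMap_tmul (𝟙 (tensor A B)) f (MaxTensor.tmul a b) c)
  have h₂ : homOf (tensorMap (𝟙 A) (tensorMap (𝟙 B) f)) (MaxTensor.tmul a (MaxTensor.tmul b c)) =
        MaxTensor.tmul a (MaxTensor.tmul b (homOf f c)) :=
    (tensorMap_tmul (𝟙 A) (tensorMap (𝟙 B) f) a (MaxTensor.tmul b c)).trans
      (congrArg (MaxTensor.tmul a) (tensorMap_tmul (𝟙 B) f b c))
  exact h₁.trans ((congrArg (homOf (assocInv A B C')) h₂).trans
    (homOf_assocInv_tmul A B C' a b (homOf f c))).symm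

lemma unitInv_naturality {B B' : CStarAlg.{u}} (f : B ⟶ B') :
    unitInv B ≫ tensorMap (𝟙 unit) f = f ≫ unitInv B' := by
  refine hom_ext (DFunLike.ext _ _ fun b => ?_)
  exact tensorMap_tmul (𝟙 unit) f (1 : ULift.{u} ℂ) b

/-- The product of two C⋆-algebras. -/
abbrev prod (A B : CStarAlg.{u}) : CStarAlg.{u} := of (A × B)

/-- First projection. -/
def prodFst (A B : CStarAlg.{u}) : prod A B ⟶ A := ofHom (NonUnitalStarAlgHom.fst ℂ A B)

/-- Second projection. -/
def prodSnd (A B : CStarAlg.{u}) : prod A B ⟶ B := ofHom (NonUnitalStarAlgHom.snd ℂ A B)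

/-- Pairing of morphisms. -/
def prodLift {D A B : CStarAlg.{u}} (f : D ⟶ A) (g : D ⟶ B) : D ⟶ prod A B :=
  ofHom ((homOf f).prod (homOf g))

lemma prodLift_fst {D A B : CStarAlg.{u}} (f : D ⟶ A) (g : D ⟶ B) :
    prodLift f g ≫ prodFst A B = f := rfl

lemma prodLift_snd {D A B : CStarAlg.{u}} (f : D ⟶ A) (g : D ⟶ B) :
    prodLift f g ≫ prodSnd A B = g := rfl

lemma prod_ext {D A B : CStarAlg.{u}} {f g : D ⟶ prod A B}
    (h₁ : f ≫ prodFst A B = g ≫ prodFst A B) (h₂ : f ≫ prodSnd A B = g ≫ prodSnd A B) : f = g :=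
  hom_ext <| DFunLike.ext _ _ fun x =>
    Prod.ext (DFunLike.congr_fun (congrArg homOf h₁) x) (DFunLike.congr_fun (congrArg homOf h₂) x)

/-- The morphism to the zero algebra. -/
def toZero (A : CStarAlg.{u}) : A ⟶ zero := ofHom 0

lemma zero_ext {A : CStarAlg.{u}} (f g : A ⟶ zero) : f = g :=
  hom_ext <| DFunLike.ext _ _ fun _ => rfl

/-- The algebra of continuous functions on the unit interval with values in a C⋆-algebra. -/
abbrev path (B : CStarAlg.{u}) : CStarAlg.{u} := of C(unitInterval, B)

/-- Composition of paths with a ⋆-homomorphism. -/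
def pathMap {B B' : CStarAlg.{u}} (f : B ⟶ B') : path B ⟶ path B' :=
  ofHom
    { toFun := fun h => ⟨fun t => homOf f (h t), (continuous_starHom _).comp h.continuous⟩
      map_smul' := fun _ _ => ContinuousMap.ext fun _ => map_smul (homOf f) _ _
      map_zero' := ContinuousMap.ext fun _ => map_zero (homOf f)
      map_add' := fun _ _ => ContinuousMap.ext fun _ => map_add (homOf f) _ _
      map_mul' := fun _ _ => ContinuousMap.ext fun _ => map_mul (homOf f) _ _
      map_star' := fun _ => ContinuousMap.ext fun _ => map_star (homOf f) _ }

/-- Evaluation of paths. -/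
def evalAt (t : unitInterval) (B : CStarAlg.{u}) : path B ⟶ B :=
  ofHom
    { toFun := fun h => h t
      map_smul' := fun _ _ => rfl
      map_zero' := rfl
      map_add' := fun _ _ => rfl
      map_mul' := fun _ _ => rfl
      map_star' := fun _ => rfl }

lemma path_ext {D B : CStarAlg.{u}} {f g : D ⟶ path B}
    (h : ∀ t, f ≫ evalAt t B = g ≫ evalAt t B) : f = g :=
  hom_ext <| DFunLike.ext _ _ fun x => ContinuousMap.ext fun t =>
    DFunLike.congr_fun (congrArg homOf (h t)) x

lemma pathMap_evalAt {B B' : CStarAlg.{u}} (f : B ⟶ B') (t : unitInterval) :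
    pathMap f ≫ evalAt t B' = evalAt t B ≫ f := rfl

/-- The bilinear map `(a, f) ↦ [t ↦ a ⊗ f(t)]`. -/
def pathBilin (A B : CStarAlg.{u}) : A →ₗ[ℂ] path B →ₗ[ℂ] path (tensor A B) :=
  LinearMap.mk₂ ℂ
    (fun a f => (⟨fun t => MaxTensor.tmul a (f t),
      (MaxTensor.continuous_tmul a).comp f.continuous⟩ : C(unitInterval, MaxTensor A B)))
    (fun a a' f => ContinuousMap.ext fun t => MaxTensor.add_tmul a a' (f t))
    (fun c a f => ContinuousMap.ext fun t => MaxTensor.smul_tmul c a (f t))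
    (fun a f f' => ContinuousMap.ext fun t => MaxTensor.tmul_add a (f t) (f' t))
    (fun c a f => ContinuousMap.ext fun t => MaxTensor.tmul_smul c a (f t))

lemma pathBilin_mul (A B : CStarAlg.{u}) (a : A) (f : path B) (a' : A) (f' : path B) :
    pathBilin A B (a * a') (f * f') = pathBilin A B a f * pathBilin A B a' f' :=
  ContinuousMap.ext fun t => (MaxTensor.tmul_mul_tmul a a' (f t) (f' t)).symm

lemma pathBilin_star (A B : CStarAlg.{u}) (a : A) (f : path B) :
    pathBilin A B (star a) (star f) = star (pathBilin A B a f) :=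
  ContinuousMap.ext fun t => (MaxTensor.star_tmul a (f t)).symm

/-- The map `A ⊗ C([0,1], B) ⟶ C([0,1], A ⊗ B)`, `a ⊗ f ↦ [t ↦ a ⊗ f(t)]`. -/
def pathLabel (A B : CStarAlg.{u}) : tensor A (path B) ⟶ path (tensor A B) :=
  ofHom (MaxTensor.lift (pathBilin A B) (pathBilin_mul A B) (pathBilin_star A B))

lemma pathLabel_tmul (A B : CStarAlg.{u}) (a : A) (f : path B) (t : unitInterval) :
    (homOf (pathLabel A B) (MaxTensor.tmul a f) : C(unitInterval, MaxTensor A B)) t =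
      MaxTensor.tmul a (f t) :=
  congrArg (fun h : C(unitInterval, MaxTensor A B) => h t)
    (MaxTensor.lift_tmul (pathBilin A B) (pathBilin_mul A B) (pathBilin_star A B) a f)

lemma pathLabel_evalAt (A B : CStarAlg.{u}) (t : unitInterval) :
    pathLabel A B ≫ evalAt t _ = tensorMap (𝟙 A) (evalAt t B) :=
  tensor_ext fun a f => (pathLabel_tmul A B a f t).trans
    (tensorMap_tmul (𝟙 A) (evalAt t B) a f).symm

lemma prodLift_comp {D E A B : CStarAlg.{u}} (h : D ⟶ E) (f : E ⟶ A) (g : E ⟶ B) :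
    h ≫ prodLift f g = prodLift (h ≫ f) (h ≫ g) := rfl

/-- The product of two morphisms. -/
def prodMap {A A' B B' : CStarAlg.{u}} (f : A ⟶ A') (g : B ⟶ B') : prod A B ⟶ prod A' B' :=
  prodLift (prodFst A B ≫ f) (prodSnd A B ≫ g)

/-- The map `A ⊗ (X ⊕ Y) ⟶ (A ⊗ X) ⊕ (A ⊗ Y) ⟶ X' ⊕ Y'`. -/
def prodLabel {A X X' Y Y' : CStarAlg.{u}} (k : tensor A X ⟶ X') (l : tensor A Y ⟶ Y') :
    tensor A (prod X Y) ⟶ prod X' Y' :=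
  prodLift (tensorMap (𝟙 A) (prodFst X Y)) (tensorMap (𝟙 A) (prodSnd X Y)) ≫ prodMap k l

lemma prodLabel_fst {A X X' Y Y' : CStarAlg.{u}} (k : tensor A X ⟶ X') (l : tensor A Y ⟶ Y') :
    prodLabel k l ≫ prodFst X' Y' = tensorMap (𝟙 A) (prodFst X Y) ≫ k := rfl

lemma prodLabel_snd {A X X' Y Y' : CStarAlg.{u}} (k : tensor A X ⟶ X') (l : tensor A Y ⟶ Y') :
    prodLabel k l ≫ prodSnd X' Y' = tensorMap (𝟙 A) (prodSnd X Y) ≫ l := rfl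

lemma prodMap_fst {A A' B B' : CStarAlg.{u}} (f : A ⟶ A') (g : B ⟶ B') :
    prodMap f g ≫ prodFst A' B' = prodFst A B ≫ f := rfl

lemma prodMap_snd {A A' B B' : CStarAlg.{u}} (f : A ⟶ A') (g : B ⟶ B') :
    prodMap f g ≫ prodSnd A' B' = prodSnd A B ≫ g := rfl

lemma prodMap_id (A B : CStarAlg.{u}) : prodMap (𝟙 A) (𝟙 B) = 𝟙 (prod A B) := rfl

lemma prodLabel_naturality {A A' X X₂ X' X₂' Y Y₂ Y' Y₂' : CStarAlg.{u}} {φ : A ⟶ A'}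
    {f : X ⟶ X₂} {g : Y ⟶ Y₂} {k : tensor A X ⟶ X'} {l : tensor A Y ⟶ Y'}
    {k₂ : tensor A' X₂ ⟶ X₂'} {l₂ : tensor A' Y₂ ⟶ Y₂'} {f' : X' ⟶ X₂'} {g' : Y' ⟶ Y₂'}
    (hk : tensorMap φ f ≫ k₂ = k ≫ f') (hl : tensorMap φ g ≫ l₂ = l ≫ g') :
    tensorMap φ (prodMap f g) ≫ prodLabel k₂ l₂ = prodLabel k l ≫ prodMap f' g' := by
  refine prod_ext ?_ ?_
  · rw [Category.assoc, Category.assoc, prodLabel_fst, prodMap_fst, ← Category.assoc,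
      ← tensorMap_comp, prodMap_fst, ← Category.assoc (prodLabel k l), prodLabel_fst,
      Category.assoc, ← hk, ← Category.assoc, ← tensorMap_comp, Category.comp_id,
      Category.id_comp]
  · rw [Category.assoc, Category.assoc, prodLabel_snd, prodMap_snd, ← Category.assoc,
      ← tensorMap_comp, prodMap_snd, ← Category.assoc (prodLabel k l), prodLabel_snd,
      Category.assoc, ← hl, ← Category.assoc, ← tensorMap_comp, Category.comp_id,
      Category.id_comp]

lemma prodLabel_tensor {A A' X X' Y Y' X'' Y'' X₃ Y₃ : CStarAlg.{u}}
    {k : tensor (tensor A A') X ⟶ X₃} {l : tensor (tensor A A') Y ⟶ Y₃}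
    {k' : tensor A' X ⟶ X'} {l' : tensor A' Y ⟶ Y'}
    {k₂ : tensor A X' ⟶ X''} {l₂ : tensor A Y' ⟶ Y''} {m : X'' ⟶ X₃} {n : Y'' ⟶ Y₃}
    (hk : assocInv A A' X ≫ k = tensorMap (𝟙 A) k' ≫ k₂ ≫ m)
    (hl : assocInv A A' Y ≫ l = tensorMap (𝟙 A) l' ≫ l₂ ≫ n) :
    assocInv A A' (prod X Y) ≫ prodLabel k l =
      tensorMap (𝟙 A) (prodLabel k' l') ≫ prodLabel k₂ l₂ ≫ prodMap m n := by
  refine prod_ext ?_ ?_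
  · rw [Category.assoc, prodLabel_fst, ← Category.assoc, assocInv_naturality₃, Category.assoc, hk,
      Category.assoc, Category.assoc, prodMap_fst, ← Category.assoc (prodLabel k₂ l₂),
      prodLabel_fst, ← Category.assoc, ← Category.assoc, ← Category.assoc, ← Category.assoc,
      ← tensorMap_comp, ← tensorMap_comp, prodLabel_fst]
  · rw [Category.assoc, prodLabel_snd, ← Category.assoc, assocInv_naturality₃, Category.assoc, hl,
      Category.assoc, Category.assoc, prodMap_snd, ← Category.assoc (prodLabel k₂ l₂),
      prodLabel_snd, ← Category.assoc, ← Category.assoc, ← Category.assoc, ← Category.assoc,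
      ← tensorMap_comp, ← tensorMap_comp, prodLabel_snd]

lemma prodLabel_unit {X X' Y Y' : CStarAlg.{u}} {k : tensor unit X ⟶ X'} {l : tensor unit Y ⟶ Y'}
    {m : X ⟶ X'} {n : Y ⟶ Y'} (hk : unitInv X ≫ k = m) (hl : unitInv Y ≫ l = n) :
    unitInv (prod X Y) ≫ prodLabel k l = prodMap m n := by
  subst hk hl
  refine prod_ext ?_ ?_
  · rw [Category.assoc, prodLabel_fst, prodMap_fst, ← Category.assoc, unitInv_naturality,
      Category.assoc]
  · rw [Category.assoc, prodLabel_snd, prodMap_snd, ← Category.assoc, unitInv_naturality,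
      Category.assoc]

lemma pathLabel_naturality {A A' B B' : CStarAlg.{u}} (φ : A ⟶ A') (f : B ⟶ B') :
    tensorMap φ (pathMap f) ≫ pathLabel A' B' = pathLabel A B ≫ pathMap (tensorMap φ f) :=
  path_ext fun t => by
    rw [Category.assoc, Category.assoc, pathLabel_evalAt, pathMap_evalAt, ← tensorMap_comp,
      ← Category.assoc, pathLabel_evalAt, ← tensorMap_comp, pathMap_evalAt, Category.comp_id,
      Category.id_comp]

lemma pathMap_id (B : CStarAlg.{u}) : pathMap (𝟙 B) = 𝟙 (path B) := rfl

lemma pathLabel_tensor (A A' B : CStarAlg.{u}) :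
    assocInv A A' (path B) ≫ pathLabel (tensor A A') B =
      tensorMap (𝟙 A) (pathLabel A' B) ≫ pathLabel A (tensor A' B) ≫ pathMap (assocInv A A' B) :=
  path_ext fun t => by
    rw [Category.assoc, pathLabel_evalAt, assocInv_naturality₃, Category.assoc, Category.assoc,
      pathMap_evalAt, ← Category.assoc (pathLabel A (tensor A' B)), pathLabel_evalAt,
      ← Category.assoc, ← tensorMap_comp, pathLabel_evalAt, Category.comp_id]

lemma pathLabel_unit (B : CStarAlg.{u}) :
    unitInv (path B) ≫ pathLabel unit B = pathMap (unitInv B) :=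
  path_ext fun t => by
    rw [Category.assoc, pathLabel_evalAt, unitInv_naturality, pathMap_evalAt]

end CStarAlg

namespace CStarAlg

section Pullback

variable {P X Y Z : CStarAlg.{u}} {p : P ⟶ X} {q : P ⟶ Y} {f : X ⟶ Z} {g : Y ⟶ Z}

/-- The pullback of C⋆-algebras as a subalgebra of the product. -/
def pbSub (f : X ⟶ Z) (g : Y ⟶ Z) : NonUnitalStarSubalgebra ℂ (X × Y) where
  carrier := {z | homOf f z.1 = homOf g z.2}
  add_mem' {a b} ha hb := by
    change homOf f (a.1 + b.1) = homOf g (a.2 + b.2)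
    rw [map_add, map_add, show homOf f a.1 = _ from ha, show homOf f b.1 = _ from hb]
  zero_mem' := (map_zero (homOf f)).trans (map_zero (homOf g)).symm
  mul_mem' {a b} ha hb := by
    change homOf f (a.1 * b.1) = homOf g (a.2 * b.2)
    rw [map_mul, map_mul, show homOf f a.1 = _ from ha, show homOf f b.1 = _ from hb]
  smul_mem' c a ha := by
    change homOf f (c • a.1) = homOf g (c • a.2)
    rw [map_smul, map_smul, show homOf f a.1 = _ from ha]
  star_mem' {a} ha := by
    change homOf f (star a.1) = homOf g (star a.2)
    rw [map_star, map_star, show homOf f a.1 = _ from ha]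

instance (f : X ⟶ Z) (g : Y ⟶ Z) : IsClosed ((pbSub f g : NonUnitalStarSubalgebra ℂ (X × Y)) : Set (X × Y)) :=
  isClosed_eq ((continuous_starHom (homOf f)).comp continuous_fst)
    ((continuous_starHom (homOf g)).comp continuous_snd)

instance (f : X ⟶ Z) (g : Y ⟶ Z) : NonUnitalCStarAlgebra (pbSub f g) :=
  NonUnitalStarSubalgebra.nonUnitalCStarAlgebra _ (h_closed := inferInstance)

/-- A pullback square of C⋆-algebras is a pullback of the underlying sets. -/
lemma existsUnique_of_isPullback (h : IsPullback p q f g) (x : X) (y : Y)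
    (hxy : homOf f x = homOf g y) : ∃! w : P, homOf p w = x ∧ homOf q w = y := by
  let i : of (pbSub f g) ⟶ prod X Y := ofHom (NonUnitalStarSubalgebraClass.subtype (pbSub f g))
  have hi : (i ≫ prodFst X Y) ≫ f = (i ≫ prodSnd X Y) ≫ g :=
    hom_ext (DFunLike.ext _ _ fun z => z.2)
  let l := h.lift _ _ hi
  refine ⟨homOf l ⟨(x, y), hxy⟩, ⟨?_, ?_⟩, ?_⟩
  · exact DFunLike.congr_fun (congrArg homOf (h.lift_fst _ _ hi)) _
  · exact DFunLike.congr_fun (congrArg homOf (h.lift_snd _ _ hi)) _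
  · rintro w ⟨rfl, rfl⟩
    let k : P ⟶ of (pbSub f g) := ofHom
      { toFun := fun w => ⟨(homOf p w, homOf q w), DFunLike.congr_fun (congrArg homOf h.w) w⟩
        map_smul' := fun c w => Subtype.ext (Prod.ext (map_smul _ _ _) (map_smul _ _ _))
        map_zero' := Subtype.ext (Prod.ext (map_zero _) (map_zero _))
        map_add' := fun a b => Subtype.ext (Prod.ext (map_add _ _ _) (map_add _ _ _))
        map_mul' := fun a b => Subtype.ext (Prod.ext (map_mul _ _ _) (map_mul _ _ _))
        map_star' := fun a => Subtype.ext (Prod.ext (map_star _ _) (map_star _ _)) }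
    have hkl : k ≫ l = 𝟙 P := h.hom_ext
      (by rw [Category.assoc, h.lift_fst, Category.id_comp]; rfl)
      (by rw [Category.assoc, h.lift_snd, Category.id_comp]; rfl)
    exact (DFunLike.congr_fun (congrArg homOf hkl) w).symm

/-- A commutative square of C⋆-algebras is a pullback if it is one on underlying sets. -/
lemma isPullback_of_existsUnique (w : p ≫ f = q ≫ g)
    (h : ∀ (x : X) (y : Y), homOf f x = homOf g y → ∃! w : P, homOf p w = x ∧ homOf q w = y) :
    IsPullback p q f g := by
  choose L hL hu using h
  have hs : ∀ {W : CStarAlg.{u}} (a : W ⟶ X) (b : W ⟶ Y), a ≫ f = b ≫ g → ∀ z,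
      homOf f (homOf a z) = homOf g (homOf b z) :=
    fun a b e z => DFunLike.congr_fun (congrArg homOf e) z
  have key : ∀ s t : P, homOf p s = homOf p t → homOf q s = homOf q t → s = t := fun s t e e' => by
    have hst : homOf f (homOf p t) = homOf g (homOf q t) :=
      DFunLike.congr_fun (congrArg homOf w) t
    exact (hu _ _ hst s ⟨e, e'⟩).trans (hu _ _ hst t ⟨rfl, rfl⟩).symm
  refine ⟨⟨w⟩, ⟨Limits.PullbackCone.IsLimit.mk w (fun s => ofHom
    { toFun := fun z => L (homOf s.fst z) (homOf s.snd z) (hs _ _ s.condition z)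
      map_smul' := fun c z => key _ _ ?_ ?_
      map_zero' := key _ _ ?_ ?_
      map_add' := fun a b => key _ _ ?_ ?_
      map_mul' := fun a b => key _ _ ?_ ?_
      map_star' := fun a => key _ _ ?_ ?_ }) ?_ ?_ ?_⟩⟩
  · simp only [(hL _ _ _).1, map_smul, MonoidHom.id_apply]
  · simp only [(hL _ _ _).2, map_smul, MonoidHom.id_apply]
  · simp only [(hL _ _ _).1, map_zero]
  · simp only [(hL _ _ _).2, map_zero]
  · simp only [(hL _ _ _).1, map_add]
  · simp only [(hL _ _ _).2, map_add]
  · simp only [(hL _ _ _).1, map_mul]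
  · simp only [(hL _ _ _).2, map_mul]
  · simp only [(hL _ _ _).1, map_star]
  · simp only [(hL _ _ _).2, map_star]
  · exact fun s => hom_ext (DFunLike.ext _ _ fun z => (hL _ _ (hs _ _ s.condition z)).1)
  · exact fun s => hom_ext (DFunLike.ext _ _ fun z => (hL _ _ (hs _ _ s.condition z)).2)
  · intro s m h₁ h₂
    refine hom_ext (DFunLike.ext _ _ fun z => hu _ _ _ _ ⟨?_, ?_⟩)
    · exact DFunLike.congr_fun (congrArg homOf h₁) z
    · exact DFunLike.congr_fun (congrArg homOf h₂) z

end Pullback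

/-- Decent endofunctors: those that preserve pullbacks in which one of the two morphisms to the
common codomain is a split epimorphism, and that preserve the zero algebra. -/
structure IsDecent (F : CStarAlg.{u} ⥤ CStarAlg.{u}) : Prop where
  map_pullback : ∀ {P X Y Z : CStarAlg.{u}} {p : P ⟶ X} {q : P ⟶ Y} {f : X ⟶ Z} {g : Y ⟶ Z},
    IsPullback p q f g → IsSplitEpi g → IsPullback (F.map p) (F.map q) (F.map f) (F.map g)
  map_zero : IsIso (toZero (F.obj zero))

lemma isIso_toZero_iff (A : CStarAlg.{u}) : IsIso (toZero A) ↔ Subsingleton A := by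
  constructor
  · intro h
    refine ⟨fun a b => ?_⟩
    have := DFunLike.congr_fun (congrArg homOf (IsIso.hom_inv_id (toZero A)))
    exact (this a).symm.trans (this b)
  · intro h
    exact ⟨ofHom 0, hom_ext (DFunLike.ext _ _ fun _ => Subsingleton.elim _ _), zero_ext _ _⟩

lemma isDecent_id : IsDecent (𝟭 CStarAlg.{u}) where
  map_pullback h _ := h
  map_zero := (isIso_toZero_iff _).mpr (inferInstanceAs (Subsingleton PUnit))

lemma IsDecent.comp {F G : CStarAlg.{u} ⥤ CStarAlg.{u}} (hF : IsDecent F) (hG : IsDecent G) :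
    IsDecent (G ⋙ F) where
  map_pullback h _ := hF.map_pullback (hG.map_pullback h inferInstance) inferInstance
  map_zero := by
    have h1 : IsIso (F.map (toZero (G.obj zero))) := @Functor.map_isIso _ _ _ _ _ _ F _ hG.map_zero
    have h2 := hF.map_zero
    rw [zero_ext (toZero ((G ⋙ F).obj zero)) (F.map (toZero (G.obj zero)) ≫ toZero (F.obj zero))]
    infer_instance

/-- The zero endofunctor. -/
def zeroFunctor : CStarAlg.{u} ⥤ CStarAlg.{u} := (Functor.const _).obj zero

lemma isDecent_zero : IsDecent zeroFunctor.{u} where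
  map_pullback _ _ := isPullback_of_existsUnique (zero_ext _ _)
    fun _ _ _ => ⟨PUnit.unit, ⟨rfl, rfl⟩, fun _ _ => rfl⟩
  map_zero := (isIso_toZero_iff _).mpr (inferInstanceAs (Subsingleton PUnit))

/-- The pointwise product of two endofunctors. -/
def prodFunctor (F G : CStarAlg.{u} ⥤ CStarAlg.{u}) : CStarAlg.{u} ⥤ CStarAlg.{u} where
  obj B := prod (F.obj B) (G.obj B)
  map f := prodMap (F.map f) (G.map f)
  map_id B := by
    rw [F.map_id, G.map_id]; rfl
  map_comp f g := by
    rw [F.map_comp, G.map_comp]; rfl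

lemma IsDecent.prod {F G : CStarAlg.{u} ⥤ CStarAlg.{u}} (hF : IsDecent F) (hG : IsDecent G) :
    IsDecent (prodFunctor F G) where
  map_pullback {P X Y Z p q f g} h hg := by
    refine isPullback_of_existsUnique ?_ fun x y hxy => ?_
    · rw [← Functor.map_comp, ← Functor.map_comp, h.w]
    · obtain ⟨a, ⟨h₁, h₂⟩, h₃⟩ := existsUnique_of_isPullback (hF.map_pullback h hg) x.1 y.1
        (congrArg Prod.fst hxy)
      obtain ⟨b, ⟨h₄, h₅⟩, h₆⟩ := existsUnique_of_isPullback (hG.map_pullback h hg) x.2 y.2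
        (congrArg Prod.snd hxy)
      refine ⟨(a, b), ⟨Prod.ext h₁ h₄, Prod.ext h₂ h₅⟩, ?_⟩
      rintro ⟨a', b'⟩ ⟨h₇, h₈⟩
      exact Prod.ext (h₃ a' ⟨congrArg Prod.fst h₇, congrArg Prod.fst h₈⟩)
        (h₆ b' ⟨congrArg Prod.snd h₇, congrArg Prod.snd h₈⟩)
  map_zero := by
    have h₁ : Subsingleton (F.obj zero) := (isIso_toZero_iff _).mp hF.map_zero
    have h₂ : Subsingleton (G.obj zero) := (isIso_toZero_iff _).mp hG.map_zero
    exact (isIso_toZero_iff _).mpr (inferInstanceAs (Subsingleton (F.obj zero × G.obj zero)))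

/-- The cylinder functor `C([0,1], -)`. -/
def pathFunctor : CStarAlg.{u} ⥤ CStarAlg.{u} where
  obj := path
  map := pathMap
  map_id _ := rfl
  map_comp _ _ := rfl

lemma isDecent_path : IsDecent pathFunctor.{u} where
  map_pullback {P X Y Z p q f g} h hg := by
    refine isPullback_of_existsUnique ?_
      fun (x : C(unitInterval, X)) (y : C(unitInterval, Y)) hxy => ?_
    · rw [← Functor.map_comp, ← Functor.map_comp, h.w]
    · have hpt : ∀ t, homOf f (x t) = homOf g (y t) := fun t =>
        congrArg (fun z : C(unitInterval, Z) => z t) hxy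
      choose L hL hu using fun t => existsUnique_of_isPullback h (x t) (y t) (hpt t)
      have hinj : Function.Injective (homOf (prodLift p q)) := fun a b hab => by
        have hw : homOf f (homOf p b) = homOf g (homOf q b) :=
          DFunLike.congr_fun (congrArg homOf h.w) b
        obtain ⟨c, -, hc⟩ := existsUnique_of_isPullback h _ _ hw
        rw [hc a ⟨congrArg Prod.fst hab, congrArg Prod.snd hab⟩, hc b ⟨rfl, rfl⟩]
      have hiso : Isometry (homOf (prodLift p q)) := NonUnitalStarAlgHom.isometry _ hinj
      have hcont : Continuous L := hiso.isUniformInducing.isInducing.continuous_iff.mpr <| by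
        have : (homOf (prodLift p q)) ∘ L = fun t => (x t, y t) :=
          funext fun t => Prod.ext (hL t).1 (hL t).2
        rw [this]
        exact x.continuous.prodMk y.continuous
      refine ⟨(⟨L, hcont⟩ : C(unitInterval, P)), ⟨?_, ?_⟩, fun (w : C(unitInterval, P)) hw => ?_⟩
      · exact ContinuousMap.ext fun t => (hL t).1
      · exact ContinuousMap.ext fun t => (hL t).2
      · exact ContinuousMap.ext fun t => hu t (w t)
          ⟨congrArg (fun z : C(unitInterval, X) => z t) hw.1,
            congrArg (fun z : C(unitInterval, Y) => z t) hw.2⟩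
  map_zero := (isIso_toZero_iff _).mpr
    ⟨fun _ _ => ContinuousMap.ext fun _ => rfl⟩

end CStarAlg

open CStarAlg

/-- A labeled endofunctor of the category of C⋆-algebras: an endofunctor `F` together with natural
transformations `A ⊗ F(-) ⟶ F(A ⊗ -)` that are natural in `A` and compatible with the
associativity and unit isomorphisms of the tensor product. -/
structure LabeledEndofunctor where
  /-- The underlying endofunctor. -/
  functor : CStarAlg.{u} ⥤ CStarAlg.{u}
  /-- The components of the labeling. -/
  label (A B : CStarAlg.{u}) : tensor A (functor.obj B) ⟶ functor.obj (tensor A B)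
  label_naturality (A : CStarAlg.{u}) {B B' : CStarAlg.{u}} (f : B ⟶ B') :
    tensorMap (𝟙 A) (functor.map f) ≫ label A B' =
      label A B ≫ functor.map (tensorMap (𝟙 A) f)
  label_map {A A' : CStarAlg.{u}} (φ : A ⟶ A') (B : CStarAlg.{u}) :
    tensorMap φ (𝟙 (functor.obj B)) ≫ label A' B =
      label A B ≫ functor.map (tensorMap φ (𝟙 B))
  label_tensor (A A' B : CStarAlg.{u}) :
    assocInv A A' (functor.obj B) ≫ label (tensor A A') B =
      tensorMap (𝟙 A) (label A' B) ≫ label A (tensor A' B) ≫ functor.map (assocInv A A' B)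
  label_unit (B : CStarAlg.{u}) :
    unitInv (functor.obj B) ≫ label CStarAlg.unit B = functor.map (unitInv B)

/-- A good endofunctor: a labeled endofunctor whose underlying endofunctor is decent. -/
structure GoodEndofunctor extends LabeledEndofunctor.{u} where
  decent : IsDecent functor

namespace GoodEndofunctor

/-- A labeled natural transformation. -/
@[ext]
structure Hom (F G : GoodEndofunctor.{u}) where
  /-- The underlying natural transformation. -/
  nat : F.functor ⟶ G.functor
  label_comm (A B : CStarAlg.{u}) :
    F.label A B ≫ nat.app (tensor A B) = tensorMap (𝟙 A) (nat.app B) ≫ G.label A B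

instance : Category GoodEndofunctor.{u} where
  Hom F G := Hom F G
  id F := ⟨𝟙 F.functor, fun A B => by simp⟩
  comp {F G H} α β := ⟨α.nat ≫ β.nat, fun A B => by
    rw [NatTrans.comp_app, NatTrans.comp_app, ← Category.comp_id (𝟙 A), tensorMap_comp,
      ← Category.assoc, α.label_comm, Category.assoc, Category.assoc, β.label_comm]⟩

/-- The underlying natural transformation of a morphism. -/
def natOf {F G : GoodEndofunctor.{u}} (α : F ⟶ G) : F.functor ⟶ G.functor := Hom.nat α

lemma label_comm {F G : GoodEndofunctor.{u}} (α : F ⟶ G) (A B : CStarAlg.{u}) :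
    F.label A B ≫ (natOf α).app (tensor A B) =
      tensorMap (𝟙 A) ((natOf α).app B) ≫ G.label A B :=
  Hom.label_comm α A B

lemma hom_ext {F G : GoodEndofunctor.{u}} {α β : F ⟶ G}
    (h : ∀ B, (natOf α).app B = (natOf β).app B) : α = β :=
  Hom.ext (NatTrans.ext (funext h))

@[simp] lemma natOf_id (F : GoodEndofunctor.{u}) : natOf (𝟙 F) = 𝟙 F.functor := rfl

@[simp] lemma natOf_comp {F G H : GoodEndofunctor.{u}} (α : F ⟶ G) (β : G ⟶ H) :
    natOf (α ≫ β) = natOf α ≫ natOf β := rfl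

/-- Constructor for morphisms. -/
def mkHom {F G : GoodEndofunctor.{u}} (nat : F.functor ⟶ G.functor)
    (h : ∀ A B : CStarAlg.{u},
      F.label A B ≫ nat.app (tensor A B) = tensorMap (𝟙 A) (nat.app B) ≫ G.label A B) : F ⟶ G :=
  ⟨nat, h⟩

/-- The identity endofunctor with the identity labeling. -/
def identity : GoodEndofunctor.{u} where
  functor := 𝟭 _
  label A B := 𝟙 (tensor A B)
  label_naturality A B B' f := rfl
  label_map φ B := rfl
  label_tensor A A' B := by
    change assocInv A A' B ≫ 𝟙 _ = tensorMap (𝟙 A) (𝟙 (tensor A' B)) ≫ 𝟙 _ ≫ assocInv A A' B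
    rw [tensorMap_id, Category.id_comp, Category.id_comp, Category.comp_id]
  label_unit B := rfl
  decent := isDecent_id

/-- The composition `F G = F ∘ G` of good endofunctors. -/
def comp (F G : GoodEndofunctor.{u}) : GoodEndofunctor.{u} where
  functor := G.functor ⋙ F.functor
  label A B := F.label A (G.functor.obj B) ≫ F.functor.map (G.label A B)
  label_naturality A B B' f := by
    dsimp only [Functor.comp_obj, Functor.comp_map]
    rw [← Category.assoc, F.label_naturality, Category.assoc, Category.assoc,
      ← Functor.map_comp, ← Functor.map_comp, G.label_naturality]
  label_map φ B := by
    dsimp only [Functor.comp_obj, Functor.comp_map]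
    rw [← Category.assoc, F.label_map, Category.assoc, Category.assoc,
      ← Functor.map_comp, ← Functor.map_comp, G.label_map]
  label_tensor A A' B := by
    dsimp only [Functor.comp_obj, Functor.comp_map]
    rw [← Category.comp_id (𝟙 A), tensorMap_comp, ← Category.assoc, F.label_tensor]
    simp only [Category.assoc]
    rw [← Functor.map_comp, G.label_tensor, ← Category.assoc (tensorMap (𝟙 A) (F.functor.map _)),
      F.label_naturality]
    simp only [Category.assoc, Functor.map_comp]
  label_unit B := by
    dsimp only [Functor.comp_obj, Functor.comp_map]
    rw [← Category.assoc, F.label_unit, ← Functor.map_comp, G.label_unit]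
  decent := F.decent.comp G.decent

/-- The zero endofunctor. -/
def zero : GoodEndofunctor.{u} where
  functor := zeroFunctor
  label A _ := toZero (tensor A CStarAlg.zero)
  label_naturality _ _ _ _ := zero_ext _ _
  label_map _ _ := zero_ext _ _
  label_tensor _ _ _ := zero_ext _ _
  label_unit _ := zero_ext _ _
  decent := isDecent_zero

/-- The pointwise product of good endofunctors. -/
def prod (F G : GoodEndofunctor.{u}) : GoodEndofunctor.{u} where
  functor := prodFunctor F.functor G.functor
  label A B := prodLabel (F.label A B) (G.label A B)
  label_naturality A B B' f :=
    prodLabel_naturality (F.label_naturality A f) (G.label_naturality A f)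
  label_map φ B := by
    have h := prodLabel_naturality (F.label_map φ B) (G.label_map φ B)
    rw [prodMap_id] at h
    exact h
  label_tensor A A' B := prodLabel_tensor (F.label_tensor A A' B) (G.label_tensor A A' B)
  label_unit B := prodLabel_unit (F.label_unit B) (G.label_unit B)
  decent := F.decent.prod G.decent

/-- The cylinder functor `I = C([0,1], -)` with the labeling `a ⊗ f ↦ [t ↦ a ⊗ f(t)]`. -/
def cylinder : GoodEndofunctor.{u} where
  functor := pathFunctor
  label := pathLabel
  label_naturality A _ _ f := pathLabel_naturality (𝟙 A) f
  label_map φ B := by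
    have h := pathLabel_naturality φ (𝟙 B)
    rw [pathMap_id] at h
    exact h
  label_tensor := pathLabel_tensor
  label_unit := pathLabel_unit
  decent := isDecent_path

/-- The evaluation `ev_t : I ⟶ Id`. -/
def ev (t : unitInterval) : cylinder.{u} ⟶ identity :=
  mkHom { app := evalAt t, naturality := fun _ _ f => pathMap_evalAt f t } fun A B =>
    (pathLabel_evalAt A B t).trans (Category.comp_id _).symm

end GoodEndofunctor

/-- The data of a bimonoidal category on a category: a symmetric monoidal structure `⊕`, a monoidal
structure `⊗`, multiplicative zeros and distributivity morphisms. -/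
structure BimonoidalData (C : Type u) [Category.{v} C] where
  /-- The additive structure. -/
  add : MonoidalCategory C
  /-- The symmetry of the additive structure. -/
  addSymm : SymmetricCategory C
  /-- The multiplicative structure. -/
  mul : MonoidalCategory C
  /-- The left multiplicative zero `0 ⊗ A ⟶ 0`. -/
  zeroMul (A : C) : mul.tensorObj add.tensorUnit A ⟶ add.tensorUnit
  /-- The right multiplicative zero `A ⊗ 0 ⟶ 0`. -/
  mulZero (A : C) : mul.tensorObj A add.tensorUnit ⟶ add.tensorUnit
  /-- The left distributivity morphism `A ⊗ (B ⊕ B') ⟶ (A ⊗ B) ⊕ (A ⊗ B')`. -/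
  distL (A B B' : C) : mul.tensorObj A (add.tensorObj B B') ⟶
    add.tensorObj (mul.tensorObj A B) (mul.tensorObj A B')
  /-- The right distributivity morphism `(B ⊕ B') ⊗ A ⟶ (B ⊗ A) ⊕ (B' ⊗ A)`. -/
  distR (B B' A : C) : mul.tensorObj (add.tensorObj B B') A ⟶
    add.tensorObj (mul.tensorObj B A) (mul.tensorObj B' A)

namespace BimonoidalData

section Axioms

variable {C : Type u} [Category.{v} C] (D : BimonoidalData C)

/-- The zero object. -/
abbrev zero : C := D.add.tensorUnit

/-- The unit object. -/
abbrev one : C := D.mul.tensorUnit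

/-- The sum of objects. -/
abbrev oplus (A B : C) : C := D.add.tensorObj A B

/-- The product of objects. -/
abbrev otimes (A B : C) : C := D.mul.tensorObj A B

variable {A A' B B' : C}

/-- The sum of morphisms. -/
abbrev oplusHom (f : A ⟶ A') (g : B ⟶ B') : D.oplus A B ⟶ D.oplus A' B' := D.add.tensorHom f g

/-- The product of morphisms. -/
abbrev otimesHom (f : A ⟶ A') (g : B ⟶ B') : D.otimes A B ⟶ D.otimes A' B' := D.mul.tensorHom f g

variable (A B)

/-- The symmetry `A ⊕ B ⟶ B ⊕ A`. -/
abbrev swap : D.oplus A B ⟶ D.oplus B A :=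
  (@BraidedCategory.braiding C _ D.add D.addSymm.toBraidedCategory A B).hom

local notation "𝟘" => BimonoidalData.zero D
local notation "𝕀" => BimonoidalData.one D
local infixr:60 " ⊕ᵒ " => BimonoidalData.oplus D
local infixr:70 " ⊗ᵒ " => BimonoidalData.otimes D
local infixr:85 " ⊕ᵐ " => BimonoidalData.oplusHom D
local infixr:90 " ⊗ᵐ " => BimonoidalData.otimesHom D
local notation "α⁺" => MonoidalCategoryStruct.associator (self := D.add.toMonoidalCategoryStruct)
local notation "α×" => MonoidalCategoryStruct.associator (self := D.mul.toMonoidalCategoryStruct)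
local notation "λ⁺" => MonoidalCategoryStruct.leftUnitor (self := D.add.toMonoidalCategoryStruct)
local notation "λ×" => MonoidalCategoryStruct.leftUnitor (self := D.mul.toMonoidalCategoryStruct)
local notation "ρ⁺" => MonoidalCategoryStruct.rightUnitor (self := D.add.toMonoidalCategoryStruct)
local notation "ρ×" => MonoidalCategoryStruct.rightUnitor (self := D.mul.toMonoidalCategoryStruct)

/-- The interchange `(A ⊕ B) ⊕ (A' ⊕ B') ⟶ (A ⊕ A') ⊕ (B ⊕ B')`. -/
abbrev interchange (A B A' B' : C) :
    (A ⊕ᵒ B) ⊕ᵒ (A' ⊕ᵒ B') ⟶ (A ⊕ᵒ A') ⊕ᵒ (B ⊕ᵒ B') :=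
  (α⁺ A B (A' ⊕ᵒ B')).hom ≫
    (𝟙 A ⊕ᵐ ((α⁺ B A' B').inv ≫ (D.swap B A' ⊕ᵐ 𝟙 B') ≫ (α⁺ A' B B').hom)) ≫
      (α⁺ A A' (B ⊕ᵒ B')).inv

/-- The data form a bimonoidal category: the multiplicative zeros are natural isomorphisms, the
distributivity morphisms are natural monomorphisms, and Laplaza's axioms hold. -/
structure IsBimonoidal : Prop where
  zeroMul_isIso (A : C) : IsIso (D.zeroMul A)
  mulZero_isIso (A : C) : IsIso (D.mulZero A)
  distL_mono (A B B' : C) : Mono (D.distL A B B')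
  distR_mono (B B' A : C) : Mono (D.distR B B' A)
  zeroMul_naturality {A A' : C} (f : A ⟶ A') : (𝟙 𝟘 ⊗ᵐ f) ≫ D.zeroMul A' = D.zeroMul A ≫ 𝟙 𝟘
  mulZero_naturality {A A' : C} (f : A ⟶ A') : (f ⊗ᵐ 𝟙 𝟘) ≫ D.mulZero A' = D.mulZero A ≫ 𝟙 𝟘
  distL_naturality {A A₂ B B₂ B' B₂' : C} (f : A ⟶ A₂) (g : B ⟶ B₂) (g' : B' ⟶ B₂') :
    (f ⊗ᵐ (g ⊕ᵐ g')) ≫ D.distL A₂ B₂ B₂' = D.distL A B B' ≫ ((f ⊗ᵐ g) ⊕ᵐ (f ⊗ᵐ g'))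
  distR_naturality {A A₂ B B₂ B' B₂' : C} (g : B ⟶ B₂) (g' : B' ⟶ B₂') (f : A ⟶ A₂) :
    ((g ⊕ᵐ g') ⊗ᵐ f) ≫ D.distR B₂ B₂' A₂ = D.distR B B' A ≫ ((g ⊗ᵐ f) ⊕ᵐ (g' ⊗ᵐ f))
  distL_swap (A B B' : C) :
    D.distL A B B' ≫ D.swap (A ⊗ᵒ B) (A ⊗ᵒ B') = (𝟙 A ⊗ᵐ D.swap B B') ≫ D.distL A B' B
  distR_swap (B B' A : C) :
    D.distR B B' A ≫ D.swap (B ⊗ᵒ A) (B' ⊗ᵒ A) = (D.swap B B' ⊗ᵐ 𝟙 A) ≫ D.distR B' B A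
  distR_addAssoc (A B B' B'' : C) :
    D.distR (A ⊕ᵒ B) B' B'' ≫ (D.distR A B B'' ⊕ᵐ 𝟙 (B' ⊗ᵒ B'')) ≫
        (α⁺ (A ⊗ᵒ B'') (B ⊗ᵒ B'') (B' ⊗ᵒ B'')).hom =
      ((α⁺ A B B').hom ⊗ᵐ 𝟙 B'') ≫ D.distR A (B ⊕ᵒ B') B'' ≫
        (𝟙 (A ⊗ᵒ B'') ⊕ᵐ D.distR B B' B'')
  distL_addAssoc (A B B' B'' : C) :
    D.distL A (B ⊕ᵒ B') B'' ≫ (D.distL A B B' ⊕ᵐ 𝟙 (A ⊗ᵒ B'')) ≫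
        (α⁺ (A ⊗ᵒ B) (A ⊗ᵒ B') (A ⊗ᵒ B'')).hom =
      (𝟙 A ⊗ᵐ (α⁺ B B' B'').hom) ≫ D.distL A B (B' ⊕ᵒ B'') ≫
        (𝟙 (A ⊗ᵒ B) ⊕ᵐ D.distL A B' B'')
  distL_mulAssoc (A A' B B' : C) :
    D.distL (A ⊗ᵒ A') B B' ≫ ((α× A A' B).hom ⊕ᵐ (α× A A' B').hom) =
      (α× A A' (B ⊕ᵒ B')).hom ≫ (𝟙 A ⊗ᵐ D.distL A' B B') ≫ D.distL A (A' ⊗ᵒ B) (A' ⊗ᵒ B')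
  distR_mulAssoc (B B' A A' : C) :
    (α× (B ⊕ᵒ B') A A').hom ≫ D.distR B B' (A ⊗ᵒ A') =
      (D.distR B B' A ⊗ᵐ 𝟙 A') ≫ D.distR (B ⊗ᵒ A) (B' ⊗ᵒ A) A' ≫
        ((α× B A A').hom ⊕ᵐ (α× B' A A').hom)
  dist_mulAssoc (A B B' A' : C) :
    (α× A (B ⊕ᵒ B') A').hom ≫ (𝟙 A ⊗ᵐ D.distR B B' A') ≫ D.distL A (B ⊗ᵒ A') (B' ⊗ᵒ A') =
      (D.distL A B B' ⊗ᵐ 𝟙 A') ≫ D.distR (A ⊗ᵒ B) (A ⊗ᵒ B') A' ≫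
        ((α× A B A').hom ⊕ᵐ (α× A B' A').hom)
  dist_interchange (A A' B B' : C) :
    D.distL (A ⊕ᵒ A') B B' ≫ (D.distR A A' B ⊕ᵐ D.distR A A' B') =
      D.distR A A' (B ⊕ᵒ B') ≫ (D.distL A B B' ⊕ᵐ D.distL A' B B') ≫
        D.interchange (A ⊗ᵒ B) (A ⊗ᵒ B') (A' ⊗ᵒ B) (A' ⊗ᵒ B')
  zeroMul_zero : D.zeroMul 𝟘 = D.mulZero 𝟘
  zeroMul_oplus (A B : C) :
    D.distL 𝟘 A B ≫ (D.zeroMul A ⊕ᵐ D.zeroMul B) ≫ (λ⁺ 𝟘).hom = D.zeroMul (A ⊕ᵒ B)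
  mulZero_oplus (A B : C) :
    D.distR A B 𝟘 ≫ (D.mulZero A ⊕ᵐ D.mulZero B) ≫ (λ⁺ 𝟘).hom = D.mulZero (A ⊕ᵒ B)
  zeroMul_one : (ρ× 𝟘).hom = D.zeroMul 𝕀
  mulZero_one : (λ× 𝟘).hom = D.mulZero 𝕀
  zeroMul_otimes (A B : C) :
    (α× 𝟘 A B).hom ≫ D.zeroMul (A ⊗ᵒ B) = (D.zeroMul A ⊗ᵐ 𝟙 B) ≫ D.zeroMul B
  mulZero_zeroMul (A B : C) :
    (α× A 𝟘 B).hom ≫ (𝟙 A ⊗ᵐ D.zeroMul B) ≫ D.mulZero A =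
      (D.mulZero A ⊗ᵐ 𝟙 B) ≫ D.zeroMul B
  mulZero_otimes (A B : C) :
    (α× A B 𝟘).hom ≫ (𝟙 A ⊗ᵐ D.mulZero B) ≫ D.mulZero A = D.mulZero (A ⊗ᵒ B)
  distL_zero_left (A B : C) :
    D.distL A 𝟘 B ≫ (D.mulZero A ⊕ᵐ 𝟙 (A ⊗ᵒ B)) ≫ (λ⁺ (A ⊗ᵒ B)).hom = 𝟙 A ⊗ᵐ (λ⁺ B).hom
  distR_zero_left (B A : C) :
    D.distR 𝟘 B A ≫ (D.zeroMul A ⊕ᵐ 𝟙 (B ⊗ᵒ A)) ≫ (λ⁺ (B ⊗ᵒ A)).hom = (λ⁺ B).hom ⊗ᵐ 𝟙 A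
  distL_zero_right (A B : C) :
    D.distL A B 𝟘 ≫ (𝟙 (A ⊗ᵒ B) ⊕ᵐ D.mulZero A) ≫ (ρ⁺ (A ⊗ᵒ B)).hom = 𝟙 A ⊗ᵐ (ρ⁺ B).hom
  distR_zero_right (B A : C) :
    D.distR B 𝟘 A ≫ (𝟙 (B ⊗ᵒ A) ⊕ᵐ D.zeroMul A) ≫ (ρ⁺ (B ⊗ᵒ A)).hom = (ρ⁺ B).hom ⊗ᵐ 𝟙 A
  distL_one (A B : C) :
    D.distL 𝕀 A B ≫ ((λ× A).hom ⊕ᵐ (λ× B).hom) = (λ× (A ⊕ᵒ B)).hom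
  distR_one (A B : C) :
    D.distR A B 𝕀 ≫ ((ρ× A).hom ⊕ᵐ (ρ× B).hom) = (ρ× (A ⊕ᵒ B)).hom

/-- The data form a tight bimonoidal category: the distributivity morphisms are isomorphisms. -/
structure IsTightBimonoidal : Prop extends D.IsBimonoidal where
  distL_isIso (A B B' : C) : IsIso (D.distL A B B')
  distR_isIso (B B' A : C) : IsIso (D.distR B B' A)

/-- The multiplicative structure is strict: the associators and unitors are identities. -/
structure IsMulStrict : Prop where
  assoc (A A' A'' : C) :
    ∃ h : (A ⊗ᵒ A') ⊗ᵒ A'' = A ⊗ᵒ (A' ⊗ᵒ A''), (α× A A' A'').hom = eqToHom h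
  one_mul (A : C) : ∃ h : 𝕀 ⊗ᵒ A = A, (λ× A).hom = eqToHom h
  mul_one (A : C) : ∃ h : A ⊗ᵒ 𝕀 = A, (ρ× A).hom = eqToHom h

/-- A bimonoidal congruence: an equivalence relation on parallel morphisms that is compatible with
composition, `⊗` and `⊕`. -/
structure IsBimonoidalCongruence (r : HomRel C) : Prop where
  equivalence (A B : C) : Equivalence (@r A B)
  comp {A B E : C} {f f' : A ⟶ B} {g g' : B ⟶ E} : r f f' → r g g' → r (f ≫ g) (f' ≫ g')
  otimes {A A' B B' : C} {f f' : A ⟶ A'} {g g' : B ⟶ B'} :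
    r f f' → r g g' → r (f ⊗ᵐ g) (f' ⊗ᵐ g')
  oplus {A A' B B' : C} {f f' : A ⟶ A'} {g g' : B ⟶ B'} :
    r f f' → r g g' → r (f ⊕ᵐ g) (f' ⊕ᵐ g')

end Axioms

section Quotient

variable {C : Type u} [Category.{v} C] {r : HomRel C}

lemma rel_of_compClosure (he : ∀ A B : C, Equivalence (@r A B))
    (hc : ∀ {A B E : C} {f f' : A ⟶ B} {g g' : B ⟶ E}, r f f' → r g g' → r (f ≫ g) (f' ≫ g'))
    {A B : C} {f g : A ⟶ B} (h : HomRel.CompClosure r f g) : r f g := by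
  obtain ⟨_, _, _, _, _, _, h⟩ := h
  exact hc ((he _ _).refl _) (hc h ((he _ _).refl _))

/-- The monoidal structure induced on the quotient category by a congruence compatible with the
tensor product. -/
@[reducible]
def quotientMonoidal (M : MonoidalCategory C) (he : ∀ A B : C, Equivalence (@r A B))
    (hc : ∀ {A B E : C} {f f' : A ⟶ B} {g g' : B ⟶ E}, r f f' → r g g' → r (f ≫ g) (f' ≫ g'))
    (hm : ∀ {A A' B B' : C} {f f' : A ⟶ A'} {g g' : B ⟶ B'},
      r f f' → r g g' → r (M.tensorHom f g) (M.tensorHom f' g')) :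
    MonoidalCategory (Quotient r) where
  tensorObj X Y := ⟨M.tensorObj X.as Y.as⟩
  tensorUnit := ⟨M.tensorUnit⟩
  tensorHom {X₁ Y₁ X₂ Y₂} f g := Quot.map₂ (fun f g => M.tensorHom f g)
    (fun f _ _ h => .of (hm ((he _ _).refl f) (rel_of_compClosure he hc h)))
    (fun _ _ g h => .of (hm (rel_of_compClosure he hc h) ((he _ _).refl g))) f g
  whiskerLeft X {Y₁ Y₂} g := Quot.map (fun g => M.whiskerLeft X.as g)
    (fun g g' h => .of <| by
      rw [← M.id_tensorHom, ← M.id_tensorHom]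
      exact hm ((he _ _).refl _) (rel_of_compClosure he hc h)) g
  whiskerRight {X₁ X₂} f Y := Quot.map (fun f => M.whiskerRight f Y.as)
    (fun f f' h => .of <| by
      rw [← M.tensorHom_id, ← M.tensorHom_id]
      exact hm (rel_of_compClosure he hc h) ((he _ _).refl _)) f
  associator X Y Z := (Quotient.functor r).mapIso (M.associator X.as Y.as Z.as)
  leftUnitor X := (Quotient.functor r).mapIso (M.leftUnitor X.as)
  rightUnitor X := (Quotient.functor r).mapIso (M.rightUnitor X.as)
  tensorHom_def := by
    rintro _ _ _ _ ⟨f⟩ ⟨g⟩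
    exact congrArg (Quot.mk _) (M.tensorHom_def f g)
  id_tensorHom_id X Y := congrArg (Quot.mk _) (M.id_tensorHom_id X.as Y.as)
  tensorHom_comp_tensorHom := by
    rintro _ _ _ _ _ _ ⟨f⟩ ⟨g⟩ ⟨h⟩ ⟨k⟩
    exact congrArg (Quot.mk _) (M.tensorHom_comp_tensorHom f g h k)
  whiskerLeft_id X Y := congrArg (Quot.mk _) (M.whiskerLeft_id X.as Y.as)
  id_whiskerRight X Y := congrArg (Quot.mk _) (M.id_whiskerRight X.as Y.as)
  associator_naturality := by
    rintro _ _ _ _ _ _ ⟨f⟩ ⟨g⟩ ⟨h⟩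
    exact congrArg (Quot.mk _) (M.associator_naturality f g h)
  leftUnitor_naturality := by
    rintro _ _ ⟨f⟩
    exact congrArg (Quot.mk _) (M.leftUnitor_naturality f)
  rightUnitor_naturality := by
    rintro _ _ ⟨f⟩
    exact congrArg (Quot.mk _) (M.rightUnitor_naturality f)
  pentagon W X Y Z := congrArg (Quot.mk _) (M.pentagon W.as X.as Y.as Z.as)
  triangle X Y := congrArg (Quot.mk _) (M.triangle X.as Y.as)

/-- The symmetry induced on the quotient category. -/
@[reducible]
def quotientSymmetric (M : MonoidalCategory C) (S : SymmetricCategory C)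
    (he : ∀ A B : C, Equivalence (@r A B))
    (hc : ∀ {A B E : C} {f f' : A ⟶ B} {g g' : B ⟶ E}, r f f' → r g g' → r (f ≫ g) (f' ≫ g'))
    (hm : ∀ {A A' B B' : C} {f f' : A ⟶ A'} {g g' : B ⟶ B'},
      r f f' → r g g' → r (M.tensorHom f g) (M.tensorHom f' g')) :
    @SymmetricCategory (Quotient r) _ (quotientMonoidal M he hc hm) :=
  letI := quotientMonoidal M he hc hm
  { braiding := fun X Y => (Quotient.functor r).mapIso (S.braiding X.as Y.as)
    braiding_naturality_right := by
      rintro X _ _ ⟨f⟩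
      exact congrArg (Quot.mk _) (S.braiding_naturality_right X.as f)
    braiding_naturality_left := by
      rintro _ _ ⟨f⟩ Z
      exact congrArg (Quot.mk _) (S.braiding_naturality_left f Z.as)
    hexagon_forward := fun X Y Z =>
      congrArg (Quot.mk _) (S.hexagon_forward X.as Y.as Z.as)
    hexagon_reverse := fun X Y Z =>
      congrArg (Quot.mk _) (S.hexagon_reverse X.as Y.as Z.as)
    symmetry := fun X Y => congrArg (Quot.mk _) (S.symmetry X.as Y.as) }

/-- The data of the quotient of a bimonoidal category by a bimonoidal congruence: the operations on
objects are unchanged, those on morphisms are defined on representatives, and all structure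
morphisms are the classes of the given ones. -/
def quotient (D : BimonoidalData C) (h : D.IsBimonoidalCongruence r) :
    BimonoidalData (Quotient r) where
  add := quotientMonoidal D.add h.equivalence h.comp h.oplus
  addSymm := quotientSymmetric D.add D.addSymm h.equivalence h.comp h.oplus
  mul := quotientMonoidal D.mul h.equivalence h.comp h.otimes
  zeroMul A := (Quotient.functor r).map (D.zeroMul A.as)
  mulZero A := (Quotient.functor r).map (D.mulZero A.as)
  distL A B B' := (Quotient.functor r).map (D.distL A.as B.as B'.as)
  distR B B' A := (Quotient.functor r).map (D.distR B.as B'.as A.as)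

end Quotient

end BimonoidalData

namespace GoodEndofunctor

/-- The horizontal composition of labeled natural transformations. -/
def compHom {F F' G G' : GoodEndofunctor.{u}} (α : F ⟶ F') (β : G ⟶ G') :
    comp F G ⟶ comp F' G' :=
  mkHom
    { app := fun B => F.functor.map ((natOf β).app B) ≫ (natOf α).app (G'.functor.obj B)
      naturality := fun B B' f => by
        dsimp only [comp, Functor.comp_obj, Functor.comp_map]
        rw [← Category.assoc, ← Functor.map_comp, (natOf β).naturality, Category.assoc,
          ← (natOf α).naturality, ← Category.assoc, Functor.map_comp] }
    fun A B => by
      change (F.label A (G.functor.obj B) ≫ F.functor.map (G.label A B)) ≫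
        F.functor.map ((natOf β).app _) ≫ (natOf α).app _ =
        tensorMap (𝟙 A) (F.functor.map ((natOf β).app B) ≫ (natOf α).app (G'.functor.obj B)) ≫
          F'.label A (G'.functor.obj B) ≫ F'.functor.map (G'.label A B)
      rw [← Category.comp_id (𝟙 A), tensorMap_comp, Category.assoc, Category.assoc,
        ← Category.assoc (tensorMap (𝟙 A) ((natOf α).app _)), ← label_comm, Category.assoc,
        ← (natOf α).naturality, ← Category.assoc (tensorMap (𝟙 A) (F.functor.map _)),
        F.label_naturality, Category.assoc, ← Category.assoc (F.functor.map (G.label A B)),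
        ← Functor.map_comp, label_comm, Functor.map_comp, Category.assoc]

/-- The associativity isomorphism of composition, with identity components. -/
def compAssoc (F G H : GoodEndofunctor.{u}) : comp (comp F G) H ≅ comp F (comp G H) where
  hom := mkHom (𝟙 (H.functor ⋙ G.functor ⋙ F.functor)) fun A B => by
    change ((F.label _ _ ≫ F.functor.map (G.label A _)) ≫
      F.functor.map (G.functor.map (H.label A B))) ≫ 𝟙 _ =
      tensorMap (𝟙 A) (𝟙 _) ≫ F.label A _ ≫ F.functor.map (G.label A _ ≫ G.functor.map _)
    rw [Category.comp_id, tensorMap_id, Category.id_comp, Category.assoc, Functor.map_comp]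
  inv := mkHom (𝟙 (H.functor ⋙ G.functor ⋙ F.functor)) fun A B => by
    change (F.label A _ ≫ F.functor.map (G.label A _ ≫ G.functor.map (H.label A B))) ≫ 𝟙 _ =
      tensorMap (𝟙 A) (𝟙 _) ≫
      ((F.label _ _ ≫ F.functor.map (G.label A _)) ≫ F.functor.map (G.functor.map (H.label A B)))
    rw [Category.comp_id, tensorMap_id, Category.id_comp, Category.assoc, Functor.map_comp]
  hom_inv_id := hom_ext fun B => Category.id_comp _
  inv_hom_id := hom_ext fun B => Category.id_comp _

/-- The left unit isomorphism of composition, with identity components. -/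
def compLeftUnitor (F : GoodEndofunctor.{u}) : comp identity F ≅ F where
  hom := mkHom (𝟙 F.functor) fun A B => by
    change (𝟙 _ ≫ F.label A B) ≫ 𝟙 _ = tensorMap (𝟙 A) (𝟙 _) ≫ F.label A B
    rw [Category.comp_id, tensorMap_id]
  inv := mkHom (𝟙 F.functor) fun A B => by
    change F.label A B ≫ 𝟙 _ = tensorMap (𝟙 A) (𝟙 _) ≫ 𝟙 _ ≫ F.label A B
    rw [Category.comp_id, tensorMap_id, Category.id_comp, Category.id_comp]
  hom_inv_id := hom_ext fun B => Category.id_comp _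
  inv_hom_id := hom_ext fun B => Category.id_comp _

/-- The right unit isomorphism of composition, with identity components. -/
def compRightUnitor (F : GoodEndofunctor.{u}) : comp F identity ≅ F where
  hom := mkHom (𝟙 F.functor) fun A B => by
    change (F.label A B ≫ F.functor.map (𝟙 _)) ≫ 𝟙 _ = tensorMap (𝟙 A) (𝟙 _) ≫ F.label A B
    rw [Category.comp_id, tensorMap_id, CategoryTheory.Functor.map_id, Category.comp_id, Category.id_comp]
  inv := mkHom (𝟙 F.functor) fun A B => by
    change F.label A B ≫ 𝟙 _ = tensorMap (𝟙 A) (𝟙 _) ≫ F.label A B ≫ F.functor.map (𝟙 _)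
    rw [Category.comp_id, tensorMap_id, Category.id_comp, CategoryTheory.Functor.map_id, Category.comp_id]
  hom_inv_id := hom_ext fun B => Category.id_comp _
  inv_hom_id := hom_ext fun B => Category.id_comp _

/-- The data of the monoidal structure given by composition. -/
@[reducible]
def compMonoidalStruct : MonoidalCategoryStruct GoodEndofunctor.{u} where
  tensorObj := comp
  tensorUnit := identity
  tensorHom := compHom
  whiskerLeft F _ _ β := compHom (𝟙 F) β
  whiskerRight α G := compHom α (𝟙 G)
  associator := compAssoc
  leftUnitor := compLeftUnitor
  rightUnitor := compRightUnitor

/-- The monoidal structure given by composition of endofunctors. -/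
@[reducible]
def compMonoidal : MonoidalCategory GoodEndofunctor.{u} :=
  letI := compMonoidalStruct.{u}
  .ofTensorHom
    (id_tensorHom_id := fun F G => hom_ext fun B => by
      change F.functor.map (𝟙 _) ≫ 𝟙 _ = 𝟙 _
      rw [CategoryTheory.Functor.map_id, Category.comp_id])
    (id_tensorHom := fun _ _ _ _ => rfl)
    (tensorHom_id := fun _ _ => rfl)
    (tensorHom_comp_tensorHom := fun {F₁ F₂ F₃ G₁ G₂ G₃} α β α' β' => hom_ext fun B => by
      change (F₁.functor.map ((natOf β).app B) ≫ (natOf α).app _) ≫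
        F₂.functor.map ((natOf β').app B) ≫ (natOf α').app _ =
        F₁.functor.map ((natOf β).app B ≫ (natOf β').app B) ≫ (natOf α).app _ ≫ (natOf α').app _
      rw [Functor.map_comp, Category.assoc, Category.assoc, ← Category.assoc ((natOf α).app _),
        ← (natOf α).naturality, Category.assoc])
    (associator_naturality := fun {F₁ F₂ F₃ G₁ G₂ G₃} α β γ => hom_ext fun B => by
      change (F₁.functor.map (F₂.functor.map ((natOf γ).app B)) ≫
        F₁.functor.map ((natOf β).app _) ≫ (natOf α).app _) ≫ 𝟙 _ = 𝟙 _ ≫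
        F₁.functor.map (F₂.functor.map ((natOf γ).app B) ≫ (natOf β).app _) ≫ (natOf α).app _
      rw [Category.comp_id, Category.id_comp, Functor.map_comp, Category.assoc])
    (leftUnitor_naturality := fun {F G} β => hom_ext fun B => by
      change ((natOf β).app B ≫ 𝟙 _) ≫ 𝟙 _ = 𝟙 _ ≫ (natOf β).app B
      rw [Category.comp_id, Category.comp_id, Category.id_comp])
    (rightUnitor_naturality := fun {F G} α => hom_ext fun B => by
      change (F.functor.map (𝟙 _) ≫ (natOf α).app B) ≫ 𝟙 _ = 𝟙 _ ≫ (natOf α).app B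
      rw [Category.comp_id, CategoryTheory.Functor.map_id])
    (pentagon := fun F G H K => hom_ext fun B => by
      change ((F.functor.map (G.functor.map (H.functor.map (𝟙 _)))) ≫ 𝟙 _) ≫ 𝟙 _ ≫
        F.functor.map (𝟙 _) ≫ 𝟙 _ = 𝟙 _ ≫ 𝟙 _
      simp only [CategoryTheory.Functor.map_id, Category.comp_id])
    (triangle := fun F G => hom_ext fun B => by
      change 𝟙 _ ≫ F.functor.map (𝟙 _) ≫ 𝟙 _ = F.functor.map (𝟙 _) ≫ 𝟙 _
      simp only [CategoryTheory.Functor.map_id, Category.comp_id])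

/-- First projection. -/
def prodFst (F G : GoodEndofunctor.{u}) : prod F G ⟶ F :=
  mkHom { app := fun _ => CStarAlg.prodFst _ _, naturality := fun _ _ _ => rfl } fun _ _ => rfl

/-- Second projection. -/
def prodSnd (F G : GoodEndofunctor.{u}) : prod F G ⟶ G :=
  mkHom { app := fun _ => CStarAlg.prodSnd _ _, naturality := fun _ _ _ => rfl } fun _ _ => rfl

/-- Pairing of labeled natural transformations. -/
def prodLift {H F G : GoodEndofunctor.{u}} (α : H ⟶ F) (β : H ⟶ G) : H ⟶ prod F G :=
  mkHom
    { app := fun B => CStarAlg.prodLift ((natOf α).app B) ((natOf β).app B)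
      naturality := fun B B' f =>
        prod_ext ((natOf α).naturality f) ((natOf β).naturality f) }
    fun A B => by
      refine prod_ext ((label_comm α A B).trans ?_) ((label_comm β A B).trans ?_)
      · change _ = tensorMap (𝟙 A) (CStarAlg.prodLift _ _) ≫ tensorMap (𝟙 A)
          (CStarAlg.prodFst _ _) ≫ F.label A B
        rw [← Category.assoc, ← tensorMap_comp, prodLift_fst, Category.comp_id]
      · change _ = tensorMap (𝟙 A) (CStarAlg.prodLift _ _) ≫ tensorMap (𝟙 A)
          (CStarAlg.prodSnd _ _) ≫ G.label A B
        rw [← Category.assoc, ← tensorMap_comp, prodLift_snd, Category.comp_id]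

/-- The labeled natural transformation to the zero endofunctor. -/
def toZero (F : GoodEndofunctor.{u}) : F ⟶ zero :=
  mkHom { app := fun _ => CStarAlg.toZero _, naturality := fun _ _ _ => zero_ext _ _ }
    fun _ _ => zero_ext _ _

/-- The zero endofunctor is terminal. -/
def zeroLimit : Limits.LimitCone (Functor.empty.{0} GoodEndofunctor.{u}) where
  cone := Limits.asEmptyCone zero
  isLimit := Limits.IsTerminal.ofUniqueHom toZero fun _ _ => hom_ext fun _ => zero_ext _ _

/-- The pointwise product of good endofunctors is a categorical product. -/
def prodLimit (F G : GoodEndofunctor.{u}) : Limits.LimitCone (Limits.pair F G) where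
  cone := Limits.BinaryFan.mk (prodFst F G) (prodSnd F G)
  isLimit := Limits.BinaryFan.isLimitMk (fun s => prodLift s.fst s.snd)
    (fun _ => rfl) (fun _ => rfl)
    fun _ _ h₁ h₂ => hom_ext fun B => prod_ext
      (congrArg (fun α => (natOf α).app B) h₁) (congrArg (fun α => (natOf α).app B) h₂)

/-- The cartesian monoidal structure on good endofunctors. -/
@[reducible]
def cartesian : CartesianMonoidalCategory GoodEndofunctor.{u} :=
  .ofChosenFiniteProducts zeroLimit prodLimit

/-- The symmetry of the cartesian monoidal structure. -/
@[reducible]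
def cartesianSymmetric :
    @SymmetricCategory GoodEndofunctor.{u} _ cartesian.toMonoidalCategory :=
  letI := cartesian.{u}
  letI : BraidedCategory GoodEndofunctor.{u} := .ofCartesianMonoidalCategory
  inferInstance

/-- The bimonoidal structure on the category of good endofunctors: the additive structure is the
cartesian one and the multiplicative structure is composition. -/
def bimonoidal : BimonoidalData GoodEndofunctor.{u} where
  add := cartesian.toMonoidalCategory
  addSymm := cartesianSymmetric
  mul := compMonoidal
  zeroMul F := toZero (comp zero F)
  mulZero F := toZero (comp F zero)
  distL F G G' := prodLift (compHom (𝟙 F) (prodFst G G')) (compHom (𝟙 F) (prodSnd G G'))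
  distR G G' F := prodLift (compHom (prodFst G G') (𝟙 F)) (compHom (prodSnd G G') (𝟙 F))

/-- Homotopy of labeled natural transformations `γ₀ γ₁ : F ⟶ G`: there is a labeled natural
transformation `Γ : F ⟶ G I` whose composites with `G ev₀` and `G ev₁` are `γ₀` and `γ₁`. -/
def Homotopic : HomRel GoodEndofunctor.{u} := fun F G γ₀ γ₁ =>
  ∃ Γ : F ⟶ comp G cylinder,
    Γ ≫ compHom (𝟙 G) (ev 0) ≫ (compRightUnitor G).hom = γ₀ ∧
      Γ ≫ compHom (𝟙 G) (ev 1) ≫ (compRightUnitor G).hom = γ₁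

end GoodEndofunctor

end

/-! The additive structure is cartesian and the distributivity morphisms are the canonical ones. So
each Laplaza axiom is an equation between morphisms into a product or into the terminal object, and
it can be checked on projections (`CartesianProjections.isTightBimonoidal`). Tightness has two
sources. Products are pointwise, so right distributivity is the identity on components. For left
distributivity, A ⊕ B is the pullback of A → 0 ← B, whose legs are split epimorphisms, so a good
functor preserves it (`IsDecent.isIso_prodLift`). Multiplication is strict because the associators
and unitors have identity components, and a labeled transformation with identity components forces
the two labelings to be equal (`exists_eqToHom`).

For homotopy, reflexivity comes from constant paths and symmetry from reversing them. For
transitivity, C([0,1], B) is the pullback of two copies of itself along ev_1 and ev_0, by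
concatenation. Since ev_0 is split by constant paths, a good G preserves this pullback, and
homotopies F ⇒ GI can be glued (`exists_concat_pathApp`).

Composition with a transformation and whiskering by H on the left are formal. Whiskering on the
right is the hard point: ΓH ends in GIH, while a homotopy has to end in GHI. What is needed is a
labeled transformation IH ⇒ HI compatible with the evaluations (`cylinderSwap`). It is the labeling
C([0,1]) ⊗ HB → H(C([0,1]) ⊗ B), read through the isomorphism C([0,1]) ⊗ B ≅ C([0,1], B).

That isomorphism for the maximal tensor product is the analytic core (`pathSMul_bijective`). The
Bernstein operators f ↦ ∑ b_{n,k} ⊗ f(k/n) map C([0,1], B) to the tensor product. Positivity of the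
b_{n,k}, together with ∑ b_{n,k} = 1, bounds them by 4‖f‖ uniformly in n. On the algebraic tensor
product they converge to an inverse of the canonical map, so that map is bounded below; its range is
closed and contains all Bernstein approximations, hence everything.

In the quotient, the structure morphisms are images under the quotient functor, which preserves
equations, isomorphisms and identities. -/

noncomputable section

open CStarAlg

/-! ### Norm estimates for sums of elementary tensors -/

namespace MaxTensor

variable {A B : Type u} [NonUnitalCStarAlgebra A] [NonUnitalCStarAlgebra B]

lemma tmul_sum {ι : Type*} (s : Finset ι) (a : A) (b : ι → B) :
    tmul a (∑ k ∈ s, b k) = ∑ k ∈ s, tmul a (b k) :=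
  map_sum (AddMonoidHom.mk' (fun b : B => tmul a b) (tmul_add a)) b s

lemma sum_tmul {ι : Type*} (s : Finset ι) (a : ι → A) (b : B) :
    tmul (∑ k ∈ s, a k) b = ∑ k ∈ s, tmul (a k) b :=
  map_sum (AddMonoidHom.mk' (fun a : A => tmul a b) fun x y => add_tmul x y b) a s

lemma continuous_tmul_left (b : B) : Continuous fun a : A => tmul a b :=
  AddMonoidHomClass.continuous_of_bound
    ({ toFun := fun a => tmul a b
       map_add' := fun x y => add_tmul x y b
       map_smul' := fun c x => smul_tmul c x b } : A →ₗ[ℂ] MaxTensor A B) ‖b‖ fun a => by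
      rw [mul_comm]; exact norm_tmul_le a b

section Order

variable [PartialOrder B] [StarOrderedRing B] [PartialOrder (MaxTensor A B)]
  [StarOrderedRing (MaxTensor A B)]

/-- With b = y*y the tensor is (a ⊗ y)*(a ⊗ y). -/
lemma tmul_star_mul_nonneg (a : A) {b : B} (hb : 0 ≤ b) : 0 ≤ tmul (star a * a) b := by
  obtain ⟨y, rfl⟩ := CStarAlgebra.nonneg_iff_eq_star_mul_self.mp hb
  rw [← tmul_mul_tmul, ← star_tmul]
  exact star_mul_self_nonneg _

/-- A convex combination of positive tensors, with respect to a partition of unity by positive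
elements, is bounded by the norms of the coefficients. -/
lemma norm_sum_tmul_le_of_nonneg {ι : Type*} (s : Finset ι) (a : ι → A) {M : ℝ} (hM : 0 ≤ M)
    (ha : ‖∑ k ∈ s, star (a k) * a k‖ ≤ 1) (b : ι → B) (hb : ∀ k, 0 ≤ b k)
    (hbM : ∀ k, ‖b k‖ ≤ M) : ‖∑ k ∈ s, tmul (star (a k) * a k) (b k)‖ ≤ M := by
  -- In a unital B, the inequality b k ≤ M·1 would give the bound at once. In general b k is
  -- replaced by e * b k * e with e in an approximate unit; this is at most M • (star e * e), and
  -- the bound passes to the limit.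
  have hu := CStarAlgebra.increasingApproximateUnit B
  have hlim : Filter.Tendsto
      (fun e : B => ‖∑ k ∈ s, tmul (star (a k) * a k) (e * b k * e)‖)
      (CStarAlgebra.approximateUnit B)
      (nhds ‖∑ k ∈ s, tmul (star (a k) * a k) (b k)‖) := by
    refine (tendsto_finsetSum s fun k _ => ?_).norm
    refine ((continuous_tmul (star (a k) * a k)).tendsto (b k)).comp ?_
    have h1 := hu.tendsto_mul_right (b k)
    rw [tendsto_iff_norm_sub_tendsto_zero] at h1 ⊢
    have h2 := hu.tendsto_mul_left (b k)
    rw [tendsto_iff_norm_sub_tendsto_zero] at h2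
    refine squeeze_zero' (Filter.Eventually.of_forall fun _ => norm_nonneg _) ?_
      (by simpa using h1.add h2)
    filter_upwards [hu.eventually_norm] with e he
    have : e * b k * e - b k = (e * b k - b k) * e + (b k * e - b k) := by
      rw [sub_mul]; abel
    rw [this]
    refine (norm_add_le _ _).trans (add_le_add ((norm_mul_le _ _).trans ?_) le_rfl)
    exact mul_le_of_le_one_right (norm_nonneg _) he
  refine le_of_tendsto hlim ?_
  filter_upwards [hu.eventually_norm, hu.eventually_star_eq] with e he hs
  have hle : ∀ k, e * b k * e ≤ M • (star e * e) := fun k => by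
    have h1 := CStarAlgebra.star_left_conjugate_le_norm_smul (a := e) (b := b k)
      (.of_nonneg (hb k))
    rw [hs] at h1 ⊢
    refine h1.trans (smul_le_smul_of_nonneg_right (hbM k) ?_)
    nth_rw 1 [← hs]
    exact star_mul_self_nonneg e
  have hnn : ∀ k, 0 ≤ e * b k * e := fun k => by
    have := star_left_conjugate_nonneg (hb k) e
    rwa [hs] at this
  -- The majorant has the same second factor in every summand, so the sum collapses to one
  -- elementary tensor, whose norm is at most 1 · M.
  have hsum : ∑ k ∈ s, tmul (star (a k) * a k) (e * b k * e) ≤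
      tmul (∑ k ∈ s, star (a k) * a k) (M • (star e * e)) := by
    rw [sum_tmul]
    refine Finset.sum_le_sum fun k _ => ?_
    rw [← sub_nonneg]
    have : tmul (star (a k) * a k) (M • (star e * e)) -
        tmul (star (a k) * a k) (e * b k * e) =
          tmul (star (a k) * a k) (M • (star e * e) - e * b k * e) := by
      rw [sub_eq_iff_eq_add, ← tmul_add, sub_add_cancel]
    rw [this]
    exact tmul_star_mul_nonneg _ (sub_nonneg.mpr (hle k))
  refine (CStarAlgebra.norm_le_norm_of_nonneg_of_le
    (Finset.sum_nonneg fun k _ => tmul_star_mul_nonneg _ (hnn k)) hsum).trans ?_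
  refine (norm_tmul_le _ _).trans ?_
  rw [norm_smul, CStarRing.norm_star_mul_self, Real.norm_of_nonneg hM]
  have h1 : ‖e‖ * ‖e‖ ≤ 1 := mul_le_one₀ he (norm_nonneg e) he
  calc _ ≤ 1 * (M * 1) := by gcongr
    _ = M := by ring

end Order

/-- Each `b k` is a combination, with coefficients 1, i, -1, -i, of four positive elements of norm
at most ‖b k‖, and the positive case applies to each of the four sums. The value 4 is immaterial;
what matters is that it depends neither on the number of summands nor on the coefficients. -/
lemma norm_sum_tmul_le {ι : Type*} (s : Finset ι) (a : ι → A) {M : ℝ} (hM : 0 ≤ M)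
    (ha : ‖∑ k ∈ s, star (a k) * a k‖ ≤ 1) (b : ι → B)
    (hbM : ∀ k, ‖b k‖ ≤ M) : ‖∑ k ∈ s, tmul (star (a k) * a k) (b k)‖ ≤ 4 * M := by
  let _ := CStarAlgebra.spectralOrder B
  let _ := CStarAlgebra.spectralOrderedRing B
  let _ := CStarAlgebra.spectralOrder (MaxTensor A B)
  let _ := CStarAlgebra.spectralOrderedRing (MaxTensor A B)
  choose x hx hxn hxs using fun k => CStarAlgebra.exists_sum_four_nonneg (b k)
  have : ∑ k ∈ s, tmul (star (a k) * a k) (b k) =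
      ∑ i : Fin 4, Complex.I ^ (i : ℕ) • ∑ k ∈ s, tmul (star (a k) * a k) (x k i) := by
    simp_rw [Finset.smul_sum]
    rw [Finset.sum_comm]
    refine Finset.sum_congr rfl fun k _ => ?_
    conv_lhs => rw [hxs k, tmul_sum]
    simp_rw [tmul_smul]
  rw [this]
  refine (norm_sum_le _ _).trans ?_
  calc _ ≤ ∑ _i : Fin 4, M := Finset.sum_le_sum fun i _ => by
        rw [norm_smul, norm_pow, Complex.norm_I, one_pow, one_mul]
        exact norm_sum_tmul_le_of_nonneg s a hM ha _ (fun k => hx k i)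
          fun k => (hxn k i).trans (hbM k)
    _ = 4 * M := by simp

end MaxTensor

/-! ### The isomorphism C([0,1]) ⊗ B ≅ C([0,1], B) by Bernstein approximation -/

namespace CStarAlg

/-- The bilinear map `(h, b) ↦ [t ↦ h(t) b]`. -/
def pathSMulBilin (B : CStarAlg.{u}) : path unit.{u} →ₗ[ℂ] B →ₗ[ℂ] path B :=
  LinearMap.mk₂ ℂ
    (fun h b => (⟨fun t => (h t).down • b,
      (continuous_uliftDown.comp h.continuous).smul continuous_const⟩ : C(unitInterval, B)))
    (fun _ _ _ => ContinuousMap.ext fun _ => add_smul _ _ _)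
    (fun _ _ _ => ContinuousMap.ext fun _ => smul_assoc _ _ _)
    (fun _ _ _ => ContinuousMap.ext fun _ => smul_add _ _ _)
    (fun _ _ _ => ContinuousMap.ext fun _ => smul_comm _ _ _)

lemma pathSMulBilin_mul (B : CStarAlg.{u}) (h : path unit.{u}) (b : B) (h' : path unit.{u})
    (b' : B) : pathSMulBilin B (h * h') (b * b') = pathSMulBilin B h b * pathSMulBilin B h' b' :=
  ContinuousMap.ext fun t => (smul_mul_smul_comm (h t).down b (h' t).down b').symm

lemma pathSMulBilin_star (B : CStarAlg.{u}) (h : path unit.{u}) (b : B) :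
    pathSMulBilin B (star h) (star b) = star (pathSMulBilin B h b) :=
  ContinuousMap.ext fun t => (star_smul (h t).down b).symm

/-- The map `C([0,1]) ⊗ B ⟶ C([0,1], B)`, `h ⊗ b ↦ [t ↦ h(t) b]`. -/
def pathSMul (B : CStarAlg.{u}) : tensor (path unit) B ⟶ path B :=
  ofHom (MaxTensor.lift (pathSMulBilin B) (pathSMulBilin_mul B) (pathSMulBilin_star B))

lemma pathSMul_tmul (B : CStarAlg.{u}) (h : path unit.{u}) (b : B) :
    homOf (pathSMul B) (MaxTensor.tmul h b) = pathSMulBilin B h b :=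
  MaxTensor.lift_tmul (pathSMulBilin B) (pathSMulBilin_mul B) (pathSMulBilin_star B) h b

lemma pathSMulBilin_apply (B : CStarAlg.{u}) (h : path unit.{u}) (b : B) (t : unitInterval) :
    (pathSMulBilin B h b : C(unitInterval, B)) t = (h t).down • b := rfl

/-- The square root of a Bernstein polynomial. -/
def sqrtBernstein (n k : ℕ) : path unit.{u} :=
  (⟨fun t => ⟨(Real.sqrt (bernstein n k t) : ℂ)⟩, by fun_prop⟩ :
    C(unitInterval, ULift.{u} ℂ))

lemma star_sqrtBernstein_mul_self (n k : ℕ) (t : unitInterval) :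
    ((star (sqrtBernstein.{u} n k) * sqrtBernstein n k : path unit.{u}) t).down =
      (bernstein n k t : ℂ) := by
  change star (Real.sqrt (bernstein n k t) : ℂ) * (Real.sqrt (bernstein n k t) : ℂ) = _
  rw [Complex.star_def, Complex.conj_ofReal, ← Complex.ofReal_mul,
    Real.mul_self_sqrt bernstein_nonneg]

/-- The Bernstein polynomials are a partition of unity. Their square roots serve to present them in
the form a*a that `norm_sum_tmul_le` requires. -/
lemma norm_sum_star_sqrtBernstein_mul_self_le (n : ℕ) :
    ‖∑ k : Fin (n + 1), star (sqrtBernstein.{u} n k) * sqrtBernstein n k‖ ≤ 1 := by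
  refine (ContinuousMap.norm_le _ zero_le_one).mpr fun t => ?_
  have h : ∀ x : ULift.{u} ℂ, ‖x‖ = ‖x.down‖ := fun _ => rfl
  have hs : ((∑ k : Fin (n + 1), star (sqrtBernstein.{u} n k) * sqrtBernstein n k :
      C(unitInterval, ULift.{u} ℂ)) t).down = 1 := by
    -- Evaluation at t as an additive map, so that `map_sum` carries it through the sum.
    let ev : C(unitInterval, ULift.{u} ℂ) →+ ℂ :=
      { toFun := fun f => (f t).down, map_zero' := rfl, map_add' := fun _ _ => rfl }
    change ev _ = 1
    rw [map_sum]
    refine (Finset.sum_congr rfl fun (k : Fin (n + 1)) _ =>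
      star_sqrtBernstein_mul_self.{u} n k t).trans ?_
    rw [← Complex.ofReal_sum, bernstein.probability, Complex.ofReal_one]
  rw [h]
  exact (congrArg norm hs).le.trans (by simp)

/-- The approximation of a path by Bernstein polynomials, as an element of the tensor product. -/
def bernsteinTensor {B : CStarAlg.{u}} (n : ℕ) (f : path B) : tensor (path unit) B :=
  ∑ k : Fin (n + 1), MaxTensor.tmul (star (sqrtBernstein n k) * sqrtBernstein n k)
    ((f : C(unitInterval, B)) (bernstein.z k))

/-- The bound is uniform in n, so it survives the limit in `norm_le_pathSMul`. -/
lemma norm_bernsteinTensor_le {B : CStarAlg.{u}} (n : ℕ) (f : path B) :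
    ‖bernsteinTensor n f‖ ≤ 4 * ‖f‖ :=
  MaxTensor.norm_sum_tmul_le _ _ (norm_nonneg f) (norm_sum_star_sqrtBernstein_mul_self_le n) _
    fun _ => ContinuousMap.norm_coe_le_norm (f : C(unitInterval, B)) _

lemma bernsteinTensor_add {B : CStarAlg.{u}} (n : ℕ) (f g : path B) :
    bernsteinTensor n (f + g) = bernsteinTensor n f + bernsteinTensor n g := by
  unfold bernsteinTensor
  rw [← Finset.sum_add_distrib]
  exact Finset.sum_congr rfl fun k _ => MaxTensor.tmul_add _ _ _

lemma pathSMul_bernsteinTensor {B : CStarAlg.{u}} (n : ℕ) (f : path B) :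
    homOf (pathSMul B) (bernsteinTensor n f) =
      bernsteinApproximation n (f : C(unitInterval, B)) := by
  refine ContinuousMap.ext fun t => ?_
  let ev : C(unitInterval, B) →+ B :=
    { toFun := fun f => f t, map_zero' := rfl, map_add' := fun _ _ => rfl }
  unfold bernsteinTensor
  rw [map_sum, bernsteinApproximation.apply]
  refine (map_sum ev _ _).trans (Finset.sum_congr rfl fun k _ => ?_)
  refine (congrArg ev (pathSMul_tmul B _ _)).trans ?_
  refine (pathSMulBilin_apply B _ _ t).trans ?_
  rw [star_sqrtBernstein_mul_self]
  rfl

/-- The samples of t ↦ h(t) b are the scalar multiples h(k/n) b. Moving the scalars to the left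
factor assembles there the Bernstein approximation of h. -/
lemma bernsteinTensor_tmul {B : CStarAlg.{u}} (n : ℕ) (h : path unit.{u}) (b : B) :
    bernsteinTensor n (homOf (pathSMul B) (MaxTensor.tmul h b)) =
      MaxTensor.tmul (bernsteinApproximation n (h : C(unitInterval, ULift.{u} ℂ)) : path unit.{u})
        b := by
  have h1 : (bernsteinApproximation n (h : C(unitInterval, ULift.{u} ℂ)) : path unit.{u}) =
      ∑ k : Fin (n + 1), (h (bernstein.z k)).down •
        (star (sqrtBernstein.{u} n k) * sqrtBernstein n k) := by
    refine ContinuousMap.ext fun t => ULift.ext _ _ ?_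
    let ev : C(unitInterval, ULift.{u} ℂ) →+ ℂ :=
      { toFun := fun f => (f t).down, map_zero' := rfl, map_add' := fun _ _ => rfl }
    refine (map_sum ev _ _).trans (Eq.trans ?_ (map_sum ev _ _).symm)
    refine Finset.sum_congr rfl fun k _ => ?_
    change bernstein n k t • (h (bernstein.z k)).down = (h (bernstein.z k)).down *
      ((star (sqrtBernstein.{u} n k) * sqrtBernstein n k : path unit.{u}) t).down
    rw [star_sqrtBernstein_mul_self, mul_comm]
    rfl
  rw [h1, MaxTensor.sum_tmul, pathSMul_tmul]
  refine Finset.sum_congr rfl fun k _ => ?_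
  exact (MaxTensor.tmul_smul _ _ b).trans (MaxTensor.smul_tmul _ _ b).symm

/-- By additivity it is enough to treat elementary tensors, where this is Bernstein's theorem in the
first factor. Only the algebraic tensor product is treated; the completed one is reached through the
norm inequality that follows. -/
lemma tendsto_bernsteinTensor {B : CStarAlg.{u}} (x : path unit.{u} ⊗[ℂ] B) :
    Filter.Tendsto (fun n => bernsteinTensor n (homOf (pathSMul B) (MaxTensor.incl _ _ x)))
      Filter.atTop (nhds (MaxTensor.incl _ _ x)) := by
  induction x using TensorProduct.induction_on with
  | zero =>
    refine Filter.Tendsto.congr (f₁ := fun _ => MaxTensor.incl _ _ 0) (fun n => ?_)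
      tendsto_const_nhds
    rw [map_zero, map_zero]
    exact (norm_le_zero_iff.mp ((norm_bernsteinTensor_le n (0 : path B)).trans (by simp))).symm
  | tmul h b =>
    refine Filter.Tendsto.congr (fun n => (bernsteinTensor_tmul n h b).symm) ?_
    exact ((MaxTensor.continuous_tmul_left b).tendsto h).comp
      (bernsteinApproximation_uniform (h : C(unitInterval, ULift.{u} ℂ)))
  | add x y hx hy =>
    rw [map_add, map_add]
    refine Filter.Tendsto.congr (fun n => (bernsteinTensor_add n _ _).symm) (hx.add hy)

/-- For x in the algebraic tensor product, x is the limit of the Bernstein tensors of its image,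
each of norm at most four times that of the image. Both sides are continuous, so density gives the
general case. The argument replaces an appeal to nuclearity of C([0,1]). -/
lemma norm_le_pathSMul {B : CStarAlg.{u}} (x : tensor (path unit) B) :
    ‖x‖ ≤ 4 * ‖homOf (pathSMul B) x‖ := by
  have hc : IsClosed {x : tensor (path unit) B | ‖x‖ ≤ 4 * ‖homOf (pathSMul B) x‖} :=
    isClosed_le continuous_norm (continuous_const.mul (continuous_starHom _).norm)
  refine (MaxTensor.denseRange_incl (path unit.{u}) B).induction_on x hc fun y => ?_
  exact le_of_tendsto (tendsto_bernsteinTensor y).norm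
    (Filter.Eventually.of_forall fun n => norm_bernsteinTensor_le n _)

/-- The lower bound makes the map injective with closed range. The range contains the Bernstein
approximations of every path, and these converge to it. -/
lemma pathSMul_bijective (B : CStarAlg.{u}) : Function.Bijective (homOf (pathSMul B)) := by
  have ha : AntilipschitzWith 4 (homOf (pathSMul B)) :=
    AddMonoidHomClass.antilipschitz_of_bound _ norm_le_pathSMul
  refine ⟨ha.injective, fun f => ?_⟩
  have hcl : IsClosed (Set.range (homOf (pathSMul B))) :=
    (ha.isClosedEmbedding (uniformContinuous_addMonoidHom_of_continuous (continuous_starHom _))).isClosed_range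
  exact hcl.mem_of_tendsto (bernsteinApproximation_uniform (f : C(unitInterval, B)))
    (Filter.Eventually.of_forall fun n => ⟨bernsteinTensor n f, pathSMul_bernsteinTensor n f⟩)

lemma isIso_of_bijective {A B : CStarAlg.{u}} (f : A ⟶ B) (h : Function.Bijective (homOf f)) :
    IsIso f := by
  let e := StarAlgEquiv.ofBijective (homOf f) h
  exact ⟨ofHom (e.symm : B →⋆ₙₐ[ℂ] A),
    hom_ext (DFunLike.ext _ _ fun a => e.symm_apply_apply a),
    hom_ext (DFunLike.ext _ _ fun b => e.apply_symm_apply b)⟩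

instance isIso_pathSMul (B : CStarAlg.{u}) : IsIso (pathSMul B) :=
  isIso_of_bijective _ (pathSMul_bijective B)

lemma pathSMul_naturality {B B' : CStarAlg.{u}} (f : B ⟶ B') :
    tensorMap (𝟙 (path unit)) f ≫ pathSMul B' = pathSMul B ≫ pathMap f :=
  tensor_ext fun h b => by
    refine (congrArg (homOf (pathSMul B')) (tensorMap_tmul _ _ _ _)).trans
      ((pathSMul_tmul _ _ _).trans ?_)
    refine Eq.trans ?_ (congrArg (homOf (pathMap f)) (pathSMul_tmul B h b)).symm
    exact ContinuousMap.ext fun t => (map_smul (homOf f) (h t).down b).symm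

/-! ### Symmetry, associativity and unit maps on elementary tensors -/

lemma homOf_comp_eq {A B C : CStarAlg.{u}} {f : A ⟶ B} {g : B ⟶ C} {a : A} {b : B} {c : C}
    (hf : homOf f a = b) (hg : homOf g b = c) : homOf (f ≫ g) a = c :=
  (congrArg (homOf g) hf).trans hg

/-- Chained with `homOf_comp_eq`, this follows an elementary tensor through a composite of canonical
maps one factor at a time; the coherence identities below are checked in this way. -/
lemma tensorMap_tmul_eq {A A' B B' : CStarAlg.{u}} {f : A ⟶ A'} {g : B ⟶ B'} {a : A} {b : B}
    {a' : A'} {b' : B'} (hf : homOf f a = a') (hg : homOf g b = b') :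
    homOf (tensorMap f g) (MaxTensor.tmul a b) = MaxTensor.tmul a' b' :=
  (tensorMap_tmul f g a b).trans (congrArg₂ MaxTensor.tmul hf hg)

/-- The bilinear map underlying the symmetry of the tensor product. -/
def swapBilin (A B : CStarAlg.{u}) : A →ₗ[ℂ] B →ₗ[ℂ] tensor B A :=
  LinearMap.mk₂ ℂ (fun (a : A) (b : B) => MaxTensor.tmul b a)
    (fun a a' b => MaxTensor.tmul_add b a a') (fun c a b => MaxTensor.tmul_smul c b a)
    (fun a b b' => MaxTensor.add_tmul b b' a) (fun c a b => MaxTensor.smul_tmul c b a)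

lemma swapBilin_mul (A B : CStarAlg.{u}) (a : A) (b : B) (a' : A) (b' : B) :
    swapBilin A B (a * a') (b * b') = swapBilin A B a b * swapBilin A B a' b' :=
  (MaxTensor.tmul_mul_tmul _ _ _ _).symm

lemma swapBilin_star (A B : CStarAlg.{u}) (a : A) (b : B) :
    swapBilin A B (star a) (star b) = star (swapBilin A B a b) :=
  (MaxTensor.star_tmul _ _).symm

/-- The symmetry of the tensor product. -/
def tensorSwap (A B : CStarAlg.{u}) : tensor A B ⟶ tensor B A :=
  ofHom (MaxTensor.lift (swapBilin A B) (swapBilin_mul A B) (swapBilin_star A B))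

lemma tensorSwap_tmul (A B : CStarAlg.{u}) (a : A) (b : B) :
    homOf (tensorSwap A B) (MaxTensor.tmul a b) = MaxTensor.tmul b a :=
  MaxTensor.lift_tmul (swapBilin A B) (swapBilin_mul A B) (swapBilin_star A B) a b

/-- The canonical map `(A ⊗ B) ⊗ C ⟶ A ⊗ (B ⊗ C)`. -/
def assocHom (A B C : CStarAlg.{u}) : tensor (tensor A B) C ⟶ tensor A (tensor B C) :=
  -- The passage is (A ⊗ B) ⊗ C → C ⊗ (A ⊗ B) → C ⊗ (B ⊗ A) → (C ⊗ B) ⊗ A → (B ⊗ C) ⊗ A → A ⊗ (B ⊗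
  -- C): the symmetries turn `assocInv` with reversed factors into its own inverse.
  tensorSwap (tensor A B) C ≫ tensorMap (𝟙 C) (tensorSwap A B) ≫ assocInv C B A ≫
    tensorMap (tensorSwap C B) (𝟙 A) ≫ tensorSwap (tensor B C) A

lemma assocHom_tmul (A B C : CStarAlg.{u}) (a : A) (b : B) (c : C) :
    homOf (assocHom A B C) (MaxTensor.tmul (MaxTensor.tmul a b) c) =
      MaxTensor.tmul a (MaxTensor.tmul b c) :=
  homOf_comp_eq (tensorSwap_tmul _ _ _ _) <|
    homOf_comp_eq (tensorMap_tmul_eq rfl (tensorSwap_tmul _ _ _ _)) <|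
    homOf_comp_eq (homOf_assocInv_tmul _ _ _ _ _ _) <|
    homOf_comp_eq (tensorMap_tmul_eq (tensorSwap_tmul _ _ _ _) rfl) (tensorSwap_tmul _ _ _ _)

lemma assocInv_hom (A B C : CStarAlg.{u}) : assocInv A B C ≫ assocHom A B C = 𝟙 _ :=
  tensor_ext₃ fun _ _ _ =>
    homOf_comp_eq (homOf_assocInv_tmul _ _ _ _ _ _) (assocHom_tmul _ _ _ _ _ _)

/-- The canonical map `A ⊗ (B ⊗ C) ⟶ B ⊗ (A ⊗ C)`. -/
def tensorLeftComm (A B C : CStarAlg.{u}) : tensor A (tensor B C) ⟶ tensor B (tensor A C) :=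
  assocInv A B C ≫ tensorMap (tensorSwap A B) (𝟙 C) ≫ assocHom B A C

lemma tensorLeftComm_tmul (A B C : CStarAlg.{u}) (a : A) (b : B) (c : C) :
    homOf (tensorLeftComm A B C) (MaxTensor.tmul a (MaxTensor.tmul b c)) =
      MaxTensor.tmul b (MaxTensor.tmul a c) :=
  homOf_comp_eq (homOf_assocInv_tmul _ _ _ _ _ _) <|
    homOf_comp_eq (tensorMap_tmul_eq (tensorSwap_tmul _ _ _ _) rfl) (assocHom_tmul _ _ _ _ _ _)

lemma assocInv_tensorSwap (A B C : CStarAlg.{u}) :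
    assocInv A B C ≫ tensorMap (tensorSwap A B) (𝟙 C) = tensorLeftComm A B C ≫ assocInv B A C :=
  tensor_ext₃ fun _ _ _ =>
    (homOf_comp_eq (homOf_assocInv_tmul _ _ _ _ _ _)
      (tensorMap_tmul_eq (tensorSwap_tmul _ _ _ _) rfl)).trans
    (homOf_comp_eq (tensorLeftComm_tmul _ _ _ _ _ _) (homOf_assocInv_tmul _ _ _ _ _ _)).symm

/-- Both composites send a ⊗ (h ⊗ b) to t ↦ h(t) (a ⊗ b). Under `pathSMul` the labeling of the
cylinder is thus the exchange of A with C([0,1]), which is the reason why `cylinderSwap` is labeled.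
-/
lemma pathSMul_pathLabel (A B : CStarAlg.{u}) :
    tensorMap (𝟙 A) (pathSMul B) ≫ pathLabel A B =
      tensorLeftComm A (path unit) B ≫ pathSMul (tensor A B) :=
  tensor_ext₃ fun a h b => by
    have e : homOf (pathLabel A B) (MaxTensor.tmul a (pathSMulBilin B h b)) =
        pathSMulBilin (tensor A B) h (MaxTensor.tmul a b) :=
      ContinuousMap.ext fun t => (pathLabel_tmul A B a _ t).trans
        (MaxTensor.tmul_smul (h t).down a b)
    exact (homOf_comp_eq (tensorMap_tmul_eq rfl (pathSMul_tmul _ _ _)) e).trans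
      (homOf_comp_eq (tensorLeftComm_tmul _ _ _ _ _ _) (pathSMul_tmul _ _ _)).symm

/-- Scalar multiplication as a bilinear map. -/
def unitBilin (B : CStarAlg.{u}) : unit.{u} →ₗ[ℂ] B →ₗ[ℂ] B :=
  LinearMap.mk₂ ℂ (fun (c : ULift.{u} ℂ) (b : B) => c.down • b)
    (fun _ _ _ => add_smul _ _ _) (fun _ _ _ => smul_assoc _ _ _)
    (fun _ _ _ => smul_add _ _ _) (fun _ _ _ => smul_comm _ _ _)

lemma unitBilin_mul (B : CStarAlg.{u}) (c : unit.{u}) (b : B) (c' : unit.{u}) (b' : B) :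
    unitBilin B (c * c') (b * b') = unitBilin B c b * unitBilin B c' b' :=
  (smul_mul_smul_comm c.down b c'.down b').symm

lemma unitBilin_star (B : CStarAlg.{u}) (c : unit.{u}) (b : B) :
    unitBilin B (star c) (star b) = star (unitBilin B c b) :=
  (star_smul c.down b).symm

/-- The canonical map `ℂ ⊗ B ⟶ B`. -/
def unitHom (B : CStarAlg.{u}) : tensor unit B ⟶ B :=
  ofHom (MaxTensor.lift (unitBilin B) (unitBilin_mul B) (unitBilin_star B))

lemma unitHom_tmul (B : CStarAlg.{u}) (c : unit.{u}) (b : B) :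
    homOf (unitHom B) (MaxTensor.tmul c b) = c.down • b :=
  MaxTensor.lift_tmul (unitBilin B) (unitBilin_mul B) (unitBilin_star B) c b

lemma unitHom_inv (B : CStarAlg.{u}) : unitHom B ≫ unitInv B = 𝟙 _ :=
  tensor_ext fun c b => homOf_comp_eq (unitHom_tmul B c b) <| by
    rw [homOf_unitInv, MaxTensor.tmul_smul, ← MaxTensor.smul_tmul]
    exact congrArg (MaxTensor.tmul · b) (ULift.ext _ _ (mul_one c.down))

lemma unitInv_hom (B : CStarAlg.{u}) : unitInv B ≫ unitHom B = 𝟙 _ :=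
  hom_ext (DFunLike.ext _ _ fun b => (unitHom_tmul B 1 b).trans (one_smul ℂ b))

/-- Under `pathSMul`, evaluation at t acts on the factor C([0,1]) alone. Naturality of a labeling in
its first variable therefore applies to it. -/
lemma pathSMul_evalAt (t : unitInterval) (B : CStarAlg.{u}) :
    pathSMul B ≫ evalAt t B = tensorMap (evalAt t unit) (𝟙 B) ≫ unitHom B :=
  tensor_ext fun h b => by
    have e₁ : homOf (evalAt t B) (pathSMulBilin B h b) = (h t).down • b := rfl
    have e₂ : homOf (evalAt t unit.{u}) h = h t := rfl
    have e₃ : homOf (𝟙 B) b = b := rfl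
    exact (homOf_comp_eq (pathSMul_tmul B h b) e₁).trans
      (homOf_comp_eq (tensorMap_tmul_eq e₂ e₃) (unitHom_tmul B (h t) b)).symm

/-! ### Reparametrization, constant paths and concatenation -/

/-- Reparametrization of paths. -/
def pathReparam (σ : C(unitInterval, unitInterval)) (B : CStarAlg.{u}) : path B ⟶ path B :=
  ofHom
    { toFun := fun h => ContinuousMap.comp h σ
      map_smul' := fun _ _ => rfl
      map_zero' := rfl
      map_add' := fun _ _ => rfl
      map_mul' := fun _ _ => rfl
      map_star' := fun _ => rfl }

lemma pathReparam_evalAt (σ : C(unitInterval, unitInterval)) (t : unitInterval)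
    (B : CStarAlg.{u}) : pathReparam σ B ≫ evalAt t B = evalAt (σ t) B := rfl

/-- Constant paths. -/
def pathConst (B : CStarAlg.{u}) : B ⟶ path B :=
  ofHom
    { toFun := fun b => ContinuousMap.const unitInterval b
      map_smul' := fun _ _ => rfl
      map_zero' := rfl
      map_add' := fun _ _ => rfl
      map_mul' := fun _ _ => rfl
      map_star' := fun _ => rfl }

lemma pathConst_evalAt (t : unitInterval) (B : CStarAlg.{u}) :
    pathConst B ≫ evalAt t B = 𝟙 B := rfl

/-- The section by constant paths places the concatenation square among the pullbacks that good
endofunctors preserve. -/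
lemma isSplitEpi_evalAt (t : unitInterval) (B : CStarAlg.{u}) : IsSplitEpi (evalAt t B) :=
  ⟨⟨⟨pathConst B, pathConst_evalAt t B⟩⟩⟩

/-- The map `t ↦ t / 2` of the unit interval. -/
def firstHalf : C(unitInterval, unitInterval) where
  toFun t := ⟨(t : ℝ) / 2, by have := t.2; constructor <;> linarith [this.1, this.2]⟩

/-- The map `t ↦ (t + 1) / 2` of the unit interval. -/
def secondHalf : C(unitInterval, unitInterval) where
  toFun t := ⟨((t : ℝ) + 1) / 2, by have := t.2; constructor <;> linarith [this.1, this.2]⟩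

lemma firstHalf_zero : firstHalf 0 = 0 := Subtype.ext (by simp [firstHalf])

lemma secondHalf_one : secondHalf 1 = 1 := Subtype.ext (by simp [secondHalf])

lemma firstHalf_one : firstHalf 1 = secondHalf 0 :=
  Subtype.ext (by simp [firstHalf, secondHalf])

lemma exists_half (t : unitInterval) : (∃ s, t = firstHalf s) ∨ ∃ s, t = secondHalf s := by
  have ht := t.2
  rcases le_total (t : ℝ) (1 / 2) with h | h
  · exact .inl ⟨⟨2 * t, by linarith [ht.1], by linarith⟩, Subtype.ext (by simp [firstHalf])⟩
  · exact .inr ⟨⟨2 * t - 1, by linarith, by linarith [ht.2]⟩, Subtype.ext (by simp [secondHalf])⟩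

lemma exists_concat {X : Type*} [TopologicalSpace X] (f g : C(unitInterval, X))
    (h : f 1 = g 0) : ∃ w : C(unitInterval, X), w.comp firstHalf = f ∧ w.comp secondHalf = g := by
  let p : Path (f 0) (f 1) := ⟨f, rfl, rfl⟩
  let q : Path (f 1) (g 1) := ⟨g, h.symm, rfl⟩
  refine ⟨(p.trans q).toContinuousMap, ?_, ?_⟩
  · ext t
    change p.trans q (firstHalf t) = f t
    have ht : ((firstHalf t : unitInterval) : ℝ) = t / 2 := rfl
    rw [Path.trans_apply, dif_pos (by rw [ht]; linarith [t.2.2])]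
    exact congrArg f (Subtype.ext (by simp only [ht]; ring))
  · ext t
    change p.trans q (secondHalf t) = g t
    have ht : ((secondHalf t : unitInterval) : ℝ) = (t + 1) / 2 := rfl
    rw [Path.trans_apply]
    -- `Path.trans` assigns the midpoint to the first path, so the first branch occurs only for t =
    -- 0, where f 1 = g 0 settles it.
    split_ifs with h'
    · have h0 : t = 0 := Subtype.ext (le_antisymm (show (t : ℝ) ≤ 0 by rw [ht] at h'; linarith) t.2.1)
      subst h0
      rw [← h]
      exact congrArg f (Subtype.ext (by simp [ht]))
    · exact congrArg g (Subtype.ext (by simp only [ht]; ring))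

/-- A path amounts to two paths with f(1) = g(0): they concatenate, and uniqueness holds because the
two halves cover the interval. The image of this square under G yields transitivity of homotopy. -/
lemma isPullback_pathReparam (B : CStarAlg.{u}) :
    IsPullback (pathReparam firstHalf B) (pathReparam secondHalf B) (evalAt 1 B) (evalAt 0 B) := by
  refine isPullback_of_existsUnique ?_ fun (f : C(unitInterval, B)) (g : C(unitInterval, B)) h => ?_
  · rw [pathReparam_evalAt, pathReparam_evalAt, firstHalf_one]
  · obtain ⟨w, hf, hg⟩ := exists_concat f g h
    refine ⟨w, ⟨hf, hg⟩, fun (w' : C(unitInterval, B)) hw => ContinuousMap.ext fun t => ?_⟩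
    rcases exists_half t with ⟨s, rfl⟩ | ⟨s, rfl⟩
    · exact congrArg (fun z : C(unitInterval, B) => z s) (hw.1.trans hf.symm)
    · exact congrArg (fun z : C(unitInterval, B) => z s) (hw.2.trans hg.symm)

end CStarAlg

/-! ### Labeled transformations: inverses, reparametrizations, constant paths -/

namespace GoodEndofunctor

/-- The componentwise inverse is automatically natural and labeled: the labeling square of α can be
inverted along its components. -/
lemma isIso_of_app {F G : GoodEndofunctor.{u}} (α : F ⟶ G)
    (h : ∀ B, IsIso ((natOf α).app B)) : IsIso α := by
  have hα : IsIso (natOf α) := NatIso.isIso_of_isIso_app _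
  let β : G ⟶ F := mkHom (inv (natOf α)) fun A B => by
    rw [NatIso.isIso_inv_app, NatIso.isIso_inv_app, IsIso.comp_inv_eq, Category.assoc, label_comm,
      ← Category.assoc, ← tensorMap_comp, IsIso.inv_hom_id, Category.comp_id, tensorMap_id,
      Category.id_comp]
  exact ⟨β, Hom.ext (IsIso.hom_inv_id (natOf α)), Hom.ext (IsIso.inv_hom_id (natOf α))⟩

lemma app_inv_comp {F G : GoodEndofunctor.{u}} (α : F ⟶ G) [IsIso α] (B : CStarAlg.{u}) :
    (natOf (inv α)).app B ≫ (natOf α).app B = 𝟙 _ :=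
  congrArg (fun β => (natOf β).app B) (IsIso.inv_hom_id α)

/-- Reparametrization of paths as a labeled natural transformation. -/
def reparam (σ : C(unitInterval, unitInterval)) : cylinder.{u} ⟶ cylinder :=
  mkHom { app := pathReparam σ, naturality := fun _ _ _ => rfl } fun A B =>
    path_ext fun t => by
      change (pathLabel A B ≫ pathReparam σ _) ≫ evalAt t _ =
        (tensorMap (𝟙 A) (pathReparam σ B) ≫ pathLabel A B) ≫ evalAt t _
      rw [Category.assoc, Category.assoc, pathReparam_evalAt, pathLabel_evalAt, pathLabel_evalAt,
        ← tensorMap_comp, pathReparam_evalAt, Category.comp_id]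

/-- Constant paths as a labeled natural transformation. -/
def constPath : identity.{u} ⟶ cylinder :=
  mkHom { app := pathConst, naturality := fun _ _ _ => rfl } fun A B =>
    path_ext fun t => by
      change (𝟙 _ ≫ pathConst _) ≫ evalAt t _ =
        (tensorMap (𝟙 A) (pathConst B) ≫ pathLabel A B) ≫ evalAt t _
      rw [Category.assoc, Category.assoc, pathConst_evalAt, pathLabel_evalAt,
        ← tensorMap_comp, pathConst_evalAt, Category.comp_id, Category.comp_id, tensorMap_id]

/-! ### The exchange I G ⇒ G I -/

section CylinderSwap

variable (G : GoodEndofunctor.{u})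

/-- Labeling by A and A' in succession, in either order, is labeling by a tensor product
(`label_tensor`), and naturality of the label in its first variable along A ⊗ A' → A' ⊗ A compares
the two orders. -/
lemma label_tensorLeftComm (A A' B : CStarAlg.{u}) :
    tensorLeftComm A A' (G.functor.obj B) ≫ tensorMap (𝟙 A') (G.label A B) ≫
        G.label A' (tensor A B) =
      tensorMap (𝟙 A) (G.label A' B) ≫ G.label A (tensor A' B) ≫
        G.functor.map (tensorLeftComm A A' B) := by
  have hc : ∀ X, assocInv A A' X ≫ tensorMap (tensorSwap A A') (𝟙 X) ≫ assocHom A' A X =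
    tensorLeftComm A A' X := fun _ => rfl
  have h₁ : tensorMap (𝟙 A') (G.label A B) ≫ G.label A' (tensor A B) =
      assocInv A' A (G.functor.obj B) ≫ G.label (tensor A' A) B ≫
        G.functor.map (assocHom A' A B) := by
    rw [← Category.assoc (assocInv A' A _), G.label_tensor, Category.assoc, Category.assoc,
      ← Functor.map_comp, assocInv_hom, CategoryTheory.Functor.map_id, Category.comp_id]
  rw [h₁, ← Category.assoc, ← assocInv_tensorSwap, Category.assoc,
    ← Category.assoc (tensorMap _ (𝟙 _)), G.label_map, Category.assoc, ← Functor.map_comp,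
    ← Category.assoc, G.label_tensor, Category.assoc, Category.assoc, ← Functor.map_comp, hc]

/-- This is `label_unit` with the maps `unitInv` replaced by their inverses. -/
lemma unitHom_map (B : CStarAlg.{u}) :
    G.label CStarAlg.unit B ≫ G.functor.map (unitHom B) = unitHom (G.functor.obj B) := by
  have h : unitHom (G.functor.obj B) ≫ unitInv (G.functor.obj B) ≫ G.label CStarAlg.unit B ≫
      G.functor.map (unitHom B) = unitHom (G.functor.obj B) := by
    rw [← Category.assoc (unitInv _), G.label_unit, ← Functor.map_comp, unitInv_hom,
      CategoryTheory.Functor.map_id, Category.comp_id]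
  rwa [← Category.assoc, unitHom_inv, Category.id_comp] at h

/-- The components of `cylinderSwap`. -/
def cylinderSwapApp (B : CStarAlg.{u}) : path (G.functor.obj B) ⟶ G.functor.obj (path B) :=
  inv (pathSMul (G.functor.obj B)) ≫ G.label (path CStarAlg.unit) B ≫ G.functor.map (pathSMul B)

/-- The labeled natural transformation `I G ⟶ G I` obtained from the labeling of `G` and the
isomorphism `C([0,1]) ⊗ B ≅ C([0,1], B)`. -/
def cylinderSwap : comp cylinder G ⟶ comp G cylinder :=
  mkHom
    { app := cylinderSwapApp G
      naturality := fun B B' f => by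
        change pathMap (G.functor.map f) ≫ cylinderSwapApp G B' =
          cylinderSwapApp G B ≫ G.functor.map (pathMap f)
        unfold cylinderSwapApp
        rw [Category.assoc, Category.assoc, ← Functor.map_comp, ← pathSMul_naturality,
          Functor.map_comp, ← Category.assoc (G.label _ _), ← G.label_naturality, Category.assoc,
          IsIso.eq_inv_comp, ← Category.assoc, ← pathSMul_naturality, Category.assoc,
          IsIso.hom_inv_id_assoc] }
    fun A B => by
      change (pathLabel A (G.functor.obj B) ≫ pathMap (G.label A B)) ≫
          inv (pathSMul (G.functor.obj (tensor A B))) ≫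
            G.label (path CStarAlg.unit) (tensor A B) ≫ G.functor.map (pathSMul (tensor A B)) =
        tensorMap (𝟙 A) (inv (pathSMul (G.functor.obj B)) ≫ G.label (path CStarAlg.unit) B ≫
          G.functor.map (pathSMul B)) ≫ G.label A (path B) ≫ G.functor.map (pathLabel A B)
      have hs : tensorMap (𝟙 A) (inv (pathSMul (G.functor.obj B))) ≫
          tensorMap (𝟙 A) (pathSMul (G.functor.obj B)) = 𝟙 _ := by
        rw [← tensorMap_comp, IsIso.inv_hom_id, Category.comp_id, tensorMap_id]
      have hl : pathLabel A (G.functor.obj B) =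
          tensorMap (𝟙 A) (inv (pathSMul (G.functor.obj B))) ≫
            tensorLeftComm A (path CStarAlg.unit) (G.functor.obj B) ≫
              pathSMul (tensor A (G.functor.obj B)) := by
        rw [← pathSMul_pathLabel, ← Category.assoc, hs, Category.id_comp]
      have ht : tensorMap (𝟙 A) (inv (pathSMul (G.functor.obj B)) ≫
            G.label (path CStarAlg.unit) B ≫ G.functor.map (pathSMul B)) =
          tensorMap (𝟙 A) (inv (pathSMul (G.functor.obj B))) ≫
            tensorMap (𝟙 A) (G.label (path CStarAlg.unit) B) ≫
              tensorMap (𝟙 A) (G.functor.map (pathSMul B)) := by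
        rw [← tensorMap_comp, ← tensorMap_comp, Category.comp_id, Category.comp_id]
      rw [hl, ht]
      simp only [Category.assoc]
      -- The common first factor, the inverse of `pathSMul` tensored with A, is removed. On both
      -- sides the labeling of I has become, or now becomes through `pathSMul_pathLabel`, an
      -- exchange of A with C([0,1]), and `label_tensorLeftComm` says that G respects this exchange.
      congr 1
      rw [← Category.assoc (tensorMap (𝟙 A) (G.functor.map _)), G.label_naturality, Category.assoc,
        ← Functor.map_comp, pathSMul_pathLabel, Functor.map_comp,
        ← Category.assoc (G.label A _), ← Category.assoc (tensorMap (𝟙 A) (G.label _ _)),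
        ← label_tensorLeftComm, ← Category.assoc (pathSMul _), ← pathSMul_naturality]
      simp only [Category.assoc, IsIso.hom_inv_id_assoc]

/-- By `pathSMul_evalAt`, evaluation happens in the first variable of the label. Naturality there
replaces C([0,1]) by ℂ, and `unitHom_map` removes the factor ℂ. Because of this identity, the
exchange keeps the ends of a homotopy. -/
lemma cylinderSwapApp_evalAt (t : unitInterval) (B : CStarAlg.{u}) :
    cylinderSwapApp G B ≫ G.functor.map (evalAt t B) = evalAt t (G.functor.obj B) := by
  rw [cylinderSwapApp, Category.assoc, Category.assoc, ← Functor.map_comp, pathSMul_evalAt,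
    Functor.map_comp, ← Category.assoc (G.label _ _), ← G.label_map, Category.assoc, unitHom_map,
    ← pathSMul_evalAt, IsIso.inv_hom_id_assoc]

end CylinderSwap

end GoodEndofunctor

/-! ### Good endofunctors preserve binary products; invertible distributivity -/

namespace CStarAlg

lemma isPullback_prod (A B : CStarAlg.{u}) :
    IsPullback (prodFst A B) (prodSnd A B) (toZero A) (toZero B) :=
  isPullback_of_existsUnique (zero_ext _ _) fun x y _ =>
    ⟨(x, y), ⟨rfl, rfl⟩, fun _ h => Prod.ext h.1 h.2⟩

lemma isSplitEpi_toZero (B : CStarAlg.{u}) : IsSplitEpi (toZero B) :=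
  ⟨⟨⟨ofHom (0 : PUnit.{u + 1} →⋆ₙₐ[ℂ] B), zero_ext _ _⟩⟩⟩

/-- The product is the pullback of A → 0 ← B, and B → 0 is split by the zero map. Hence F sends it
to a pullback over F 0, and since F 0 is trivial the matching condition is empty: the result is the
product of F A and F B. -/
lemma IsDecent.isIso_prodLift {F : CStarAlg.{u} ⥤ CStarAlg.{u}} (hF : IsDecent F)
    (A B : CStarAlg.{u}) : IsIso (prodLift (F.map (prodFst A B)) (F.map (prodSnd A B))) := by
  have h := hF.map_pullback (isPullback_prod A B) (isSplitEpi_toZero B)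
  have h0 : Subsingleton (F.obj zero) := (isIso_toZero_iff _).mp hF.map_zero
  refine isIso_of_bijective _ ⟨fun x y hxy => ?_, fun z => ?_⟩
  · obtain ⟨w, -, hw⟩ := existsUnique_of_isPullback h _ _
      (Subsingleton.elim (homOf (F.map (toZero A)) (homOf (F.map (prodFst A B)) x))
        (homOf (F.map (toZero B)) (homOf (F.map (prodSnd A B)) x)))
    exact (hw x ⟨rfl, rfl⟩).trans
      (hw y ⟨(congrArg Prod.fst hxy).symm, (congrArg Prod.snd hxy).symm⟩).symm
  · obtain ⟨w, ⟨h₁, h₂⟩, -⟩ := existsUnique_of_isPullback h z.1 z.2 (Subsingleton.elim _ _)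
    exact ⟨w, Prod.ext h₁ h₂⟩

end CStarAlg

namespace GoodEndofunctor

lemma isIso_distL (F G G' : GoodEndofunctor.{u}) : IsIso (bimonoidal.distL F G G') :=
  isIso_of_app _ fun B => by
    have h := F.decent.isIso_prodLift (G.functor.obj B) (G'.functor.obj B)
    have e : (natOf (bimonoidal.distL F G G')).app B =
        CStarAlg.prodLift (F.functor.map (CStarAlg.prodFst (G.functor.obj B) (G'.functor.obj B)))
          (F.functor.map (CStarAlg.prodSnd (G.functor.obj B) (G'.functor.obj B))) := rfl
    rw [e]
    exact h

/-- Sums are formed on values, so (G ⊕ G')F and GF ⊕ G'F have the same components, and the canonical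
comparison is the identity there. -/
lemma natOf_distR_app (G G' F : GoodEndofunctor.{u}) (B : CStarAlg.{u}) :
    (natOf (bimonoidal.distR G G' F)).app B = 𝟙 _ := by
  have e : (natOf (bimonoidal.distR G G' F)).app B =
    (prod G G').functor.map (𝟙 (F.functor.obj B)) := rfl
  rw [e, CategoryTheory.Functor.map_id]
  rfl

lemma isIso_distR (G G' F : GoodEndofunctor.{u}) : IsIso (bimonoidal.distR G G' F) :=
  isIso_of_app _ fun B => by
    rw [natOf_distR_app]
    exact IsIso.id _

/-! ### Homotopy is a bimonoidal congruence -/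

variable {F G : GoodEndofunctor.{u}}

/-- The components of a labeled natural transformation into `G I`. -/
def pathApp (Γ : F ⟶ comp G cylinder) (B : CStarAlg.{u}) :
    F.functor.obj B ⟶ G.functor.obj (path B) := (natOf Γ).app B

lemma comp_ev_eq_iff (Γ : F ⟶ comp G cylinder) (t : unitInterval) (γ : F ⟶ G) :
    Γ ≫ compHom (𝟙 G) (ev t) ≫ (compRightUnitor G).hom = γ ↔
      ∀ B, pathApp Γ B ≫ G.functor.map (evalAt t B) = (natOf γ).app B := by
  have key : ∀ B, (natOf (Γ ≫ compHom (𝟙 G) (ev t) ≫ (compRightUnitor G).hom)).app B =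
      pathApp Γ B ≫ G.functor.map (evalAt t B) := fun _ => rfl
  refine ⟨fun h B => by rw [← key, h], fun h => hom_ext fun B => by rw [key, h]⟩

/-- In this componentwise form the right unitor, whose components are identities, disappears. -/
lemma homotopic_iff {γ₀ γ₁ : F ⟶ G} : Homotopic γ₀ γ₁ ↔ ∃ Γ : F ⟶ comp G cylinder,
    ∀ B, pathApp Γ B ≫ G.functor.map (evalAt 0 B) = (natOf γ₀).app B ∧
      pathApp Γ B ≫ G.functor.map (evalAt 1 B) = (natOf γ₁).app B := by
  refine exists_congr fun Γ => ?_
  rw [comp_ev_eq_iff, comp_ev_eq_iff, forall_and]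

lemma Homotopic.refl (γ : F ⟶ G) : Homotopic γ γ := by
  refine homotopic_iff.mpr ⟨γ ≫ (compRightUnitor G).inv ≫ compHom (𝟙 G) constPath, fun B => ?_⟩
  have h : ∀ t, ((natOf γ).app B ≫ G.functor.map (pathConst B)) ≫ G.functor.map (evalAt t B) =
      (natOf γ).app B := fun t => by
    rw [Category.assoc, ← Functor.map_comp, pathConst_evalAt, CategoryTheory.Functor.map_id,
      Category.comp_id]
  exact ⟨h 0, h 1⟩

lemma Homotopic.symm {γ₀ γ₁ : F ⟶ G} (h : Homotopic γ₀ γ₁) : Homotopic γ₁ γ₀ := by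
  obtain ⟨Γ, hΓ⟩ := homotopic_iff.mp h
  let σ : C(unitInterval, unitInterval) := ⟨unitInterval.symm, unitInterval.continuous_symm⟩
  refine homotopic_iff.mpr ⟨Γ ≫ compHom (𝟙 G) (reparam σ), fun B => ?_⟩
  have h : ∀ t, (pathApp Γ B ≫ G.functor.map (pathReparam σ B)) ≫ G.functor.map (evalAt t B) =
      pathApp Γ B ≫ G.functor.map (evalAt (unitInterval.symm t) B) := fun t => by
    rw [Category.assoc, ← Functor.map_comp, pathReparam_evalAt]
    rfl
  exact ⟨((h 0).trans (by rw [unitInterval.symm_zero])).trans (hΓ B).2,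
    ((h 1).trans (by rw [unitInterval.symm_one])).trans (hΓ B).1⟩

section Concat

lemma isPullback_map_pathReparam (G : GoodEndofunctor.{u}) (B : CStarAlg.{u}) :
    IsPullback (G.functor.map (pathReparam firstHalf B)) (G.functor.map (pathReparam secondHalf B))
      (G.functor.map (evalAt 1 B)) (G.functor.map (evalAt 0 B)) :=
  G.decent.map_pullback (isPullback_pathReparam B) (isSplitEpi_evalAt 0 B)

/-- G preserves the concatenation square, so at each B the two components lift uniquely to
G(C([0,1], B)). Naturality and compatibility with the labelings can be tested on the two legs of the
pullback, where they are those of Γ and Γ'. -/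
lemma exists_concat_pathApp {Γ Γ' : F ⟶ comp G cylinder}
    (h : ∀ B, pathApp Γ B ≫ G.functor.map (evalAt 1 B) =
      pathApp Γ' B ≫ G.functor.map (evalAt 0 B)) :
    ∃ Δ : F ⟶ comp G cylinder,
      ∀ B, pathApp Δ B ≫ G.functor.map (pathReparam firstHalf B) = pathApp Γ B ∧
        pathApp Δ B ≫ G.functor.map (pathReparam secondHalf B) = pathApp Γ' B := by
  have nat : ∀ (Γ : F ⟶ comp G cylinder) {B B' : CStarAlg.{u}} (f : B ⟶ B'),
      F.functor.map f ≫ pathApp Γ B' = pathApp Γ B ≫ G.functor.map (pathMap f) :=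
    fun Γ _ _ f => (natOf Γ).naturality f
  have lab : ∀ (Γ : F ⟶ comp G cylinder) (A B : CStarAlg.{u}),
      F.label A B ≫ pathApp Γ (tensor A B) = tensorMap (𝟙 A) (pathApp Γ B) ≫
        G.label A (path B) ≫ G.functor.map (pathLabel A B) := fun Γ => label_comm Γ
  have plab : ∀ σ (A B : CStarAlg.{u}), pathLabel A B ≫ pathReparam σ (tensor A B) =
      tensorMap (𝟙 A) (pathReparam σ B) ≫ pathLabel A B := fun σ => label_comm (reparam σ)
  have pnat : ∀ σ {B B' : CStarAlg.{u}} (f : B ⟶ B'),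
      pathMap f ≫ pathReparam σ B' = pathReparam σ B ≫ pathMap f := fun _ _ _ _ => rfl
  let L : ∀ B, F.functor.obj B ⟶ G.functor.obj (path B) := fun B =>
    (isPullback_map_pathReparam G B).lift (pathApp Γ B) (pathApp Γ' B) (h B)
  have hL₁ : ∀ B, L B ≫ G.functor.map (pathReparam firstHalf B) = pathApp Γ B :=
    fun B => (isPullback_map_pathReparam G B).lift_fst _ _ _
  have hL₂ : ∀ B, L B ≫ G.functor.map (pathReparam secondHalf B) = pathApp Γ' B :=
    fun B => (isPullback_map_pathReparam G B).lift_snd _ _ _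
  -- `natL` and `labL` are stated for an arbitrary reparametrization σ, so that each serves both
  -- legs of the pullback.
  have natL : ∀ σ (Γ : F ⟶ comp G cylinder)
      (_ : ∀ B, L B ≫ G.functor.map (pathReparam σ B) = pathApp Γ B)
      {B B' : CStarAlg.{u}} (f : B ⟶ B'),
      (F.functor.map f ≫ L B') ≫ G.functor.map (pathReparam σ B') =
        (L B ≫ G.functor.map (pathMap f)) ≫ G.functor.map (pathReparam σ B') := by
    intro σ Γ hσ B B' f
    rw [Category.assoc, hσ, nat, Category.assoc, ← Functor.map_comp, pnat, Functor.map_comp,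
      ← Category.assoc, hσ]
  have labL : ∀ σ (Γ : F ⟶ comp G cylinder)
      (_ : ∀ B, L B ≫ G.functor.map (pathReparam σ B) = pathApp Γ B) (A B : CStarAlg.{u}),
      (F.label A B ≫ L (tensor A B)) ≫ G.functor.map (pathReparam σ (tensor A B)) =
        (tensorMap (𝟙 A) (L B) ≫ G.label A (path B) ≫ G.functor.map (pathLabel A B)) ≫
          G.functor.map (pathReparam σ (tensor A B)) := by
    intro σ Γ hσ A B
    rw [Category.assoc, hσ, lab, Category.assoc, Category.assoc, ← Functor.map_comp, plab,
      Functor.map_comp, ← Category.assoc (G.label _ _), ← G.label_naturality, Category.assoc,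
      ← Category.assoc (tensorMap (𝟙 A) (L B)), ← tensorMap_comp, hσ, Category.comp_id]
  refine ⟨mkHom { app := L, naturality := fun B B' f => ?_ } fun A B => ?_,
    fun B => ⟨hL₁ B, hL₂ B⟩⟩
  · exact (isPullback_map_pathReparam G B').hom_ext (natL _ Γ hL₁ f) (natL _ Γ' hL₂ f)
  · exact (isPullback_map_pathReparam G (tensor A B)).hom_ext (labL _ Γ hL₁ A B)
      (labL _ Γ' hL₂ A B)

end Concat

lemma Homotopic.trans {γ₀ γ₁ γ₂ : F ⟶ G} (h : Homotopic γ₀ γ₁) (h' : Homotopic γ₁ γ₂) :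
    Homotopic γ₀ γ₂ := by
  obtain ⟨Γ, hΓ⟩ := homotopic_iff.mp h
  obtain ⟨Γ', hΓ'⟩ := homotopic_iff.mp h'
  obtain ⟨Δ, hΔ⟩ := exists_concat_pathApp fun B => (hΓ B).2.trans (hΓ' B).1.symm
  refine homotopic_iff.mpr ⟨Δ, fun B => ⟨?_, ?_⟩⟩
  · rw [← (hΓ B).1, ← (hΔ B).1, Category.assoc, ← Functor.map_comp, pathReparam_evalAt,
      firstHalf_zero]
  · rw [← (hΓ' B).2, ← (hΔ B).2, Category.assoc, ← Functor.map_comp, pathReparam_evalAt,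
      secondHalf_one]

lemma Homotopic.precomp {E : GoodEndofunctor.{u}} (δ : E ⟶ F) {γ₀ γ₁ : F ⟶ G}
    (h : Homotopic γ₀ γ₁) : Homotopic (δ ≫ γ₀) (δ ≫ γ₁) := by
  obtain ⟨Γ, rfl, rfl⟩ := h
  exact ⟨δ ≫ Γ, Category.assoc _ _ _, Category.assoc _ _ _⟩

/-- The homotopy is followed by δ whiskered with the cylinder; naturality of δ at the evaluations
gives the ends. -/
lemma Homotopic.postcomp {H : GoodEndofunctor.{u}} {γ₀ γ₁ : F ⟶ G} (h : Homotopic γ₀ γ₁)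
    (δ : G ⟶ H) : Homotopic (γ₀ ≫ δ) (γ₁ ≫ δ) := by
  obtain ⟨Γ, hΓ⟩ := homotopic_iff.mp h
  refine homotopic_iff.mpr ⟨Γ ≫ bimonoidal.mul.whiskerRight δ cylinder, fun B => ?_⟩
  have key : ∀ t, pathApp (Γ ≫ bimonoidal.mul.whiskerRight δ cylinder) B ≫
      H.functor.map (evalAt t B) =
      (pathApp Γ B ≫ G.functor.map (evalAt t B)) ≫ (natOf δ).app B := fun t => by
    have e : pathApp (Γ ≫ bimonoidal.mul.whiskerRight δ cylinder) B =
      pathApp Γ B ≫ G.functor.map (𝟙 (path B)) ≫ (natOf δ).app (path B) := rfl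
    rw [e, CategoryTheory.Functor.map_id, Category.id_comp, Category.assoc, Category.assoc,
      (natOf δ).naturality]
  rw [key, key, (hΓ B).1, (hΓ B).2]
  exact ⟨rfl, rfl⟩

/-- HΓ already ends in HGI, up to the associator with identity components. -/
lemma Homotopic.whiskerLeft {γ₀ γ₁ : F ⟶ G} (h : Homotopic γ₀ γ₁) (H : GoodEndofunctor.{u}) :
    Homotopic (compHom (𝟙 H) γ₀) (compHom (𝟙 H) γ₁) := by
  obtain ⟨Γ, hΓ⟩ := homotopic_iff.mp h
  refine homotopic_iff.mpr ⟨compHom (𝟙 H) Γ ≫ (compAssoc H G cylinder).inv, fun B => ?_⟩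
  have key : ∀ t (γ : F ⟶ G), pathApp Γ B ≫ G.functor.map (evalAt t B) = (natOf γ).app B →
      H.functor.map (pathApp Γ B) ≫ H.functor.map (G.functor.map (evalAt t B)) =
      H.functor.map ((natOf γ).app B) := fun t γ e => by
    rw [← Functor.map_comp, e]
  exact ⟨key 0 γ₀ (hΓ B).1, key 1 γ₁ (hΓ B).2⟩

/-- ΓH ends in GIH, with the cylinder on the wrong side of H, and `cylinderSwap` moves it to GHI.
The labeling of H is indispensable for this construction. -/
lemma Homotopic.whiskerRight {γ₀ γ₁ : F ⟶ G} (h : Homotopic γ₀ γ₁) (H : GoodEndofunctor.{u}) :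
    Homotopic (compHom γ₀ (𝟙 H)) (compHom γ₁ (𝟙 H)) := by
  obtain ⟨Γ, hΓ⟩ := homotopic_iff.mp h
  refine homotopic_iff.mpr ⟨compHom Γ (𝟙 H) ≫ (compAssoc G cylinder H).hom ≫
    compHom (𝟙 G) (cylinderSwap H) ≫ (compAssoc G H cylinder).inv, fun B => ?_⟩
  have key : ∀ t (γ : F ⟶ G), pathApp Γ (H.functor.obj B) ≫
        G.functor.map (evalAt t (H.functor.obj B)) = (natOf γ).app (H.functor.obj B) →
      (F.functor.map (𝟙 (H.functor.obj B)) ≫ pathApp Γ (H.functor.obj B) ≫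
        G.functor.map (cylinderSwapApp H B)) ≫ G.functor.map (H.functor.map (evalAt t B)) =
      F.functor.map (𝟙 (H.functor.obj B)) ≫ (natOf γ).app (H.functor.obj B) := fun t γ e => by
    rw [Category.assoc, Category.assoc, ← Functor.map_comp, cylinderSwapApp_evalAt, e]
  exact ⟨key 0 γ₀ (hΓ _).1, key 1 γ₁ (hΓ _).2⟩

lemma Homotopic.oplusHom {F' G' : GoodEndofunctor.{u}} {γ₀ γ₁ : F ⟶ G} {δ₀ δ₁ : F' ⟶ G'}
    (h : Homotopic γ₀ γ₁) (h' : Homotopic δ₀ δ₁) :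
    Homotopic (bimonoidal.oplusHom γ₀ δ₀) (bimonoidal.oplusHom γ₁ δ₁) := by
  obtain ⟨Γ, hΓ⟩ := homotopic_iff.mp h
  obtain ⟨Δ, hΔ⟩ := homotopic_iff.mp h'
  -- Γ ⊕ Δ ends in GI ⊕ G'I rather than in (G ⊕ G')I. The inverse of right distributivity, whose
  -- components are identities, makes up the difference.
  let R : comp (prod G G') cylinder ⟶ prod (comp G cylinder) (comp G' cylinder) :=
    bimonoidal.distR G G' cylinder
  have hR : ∀ B, (natOf R).app B = 𝟙 _ := natOf_distR_app G G' cylinder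
  have : IsIso R := isIso_distR G G' cylinder
  let S : prod (comp G cylinder) (comp G' cylinder) ⟶ comp (prod G G') cylinder := inv R
  refine homotopic_iff.mpr
    ⟨bimonoidal.oplusHom Γ Δ ≫ S, fun B => ?_⟩
  have hi : (natOf (S)).app B = 𝟙 _ := by
    have h := app_inv_comp R B
    rw [hR] at h
    exact (Category.comp_id _).symm.trans h
  have e : pathApp (G := prod G G')
      (bimonoidal.oplusHom Γ Δ ≫ S) B =
        prodMap (pathApp Γ B) (pathApp Δ B) := by
    refine Eq.trans ?_ (Category.comp_id _)
    exact congrArg (prodMap (pathApp Γ B) (pathApp Δ B) ≫ ·) hi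
  have key : ∀ t (γ : F ⟶ G) (δ : F' ⟶ G'),
      pathApp Γ B ≫ G.functor.map (evalAt t B) = (natOf γ).app B →
      pathApp Δ B ≫ G'.functor.map (evalAt t B) = (natOf δ).app B →
      prodMap (pathApp Γ B) (pathApp Δ B) ≫
        prodMap (G.functor.map (evalAt t B)) (G'.functor.map (evalAt t B)) =
      prodMap ((natOf γ).app B) ((natOf δ).app B) := fun t γ δ e₁ e₂ => by
    rw [← e₁, ← e₂]; rfl
  exact ⟨(congrArg (· ≫ _) e).trans (key 0 γ₀ δ₀ (hΓ B).1 (hΔ B).1),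
    (congrArg (· ≫ _) e).trans (key 1 γ₁ δ₁ (hΓ B).2 (hΔ B).2)⟩

lemma isBimonoidalCongruence_homotopic :
    bimonoidal.{u}.IsBimonoidalCongruence Homotopic where
  equivalence _ _ := ⟨Homotopic.refl, Homotopic.symm, Homotopic.trans⟩
  comp h h' := (h.postcomp _).trans (h'.precomp _)
  otimes {A A' B B' f f' g g'} h h' := by
    -- A horizontal composite is a right whiskering followed by a left one, so the two factors can
    -- be varied one at a time.
    have e : ∀ (f : A ⟶ A') (g : B ⟶ B'),
        bimonoidal.otimesHom f g = compHom f (𝟙 B) ≫ compHom (𝟙 A') g :=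
      fun f g => bimonoidal.mul.tensorHom_def f g
    rw [e, e]
    exact ((h.whiskerRight B).postcomp _).trans ((h'.whiskerLeft A').precomp _)
  oplus h h' := h.oplusHom h'

end GoodEndofunctor

/-! ### Laplaza's axioms when the sum is cartesian -/

namespace BimonoidalData

variable {C : Type u} [Category.{v} C]

/-- Projections that exhibit the additive structure of bimonoidal data as cartesian, the
distributivity morphisms being the canonical ones. -/
structure CartesianProjections (D : BimonoidalData C) where
  /-- First projection. -/
  fst (A B : C) : D.oplus A B ⟶ A
  /-- Second projection. -/
  snd (A B : C) : D.oplus A B ⟶ B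
  hom_ext {X A B : C} {f g : X ⟶ D.oplus A B} :
    f ≫ fst A B = g ≫ fst A B → f ≫ snd A B = g ≫ snd A B → f = g
  zero_ext {X : C} (f g : X ⟶ D.zero) : f = g
  oplusHom_fst {A A' B B' : C} (f : A ⟶ A') (g : B ⟶ B') :
    D.oplusHom f g ≫ fst A' B' = fst A B ≫ f
  oplusHom_snd {A A' B B' : C} (f : A ⟶ A') (g : B ⟶ B') :
    D.oplusHom f g ≫ snd A' B' = snd A B ≫ g
  swap_fst (A B : C) : D.swap A B ≫ fst B A = snd A B
  swap_snd (A B : C) : D.swap A B ≫ snd B A = fst A B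
  assoc_fst (A B E : C) :
    (D.add.associator A B E).hom ≫ fst A (D.oplus B E) = fst (D.oplus A B) E ≫ fst A B
  assoc_snd_fst (A B E : C) :
    (D.add.associator A B E).hom ≫ snd A (D.oplus B E) ≫ fst B E =
      fst (D.oplus A B) E ≫ snd A B
  assoc_snd_snd (A B E : C) :
    (D.add.associator A B E).hom ≫ snd A (D.oplus B E) ≫ snd B E = snd (D.oplus A B) E
  leftUnitor_eq (A : C) : (D.add.leftUnitor A).hom = snd D.zero A
  rightUnitor_eq (A : C) : (D.add.rightUnitor A).hom = fst A D.zero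
  distL_fst (A B B' : C) : D.distL A B B' ≫ fst _ _ = D.otimesHom (𝟙 A) (fst B B')
  distL_snd (A B B' : C) : D.distL A B B' ≫ snd _ _ = D.otimesHom (𝟙 A) (snd B B')
  distR_fst (B B' A : C) : D.distR B B' A ≫ fst _ _ = D.otimesHom (fst B B') (𝟙 A)
  distR_snd (B B' A : C) : D.distR B B' A ≫ snd _ _ = D.otimesHom (snd B B') (𝟙 A)

namespace CartesianProjections

variable {D : BimonoidalData C} (c : D.CartesianProjections)

lemma assoc_inv_fst_fst (A B E : C) :
    (D.add.associator A B E).inv ≫ c.fst (D.oplus A B) E ≫ c.fst A B = c.fst A (D.oplus B E) := by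
  rw [Iso.inv_comp_eq, c.assoc_fst]

lemma assoc_inv_fst_snd (A B E : C) :
    (D.add.associator A B E).inv ≫ c.fst (D.oplus A B) E ≫ c.snd A B =
      c.snd A (D.oplus B E) ≫ c.fst B E := by
  rw [Iso.inv_comp_eq, c.assoc_snd_fst]

lemma assoc_inv_snd (A B E : C) :
    (D.add.associator A B E).inv ≫ c.snd (D.oplus A B) E =
      c.snd A (D.oplus B E) ≫ c.snd B E := by
  rw [Iso.inv_comp_eq, c.assoc_snd_snd]

lemma hom_ext₃ {X A B E : C} {f g : X ⟶ D.oplus A (D.oplus B E)}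
    (h₁ : f ≫ c.fst A _ = g ≫ c.fst A _)
    (h₂ : f ≫ c.snd A _ ≫ c.fst B E = g ≫ c.snd A _ ≫ c.fst B E)
    (h₃ : f ≫ c.snd A _ ≫ c.snd B E = g ≫ c.snd A _ ≫ c.snd B E) : f = g :=
  c.hom_ext h₁ (c.hom_ext (by simpa using h₂) (by simpa using h₃))

/-- This and the next three lemmas determine `interchange` by its four coordinates: it exchanges the
two middle summands. -/
lemma interchange_fst_fst (A B A' B' : C) :
    D.interchange A B A' B' ≫ c.fst _ _ ≫ c.fst _ _ = c.fst _ _ ≫ c.fst _ _ := by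
  simp only [interchange, Category.assoc, c.assoc_inv_fst_fst, c.oplusHom_fst, Category.comp_id,
    c.assoc_fst]

lemma interchange_fst_snd (A B A' B' : C) :
    D.interchange A B A' B' ≫ c.fst _ _ ≫ c.snd _ _ = c.snd _ _ ≫ c.fst _ _ := by
  simp only [interchange, Category.assoc, c.assoc_inv_fst_snd, reassoc_of% c.oplusHom_snd,
    c.assoc_fst, reassoc_of% c.oplusHom_fst, c.swap_fst, reassoc_of% c.assoc_snd_snd]

lemma interchange_snd_fst (A B A' B' : C) :
    D.interchange A B A' B' ≫ c.snd _ _ ≫ c.fst _ _ = c.fst _ _ ≫ c.snd _ _ := by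
  simp only [interchange, Category.assoc, reassoc_of% c.assoc_inv_snd, reassoc_of% c.oplusHom_snd,
    c.assoc_snd_fst, reassoc_of% c.oplusHom_fst, c.swap_snd, c.assoc_inv_fst_fst]

lemma interchange_snd_snd (A B A' B' : C) :
    D.interchange A B A' B' ≫ c.snd _ _ ≫ c.snd _ _ = c.snd _ _ ≫ c.snd _ _ := by
  simp only [interchange, Category.assoc, reassoc_of% c.assoc_inv_snd, reassoc_of% c.oplusHom_snd,
    c.assoc_snd_snd, c.oplusHom_snd, Category.comp_id, c.assoc_inv_snd,
    reassoc_of% c.assoc_snd_snd]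

/-- Bimonoidal data whose additive structure is cartesian, with the canonical distributivity
morphisms, form a tight bimonoidal category as soon as the canonical morphisms are invertible. -/
lemma isTightBimonoidal (c : D.CartesianProjections)
    (h₁ : ∀ A, IsIso (D.zeroMul A)) (h₂ : ∀ A, IsIso (D.mulZero A))
    (h₃ : ∀ A B B', IsIso (D.distL A B B')) (h₄ : ∀ B B' A, IsIso (D.distR B B' A)) :
    D.IsTightBimonoidal where
  distL_isIso := h₃
  distR_isIso := h₄
  zeroMul_isIso := h₁
  mulZero_isIso := h₂
  distL_mono A B B' := inferInstance
  distR_mono A B B' := inferInstance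
  zeroMul_naturality _ := c.zero_ext _ _
  mulZero_naturality _ := c.zero_ext _ _
  -- The same argument serves for all axioms on distributivity: after projection to a coordinate,
  -- each distributivity morphism becomes a product of an identity with a projection, and
  -- functoriality of ⊗ or naturality of its structure maps remains. The axioms with values in the
  -- zero object hold because that object is terminal.
  distL_naturality f g g' := by
    apply c.hom_ext <;>
    simp only [Category.assoc, c.distL_fst, c.distL_snd, reassoc_of% c.distL_fst,
      reassoc_of% c.distL_snd, c.oplusHom_fst, c.oplusHom_snd, D.mul.tensorHom_comp_tensorHom,
      Category.comp_id, Category.id_comp]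
  distR_naturality f g g' := by
    apply c.hom_ext <;>
    simp only [Category.assoc, c.distR_fst, c.distR_snd, reassoc_of% c.distR_fst,
      reassoc_of% c.distR_snd, c.oplusHom_fst, c.oplusHom_snd, D.mul.tensorHom_comp_tensorHom,
      Category.comp_id, Category.id_comp]
  distL_swap A B B' := by
    apply c.hom_ext <;>
    simp only [Category.assoc, c.distL_fst, c.distL_snd, c.swap_fst, c.swap_snd,
      D.mul.tensorHom_comp_tensorHom, Category.comp_id]
  distR_swap B B' A := by
    apply c.hom_ext <;>
    simp only [Category.assoc, c.distR_fst, c.distR_snd, c.swap_fst, c.swap_snd,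
      D.mul.tensorHom_comp_tensorHom, Category.comp_id]
  distR_addAssoc A B B' B'' := by
    apply c.hom_ext₃ <;>
    simp only [Category.assoc, c.distR_fst, c.distR_snd, reassoc_of% c.distR_fst,
      reassoc_of% c.distR_snd, c.oplusHom_fst, c.oplusHom_snd, reassoc_of% c.oplusHom_fst,
      reassoc_of% c.oplusHom_snd, c.assoc_fst, c.assoc_snd_fst, c.assoc_snd_snd,
      D.mul.tensorHom_comp_tensorHom, Category.comp_id]
  distL_addAssoc A B B' B'' := by
    apply c.hom_ext₃ <;>
    simp only [Category.assoc, c.distL_fst, c.distL_snd, reassoc_of% c.distL_fst,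
      reassoc_of% c.distL_snd, c.oplusHom_fst, c.oplusHom_snd, reassoc_of% c.oplusHom_fst,
      reassoc_of% c.oplusHom_snd, c.assoc_fst, c.assoc_snd_fst, c.assoc_snd_snd,
      D.mul.tensorHom_comp_tensorHom, Category.comp_id]
  distL_mulAssoc A A' B B' := by
    apply c.hom_ext <;>
    simp only [Category.assoc, c.distL_fst, c.distL_snd, reassoc_of% c.distL_fst,
      reassoc_of% c.distL_snd, c.oplusHom_fst, c.oplusHom_snd,
      D.mul.tensorHom_comp_tensorHom, Category.comp_id, ← D.mul.associator_naturality,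
      D.mul.id_tensorHom_id]
  distR_mulAssoc B B' A A' := by
    apply c.hom_ext <;>
    simp only [Category.assoc, c.distR_fst, c.distR_snd, reassoc_of% c.distR_fst,
      reassoc_of% c.distR_snd, c.oplusHom_fst, c.oplusHom_snd,
      reassoc_of% D.mul.tensorHom_comp_tensorHom, Category.comp_id, D.mul.associator_naturality,
      ← D.mul.id_tensorHom_id]
  dist_mulAssoc A B B' A' := by
    apply c.hom_ext <;>
    simp only [Category.assoc, c.distR_fst, c.distR_snd, reassoc_of% c.distR_fst,
      reassoc_of% c.distR_snd, c.distL_fst, c.distL_snd, c.oplusHom_fst, c.oplusHom_snd,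
      reassoc_of% D.mul.tensorHom_comp_tensorHom, D.mul.tensorHom_comp_tensorHom,
      Category.comp_id, D.mul.associator_naturality]
  dist_interchange A A' B B' := by
    have e₁ := c.interchange_fst_fst (D.otimes A B) (D.otimes A B') (D.otimes A' B) (D.otimes A' B')
    have e₂ := c.interchange_fst_snd (D.otimes A B) (D.otimes A B') (D.otimes A' B) (D.otimes A' B')
    have e₃ := c.interchange_snd_fst (D.otimes A B) (D.otimes A B') (D.otimes A' B) (D.otimes A' B')
    have e₄ := c.interchange_snd_snd (D.otimes A B) (D.otimes A B') (D.otimes A' B) (D.otimes A' B')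
    -- Only the coordinates of `interchange` are used from here on; generalizing makes it opaque to
    -- `simp`.
    generalize D.interchange (D.otimes A B) (D.otimes A B') (D.otimes A' B) (D.otimes A' B') = m
      at e₁ e₂ e₃ e₄ ⊢
    apply c.hom_ext <;> apply c.hom_ext <;>
    simp only [Category.assoc, c.distR_fst, c.distR_snd, reassoc_of% c.distR_fst,
      reassoc_of% c.distR_snd, c.distL_fst, c.distL_snd, reassoc_of% c.distL_fst,
      reassoc_of% c.distL_snd, c.oplusHom_fst, c.oplusHom_snd, reassoc_of% c.oplusHom_fst,
      reassoc_of% c.oplusHom_snd, e₁, e₂, e₃, e₄,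
      D.mul.tensorHom_comp_tensorHom, Category.comp_id, Category.id_comp]
  zeroMul_zero := c.zero_ext _ _
  zeroMul_oplus _ _ := c.zero_ext _ _
  mulZero_oplus _ _ := c.zero_ext _ _
  zeroMul_one := c.zero_ext _ _
  mulZero_one := c.zero_ext _ _
  zeroMul_otimes _ _ := c.zero_ext _ _
  mulZero_zeroMul _ _ := c.zero_ext _ _
  mulZero_otimes _ _ := c.zero_ext _ _
  distL_zero_left A B := by
    simp only [c.leftUnitor_eq, c.oplusHom_snd, Category.comp_id, c.distL_snd]
  distR_zero_left A B := by
    simp only [c.leftUnitor_eq, c.oplusHom_snd, Category.comp_id, c.distR_snd]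
  distL_zero_right A B := by
    simp only [c.rightUnitor_eq, c.oplusHom_fst, Category.comp_id, c.distL_fst]
  distR_zero_right A B := by
    simp only [c.rightUnitor_eq, c.oplusHom_fst, Category.comp_id, c.distR_fst]
  distL_one A B := by
    apply c.hom_ext <;>
    simp only [Category.assoc, c.oplusHom_fst, c.oplusHom_snd, reassoc_of% c.distL_fst,
      reassoc_of% c.distL_snd, D.mul.id_tensorHom, D.mul.leftUnitor_naturality]
  distR_one A B := by
    apply c.hom_ext <;>
    simp only [Category.assoc, c.oplusHom_fst, c.oplusHom_snd, reassoc_of% c.distR_fst,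
      reassoc_of% c.distR_snd, D.mul.tensorHom_id, D.mul.rightUnitor_naturality]

end CartesianProjections

end BimonoidalData

/-! ### Tightness and strictness for good endofunctors -/

namespace GoodEndofunctor

/-- The projections of the pointwise product of good endofunctors. -/
def cartesianProjections : bimonoidal.{u}.CartesianProjections where
  fst := prodFst
  snd := prodSnd
  hom_ext h₁ h₂ := hom_ext fun B => prod_ext
    (congrArg (fun α => (natOf α).app B) h₁) (congrArg (fun α => (natOf α).app B) h₂)
  zero_ext _ _ := hom_ext fun _ => CStarAlg.zero_ext _ _
  -- The cartesian structure is built from `prodFst`, `prodSnd` and `prodLift`, so the remaining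
  -- identities hold by unfolding.
  oplusHom_fst _ _ := rfl
  oplusHom_snd _ _ := rfl
  swap_fst _ _ := rfl
  swap_snd _ _ := rfl
  assoc_fst _ _ _ := rfl
  assoc_snd_fst _ _ _ := rfl
  assoc_snd_snd _ _ _ := rfl
  leftUnitor_eq _ := rfl
  rightUnitor_eq _ := rfl
  distL_fst _ _ _ := rfl
  distL_snd _ _ _ := rfl
  distR_fst _ _ _ := rfl
  distR_snd _ _ _ := rfl

lemma isIso_zeroMul (F : GoodEndofunctor.{u}) : IsIso (bimonoidal.zeroMul F) :=
  isIso_of_app _ fun _ => (isIso_toZero_iff _).mpr (inferInstanceAs (Subsingleton PUnit))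

/-- The components are F 0 → 0, so this is the condition F 0 ≅ 0. -/
lemma isIso_mulZero (F : GoodEndofunctor.{u}) : IsIso (bimonoidal.mulZero F) :=
  isIso_of_app _ fun _ => F.decent.map_zero

lemma isTightBimonoidal : bimonoidal.{u}.IsTightBimonoidal :=
  cartesianProjections.isTightBimonoidal isIso_zeroMul isIso_mulZero isIso_distL isIso_distR

/-- For α with identity components, compatibility with the labelings says that the two labelings
coincide. All other fields are propositions, so the objects are equal and α is the identity. -/
lemma exists_eqToHom {F G : GoodEndofunctor.{u}} (α : F ⟶ G) (hF : F.functor = G.functor)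
    (hα : natOf α = eqToHom hF) : ∃ h : F = G, α = eqToHom h := by
  obtain ⟨⟨F, l, _, _, _, _⟩, _⟩ := F
  obtain ⟨⟨G, l', _, _, _, _⟩, _⟩ := G
  obtain rfl : F = G := hF
  have hl : l = l' := by
    funext A B
    have h := label_comm α A B
    rw [hα] at h
    simpa using h
  subst hl
  exact ⟨rfl, Hom.ext hα⟩

/-- The underlying functors agree by definition, while the labelings agree only by functoriality and
the unit laws. The equality of objects is therefore extracted from the structure isomorphisms, by
`exists_eqToHom`. -/
lemma isMulStrict : bimonoidal.{u}.IsMulStrict where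
  assoc _ _ _ := exists_eqToHom _ rfl rfl
  one_mul _ := exists_eqToHom _ rfl rfl
  mul_one _ := exists_eqToHom _ rfl rfl

end GoodEndofunctor

/-! ### Passage to the quotient category -/

namespace BimonoidalData

variable {C : Type u} [Category.{v} C] {r : HomRel C} {D : BimonoidalData C}

lemma IsTightBimonoidal.quotient (hD : D.IsTightBimonoidal) (h : D.IsBimonoidalCongruence r) :
    (D.quotient h).IsTightBimonoidal := by
  have iso : ∀ {X Y : C} (f : X ⟶ Y), IsIso f → IsIso ((Quotient.functor r).map f) :=
    fun f _ => inferInstance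
  have e : ∀ {X Y : C} {f g : X ⟶ Y}, f = g →
      (Quotient.functor r).map f = (Quotient.functor r).map g := fun h => congrArg _ h
  -- Monomorphisms need not remain monic in a quotient category, but isomorphisms remain invertible.
  -- So tightness of D is what supplies the monomorphism axioms. The equations pass to classes, with
  -- naturality checked on representatives.
  have hL : ∀ A B B', IsIso ((D.quotient h).distL A B B') := fun A B B' =>
    iso _ (hD.distL_isIso A.as B.as B'.as)
  have hR : ∀ B B' A, IsIso ((D.quotient h).distR B B' A) := fun B B' A =>
    iso _ (hD.distR_isIso B.as B'.as A.as)
  exact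
  { distL_isIso := hL
    distR_isIso := hR
    distL_mono := fun A B B' => inferInstance
    distR_mono := fun A B B' => inferInstance
    zeroMul_isIso := fun A => iso _ (hD.zeroMul_isIso A.as)
    mulZero_isIso := fun A => iso _ (hD.mulZero_isIso A.as)
    zeroMul_naturality := by
      rintro _ _ ⟨f⟩
      exact e (hD.zeroMul_naturality f)
    mulZero_naturality := by
      rintro _ _ ⟨f⟩
      exact e (hD.mulZero_naturality f)
    distL_naturality := by
      rintro _ _ _ _ _ _ ⟨f⟩ ⟨g⟩ ⟨g'⟩
      exact e (hD.distL_naturality f g g')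
    distR_naturality := by
      rintro _ _ _ _ _ _ ⟨f⟩ ⟨g⟩ ⟨g'⟩
      exact e (hD.distR_naturality f g g')
    distL_swap := fun _ _ _ => e (hD.distL_swap _ _ _)
    distR_swap := fun _ _ _ => e (hD.distR_swap _ _ _)
    distR_addAssoc := fun _ _ _ _ => e (hD.distR_addAssoc _ _ _ _)
    distL_addAssoc := fun _ _ _ _ => e (hD.distL_addAssoc _ _ _ _)
    distL_mulAssoc := fun _ _ _ _ => e (hD.distL_mulAssoc _ _ _ _)
    distR_mulAssoc := fun _ _ _ _ => e (hD.distR_mulAssoc _ _ _ _)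
    dist_mulAssoc := fun _ _ _ _ => e (hD.dist_mulAssoc _ _ _ _)
    dist_interchange := fun _ _ _ _ => e (hD.dist_interchange _ _ _ _)
    zeroMul_zero := e hD.zeroMul_zero
    zeroMul_oplus := fun _ _ => e (hD.zeroMul_oplus _ _)
    mulZero_oplus := fun _ _ => e (hD.mulZero_oplus _ _)
    zeroMul_one := e hD.zeroMul_one
    mulZero_one := e hD.mulZero_one
    zeroMul_otimes := fun _ _ => e (hD.zeroMul_otimes _ _)
    mulZero_zeroMul := fun _ _ => e (hD.mulZero_zeroMul _ _)
    mulZero_otimes := fun _ _ => e (hD.mulZero_otimes _ _)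
    distL_zero_left := fun _ _ => e (hD.distL_zero_left _ _)
    distR_zero_left := fun _ _ => e (hD.distR_zero_left _ _)
    distL_zero_right := fun _ _ => e (hD.distL_zero_right _ _)
    distR_zero_right := fun _ _ => e (hD.distR_zero_right _ _)
    distL_one := fun _ _ => e (hD.distL_one _ _)
    distR_one := fun _ _ => e (hD.distR_one _ _) }

lemma map_quotient_eq_eqToHom {X Y : C} {f : X ⟶ Y} (h : ∃ h : X = Y, f = eqToHom h) :
    ∃ h : (Quotient.functor r).obj X = (Quotient.functor r).obj Y,
      (Quotient.functor r).map f = eqToHom h := by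
  obtain ⟨rfl, rfl⟩ := h
  exact ⟨rfl, CategoryTheory.Functor.map_id _ _⟩

lemma IsMulStrict.quotient (hD : D.IsMulStrict) (h : D.IsBimonoidalCongruence r) :
    (D.quotient h).IsMulStrict where
  assoc _ _ _ := map_quotient_eq_eqToHom (hD.assoc _ _ _)
  one_mul _ := map_quotient_eq_eqToHom (hD.one_mul _)
  mul_one _ := map_quotient_eq_eqToHom (hD.mul_one _)

end BimonoidalData

end

theorem proposition4p51 :
    GoodEndofunctor.bimonoidal.{u}.IsTightBimonoidal ∧
    GoodEndofunctor.bimonoidal.{u}.IsMulStrict ∧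
    ∃ h : GoodEndofunctor.bimonoidal.{u}.IsBimonoidalCongruence GoodEndofunctor.Homotopic,
      (GoodEndofunctor.bimonoidal.quotient h).IsTightBimonoidal ∧
      (GoodEndofunctor.bimonoidal.quotient h).IsMulStrict :=
  ⟨GoodEndofunctor.isTightBimonoidal, GoodEndofunctor.isMulStrict,
    GoodEndofunctor.isBimonoidalCongruence_homotopic,
    GoodEndofunctor.isTightBimonoidal.quotient _, GoodEndofunctor.isMulStrict.quotient _⟩
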